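/- **Setting.** Let $\mathcal X$ be a measurable space, $\mathcal A$ a finite set of $A\ge 1$ actions, $H,K\ge 1$, and consider a Markov decision process with transition kernels $P_h:\mathcal X\times\mathcal A\to\Delta(\mathcal X)$ and cost kernels $C_h:\mathcal X\times\mathcal A\to\Delta([0,1])$, $h\in[H]$, such that under every policy and from every initial state the cumulative cost lies in $[0,1]$ almost surely. A policy $\pi=(\pi_h)_h$ consists of kernels $\pi_h:\mathcal X\to\Delta(\mathcal A)$. From $x_1$ it generates $a_h\sim\pi_h(x_h)$, $c_h\sim C_h(x_h,a_h)$, $x_{h+1}\sim P_h(x_h,a_h)$, with $c_h$ and $x_{h+1}$ independent given $(x_h,a_h)$. Put $Z^\pi(x_1)=\sum_{h=1}^H c_h$, $V^\pi(x_1)=\mathbb E[Z^\pi(x_1)]$, $V^\star(x_1)=\inf_\pi V^\pi(x_1)$, and let $d^{\pi,x_1}_h$ be the law of $(x_h,a_h)$. Let $\lambda$ be a $\sigma$-finite measure concentrated on $[0,1]$, and let $\mathcal F=\mathcal F_1\times\dots\times\mathcal F_H$ where each $\mathcal F_h$ is a finite nonempty set of conditional probability densities $f_h(\cdot\mid x,a)$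 with respect to $\lambda$; put $f_{H+1}=\delta_0$ and $\mathcal F_{H+1}=\{\delta_0\}$. A bar denotes the mean of a distribution. Fix a measurable tie-breaking rule for $\operatorname{argmin}$ over $\mathcal A$. For a conditional distribution $d$, $\mathcal T^{\pi,D}_h d(x,a)$ is the law of $c+y$, where $c\sim C_h(x,a)$ and, independently, $x'\sim P_h(x,a)$, $a'\sim\pi_{h+1}(x')$, $y\sim d(x',a')$; $\mathcal T^{\star,D}_h d$ is the same with $a'=\operatorname{argmin}_a\bar d(x',a)$. Let $D_\triangle(p\,\|\,q)=\int\frac{(p-q)^2}{p+q}\,d\lambda$. Let $\Pi$ be a set of policies that contains the greedy policy $x\mapsto \operatorname{argmin}_a\bar f_h(x,a)$ ($h\in[H]$) of every $f\in\mathcal F$. Assume *distributional Bellman completeness*: $\mathcal T_h^{\pi,D}f_{h+1}\in\mathcal F_h$ for all $\pi\in\Pi$, $h\in[H]$, $f_{h+1}\in\mathcal F_{h+1}$. **Eluder dimension.** For a set $\Psi$ of functions $\mathcal S\to\mathbb R$, a set $\mathfrak D$ of distributions on $\mathcal S$ and $\varepsilon_0>0$, $\dim(\Psi,\mathfrak D,\varepsilon_0)$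 is the supremum of the lengths $L$ of sequences $d^{(1)},\dots,d^{(L)}\in\mathfrak D$ for which there is $\varepsilon\ge\varepsilon_0$ such that for every $t\le L$ some $\psi\in\Psi$ has $|\mathbb E_{d^{(t)}}\psi|>\varepsilon$ and $\sum_{i<t}|\mathbb E_{d^{(i)}}\psi|\le\varepsilon$. With $\psi_{f,h}(x,a)=D_\triangle(f_h(x,a)\,\|\,\mathcal T_h^{\star,D}f_{h+1}(x,a))$, let $$d_{\mathrm{RL}}=\max_h\dim\big(\{\psi_{f,h}:f\in\mathcal F\},\{d_h^{\pi,x_1}:\pi\in\Pi,x_1\in\mathcal X\},\tfrac1K\big),$$ and let $d_{\mathrm{RL,V}}$ be the same with the functions $x\mapsto\frac1A\sum_a\psi_{f,h}(x,a)$ and the laws of $x_h$ under $\pi$ from $x_1$, $\pi\in\Pi$, $x_1\in\mathcal X$. **Algorithm (O-DISCO).** Let $\delta\in(0,1)$ and $\beta=\log(HK|\mathcal F|/\delta)$. In episode $k=1,\dots,K$ an adaptive adversary reveals $x_{1,k}$. Let $\mathcal F_{k-1}$ be the set of $f\in\mathcal F$ such that for all $h$ and all $g\in\mathcal F_h$,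 $\sum_{i<k}\log f_h(z^f_{h,i}\mid x_{h,i},a_{h,i})\ge\sum_{i<k}\log g(z^f_{h,i}\mid x_{h,i},a_{h,i})-\beta$ (with $\log 0=-\infty$). The learner chooses $f^{(k)}\in\operatorname{argmin}_{f\in\mathcal F_{k-1}}\min_a\bar f_1(x_{1,k},a)$ (any $f^{(k)}\in\mathcal F$ if $\mathcal F_{k-1}$ is empty) and lets $\pi^k$ be the greedy policy of $f^{(k)}$. Without uniform action exploration (UAE), it runs $\pi^k$ from $x_{1,k}$ and records the transitions $(x_{h,k},a_{h,k},c_{h,k},x'_{h,k})$, $h\in[H]$, of the trajectory. With UAE, for each $h$ it makes a separate rollout of $\pi^k$ from $x_{1,k}$ up to $x_{h,k}$, draws $a_{h,k}$ uniformly from $\mathcal A$, and records $c_{h,k}\sim C_h(x_{h,k},a_{h,k})$, $x'_{h,k}\sim P_h(x_{h,k},a_{h,k})$. For $f\in\mathcal F$ it sets $z^f_{h,k}=c_{h,k}+y$ with $y\sim f_{h+1}(x'_{h,k},a')$, $a'=\operatorname{argmin}_a\bar f_{h+1}(x'_{h,k},a)$. The output $\bar\pi$ draws $k\in[K]$ uniformly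 and runs $\pi^k$. **Theorem.** There is a universal constant $c>0$ such that in this setting, with $L=1+\log K$: 1. Without UAE, if $d_{\mathrm{RL}}<\infty$ and $d=\max(1,d_{\mathrm{RL}})$, then with probability at least $1-\delta$, $$\sum_{k=1}^K\big(V^{\pi^k}(x_{1,k})-V^\star(x_{1,k})\big)\le c\Big(H\sqrt{\textstyle\sum_{k=1}^K\operatorname{Var}(Z^{\pi^k}(x_{1,k}))\cdot d\,\beta L}+H^{2.5}d\,\beta L\Big).$$ 2. With UAE, if $d_{\mathrm{RL,V}}<\infty$ and $d=\max(1,d_{\mathrm{RL,V}})$, then with probability at least $1-\delta$, $$\sum_{k=1}^K\big(V^{\pi^k}(x_{1,k})-V^\star(x_{1,k})\big)\le c\Big(H\sqrt{A\textstyle\sum_{k=1}^K\operatorname{Var}(Z^{\pi^k}(x_{1,k}))\cdot d\,\beta L}+A H^{2.5}d\,\beta L\Big),$$ and, if all initial states equal one state $x_1$, $K\big(V^{\bar\pi}(x_1)-V^\star(x_1)\big)$ is at most the same right-hand side. -/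

import Mathlib

open MeasureTheory ProbabilityTheory
open scoped ENNReal NNReal

noncomputable section

namespace DistRL

/-- One observed transition `((x_h, a_h), c_h, x_{h+1})`. -/
abbrev Step (X A : Type*) := (X × A) × ℝ × X

/-- Markov decision process with transition kernels `P_h` and cost distributions `C_h` on `[0,1]`.
Steps are numbered from `0`; with horizon `H` only the steps `h < H` are ever used. -/
structure MDP (X A : Type*) [MeasurableSpace X] [MeasurableSpace A] where
  P : ℕ → Kernel (X × A) X
  C : ℕ → Kernel (X × A) ℝ
  markovP : ∀ h, IsMarkovKernel (P h)
  markovC : ∀ h, IsMarkovKernel (C h)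
  cost_mem : ∀ h xa, ∀ᵐ c ∂(C h xa), c ∈ Set.Icc (0 : ℝ) 1

attribute [instance] MDP.markovP MDP.markovC

/-- A (time-dependent, randomized) Markov policy. -/
structure Policy (X A : Type*) [MeasurableSpace X] [MeasurableSpace A] where
  kern : ℕ → Kernel X A
  markov : ∀ h, IsMarkovKernel (kern h)

attribute [instance] Policy.markov

/-- A fixed tie-breaking rule for `argmin_a q(a)`. -/
structure ArgminRule (A : Type*) [MeasurableSpace A] where
  act : (A → ℝ) → A
  measurable_act : Measurable act
  act_le : ∀ (q : A → ℝ) (a : A), q (act q) ≤ q a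

section Rollout

variable {X A : Type*} [MeasurableSpace X] [MeasurableSpace A]

/-- From state `x`: draw `a ∼ ρ(x)`, then, independently, `c ∼ C_h(x,a)` and `x' ∼ P_h(x,a)`. -/
def MDP.stepKernel (M : MDP X A) (h : ℕ) (ρ : Kernel X A) : Kernel X (Step X A) :=
  (Kernel.id ×ₖ (M.C h ×ₖ M.P h)) ∘ₖ (Kernel.id ×ₖ ρ)

/-- The law of the trajectory of `n` steps obtained by rolling in `π` from a state at step `h`. -/
def MDP.roll (M : MDP X A) (π : Policy X A) :
    (n : ℕ) → ℕ → Kernel X (Fin n → Step X A)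
  | 0, _ => Kernel.const X (Measure.dirac Fin.elim0)
  | n + 1, h =>
      ((M.stepKernel h (π.kern h)) ⊗ₖ
        ((MDP.roll M π n (h + 1)).comap (fun p : X × Step X A => p.2.2.2)
          (measurable_snd.comp (measurable_snd.comp measurable_snd)))).map
        (fun p => Fin.cons (α := fun _ => Step X A) p.1 p.2)

/-- The return `∑_h c_h` of a trajectory. -/
def ret {n : ℕ} (τ : Fin n → Step X A) : ℝ := ∑ i, (τ i).2.1

/-- `V^π(x₁)`. -/
def MDP.value (M : MDP X A) (H : ℕ) (π : Policy X A) (x : X) : ℝ :=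
  ∫ τ, ret τ ∂(M.roll π H 0 x)

/-- `Var(Z^π(x₁))`. -/
def MDP.returnVar (M : MDP X A) (H : ℕ) (π : Policy X A) (x : X) : ℝ :=
  variance ret (M.roll π H 0 x)

/-- `V^⋆(x₁)`. -/
def MDP.optValue (M : MDP X A) (H : ℕ) (x : X) : ℝ :=
  ⨅ π : Policy X A, M.value H π x

/-- `V^{π̄}(x₁)` for the mixture policy that draws `k` uniformly among `0, …, K-1` and runs `π^k`. -/
def MDP.mixtureValue (M : MDP X A) (H K : ℕ) (π : ℕ → Policy X A) (x : X) : ℝ :=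
  ∫ τ, ret τ ∂((K : ℝ≥0∞)⁻¹ • ∑ k ∈ Finset.range K, M.roll (π k) H 0 x)

/-- Cumulative costs lie in `[0,1]` almost surely. -/
def MDP.Normalized (M : MDP X A) (H : ℕ) : Prop :=
  ∀ (π : Policy X A) (x : X), ∀ᵐ τ ∂(M.roll π H 0 x), ret τ ∈ Set.Icc (0 : ℝ) 1

/-- The state-action distribution `d^π_h` when starting from `x₁`. -/
def MDP.occ (M : MDP X A) {H : ℕ} (π : Policy X A) (h : Fin H) : Kernel X (X × A) :=
  (M.roll π H 0).map (fun τ => (τ h).1)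

/-- The state distribution `d^π_h` when starting from `x₁`. -/
def MDP.stateOcc (M : MDP X A) {H : ℕ} (π : Policy X A) (h : Fin H) : Kernel X X :=
  (M.roll π H 0).map (fun τ => (τ h).1.1)

/-- Roll in `π` up to step `h`, then take a uniformly random action. -/
def MDP.uaeKernel (M : MDP X A) [Fintype A] [Nonempty A] {H : ℕ} (π : Policy X A) (h : Fin H) :
    Kernel X (Step X A) :=
  (M.stepKernel h.val (Kernel.const X (PMF.uniformOfFintype A).toMeasure)) ∘ₖ (M.stateOcc π h)

/-- The law of the data of one episode: a trajectory of `π` from `x` without uniform action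
exploration; one separate rollout for each step with it. -/
def MDP.episodeLaw (M : MDP X A) [Fintype A] [Nonempty A] (H : ℕ) (uae : Bool)
    (π : Policy X A) (x : X) : Measure (Fin H → Step X A) :=
  if uae then Measure.pi (fun h => M.uaeKernel π h x) else M.roll π H 0 x

lemma measurable_cons (n : ℕ) :
    Measurable (fun p : Step X A × (Fin n → Step X A) =>
      (Fin.cons (α := fun _ => Step X A) p.1 p.2 : Fin (n + 1) → Step X A)) := by
  refine measurable_pi_iff.2 fun i => ?_
  refine Fin.cases ?_ (fun j => ?_) i
  · simpa using measurable_fst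
  · simp only [Fin.cons_succ]; fun_prop

instance (M : MDP X A) (h : ℕ) (ρ : Kernel X A) [IsMarkovKernel ρ] :
    IsMarkovKernel (M.stepKernel h ρ) := by
  unfold MDP.stepKernel; infer_instance

instance MDP.isMarkovKernel_roll (M : MDP X A) (π : Policy X A) (n : ℕ) :
    ∀ h, IsMarkovKernel (M.roll π n h) := by
  induction n with
  | zero => intro h; unfold MDP.roll; infer_instance
  | succ n ih =>
      intro h
      have := ih (h + 1)
      unfold MDP.roll
      exact Kernel.IsMarkovKernel.map _ (measurable_cons n)

end Rollout

/-- A conditional distribution `X × A → Δ([0,1])`, given by its density with respect to the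
dominating measure `lam`. -/
structure CondDens (X A : Type*) [MeasurableSpace X] [MeasurableSpace A] (lam : Measure ℝ) where
  dens : X × A → ℝ → ℝ≥0
  measurable_dens : Measurable (Function.uncurry dens)
  lintegral_eq_one : ∀ xa, ∫⁻ y, (dens xa y : ℝ≥0∞) ∂lam = 1

section Bellman

variable {X A : Type*} [MeasurableSpace X] [MeasurableSpace A]

/-- The conditional distribution itself, as a kernel. -/
def CondDens.law {lam : Measure ℝ} [SFinite lam] (f : CondDens X A lam) : Kernel (X × A) ℝ :=
  Kernel.withDensity (Kernel.const (X × A) lam) (fun xa y => (f.dens xa y : ℝ≥0∞))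

/-- The mean `d̄(x,a)`. -/
def mean (d : Kernel (X × A) ℝ) (x : X) (a : A) : ℝ := ∫ y, y ∂(d (x, a))

lemma measurable_mean (d : Kernel (X × A) ℝ) : Measurable (fun x a => mean d x a) := by
  have h : Measurable (fun xa => ∫ y, y ∂(d xa)) :=
    (StronglyMeasurable.integral_kernel (κ := d) (f := fun y : ℝ => y)
      stronglyMeasurable_id).measurable
  exact measurable_pi_iff.2 fun a => h.comp (measurable_id.prodMk measurable_const)

/-- `argmin_a d̄(x,a)`. -/
def greedyAct (am : ArgminRule A) (d : Kernel (X × A) ℝ) (x : X) : A := am.act (mean d x)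

/-- The deterministic kernel `x ↦ argmin_a d̄(x,a)`. -/
def greedyKernel (am : ArgminRule A) (d : Kernel (X × A) ℝ) : Kernel X A :=
  Kernel.deterministic (greedyAct am d) (am.measurable_act.comp (measurable_mean d))

instance (am : ArgminRule A) (d : Kernel (X × A) ℝ) : IsMarkovKernel (greedyKernel am d) :=
  Kernel.isMarkovKernel_deterministic _

/-- The law of `c + y` where `c ∼ C_h(x,a)`, `x' ∼ P_h(x,a)`, `a' ∼ ρ(x')`, `y ∼ d(x',a')`. -/
def MDP.bellman (M : MDP X A) (h : ℕ) (ρ : Kernel X A) (d : Kernel (X × A) ℝ) :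
    Kernel (X × A) ℝ :=
  (M.C h ×ₖ (d ∘ₖ ((Kernel.id ×ₖ ρ) ∘ₖ M.P h))).map (fun p : ℝ × ℝ => p.1 + p.2)

/-- The distributional Bellman operator `T_h^{π,D}`. -/
def MDP.bellmanPolicy (M : MDP X A) (π : Policy X A) (h : ℕ) (d : Kernel (X × A) ℝ) :
    Kernel (X × A) ℝ :=
  M.bellman h (π.kern (h + 1)) d

/-- The distributional Bellman optimality operator `T_h^{⋆,D}`. -/
def MDP.bellmanOpt (M : MDP X A) (am : ArgminRule A) (h : ℕ) (d : Kernel (X × A) ℝ) :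
    Kernel (X × A) ℝ :=
  M.bellman h (greedyKernel am d) d

/-- Triangular discrimination of two distributions with densities with respect to `lam`. -/
def triDisc (lam μ ν : Measure ℝ) : ℝ :=
  ∫ y, ((μ.rnDeriv lam y).toReal - (ν.rnDeriv lam y).toReal) ^ 2 /
    ((μ.rnDeriv lam y).toReal + (ν.rnDeriv lam y).toReal) ∂lam

variable {lam : Measure ℝ} [SFinite lam] {H : ℕ}

/-- `f_n` as a kernel, with the terminal convention `f_H = δ_0` (steps are `0, …, H-1`). -/
def lawAt (f : Fin H → CondDens X A lam) (n : ℕ) : Kernel (X × A) ℝ :=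
  if hn : n < H then (f ⟨n, hn⟩).law else Kernel.const (X × A) (Measure.dirac 0)

/-- The greedy policy `π_h(x) = argmin_a f̄_h(x,a)`. -/
def greedyPolicy (am : ArgminRule A) (f : Fin H → CondDens X A lam) : Policy X A where
  kern h := greedyKernel am (lawAt f h)
  markov _ := inferInstance

/-- The product class `F = F_0 × ⋯ × F_{H-1}`. -/
def tuples (F : Fin H → Finset (CondDens X A lam)) : Set (Fin H → CondDens X A lam) :=
  {f | ∀ h, f h ∈ F h}

/-- The class `F_n` as a set of kernels, with `F_H = {δ_0}`. -/
def lawClass (F : Fin H → Finset (CondDens X A lam)) (n : ℕ) : Set (Kernel (X × A) ℝ) :=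
  if hn : n < H then {d | ∃ g ∈ F ⟨n, hn⟩, d = g.law}
  else {Kernel.const (X × A) (Measure.dirac 0)}

/-- Distributional Bellman completeness over the policy class `Pol`. -/
def BellmanComplete (M : MDP X A) (Pol : Set (Policy X A))
    (F : Fin H → Finset (CondDens X A lam)) : Prop :=
  ∀ π ∈ Pol, ∀ h < H, ∀ d ∈ lawClass F (h + 1), M.bellmanPolicy π h d ∈ lawClass F h

end Bellman

/-- The `ℓ₁`-distributional eluder dimension. -/
def eluderDim {S : Type*} [MeasurableSpace S] (Ψ : Set (S → ℝ)) (𝔇 : Set (Measure S)) (ε₀ : ℝ) :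
    ℕ∞ :=
  sSup {n : ℕ∞ | ∃ L : ℕ, n = L ∧ ∃ d : Fin L → Measure S, (∀ t, d t ∈ 𝔇) ∧
    ∃ ε : ℝ, ε₀ ≤ ε ∧ ∀ t, ∃ f ∈ Ψ, ε < |∫ s, f s ∂(d t)| ∧
      ∑ i ∈ Finset.univ.filter (· < t), |∫ s, f s ∂(d i)| ≤ ε}

section Dimension

variable {X A : Type*} [MeasurableSpace X] [MeasurableSpace A] {lam : Measure ℝ} [SFinite lam]
  {H : ℕ}

/-- `D_△(f_h(x,a) ‖ T_h^{⋆,D} f_{h+1}(x,a))`. -/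
def bellmanError (M : MDP X A) (am : ArgminRule A) (f : Fin H → CondDens X A lam) (h : Fin H)
    (xa : X × A) : ℝ :=
  triDisc lam (lawAt f h.val xa) (M.bellmanOpt am h.val (lawAt f (h.val + 1)) xa)

/-- The Q-type dimension `d_RL(ε)`. -/
def dimQ (M : MDP X A) (am : ArgminRule A) (Pol : Set (Policy X A))
    (F : Fin H → Finset (CondDens X A lam)) (ε : ℝ) : ℕ∞ :=
  ⨆ h : Fin H, eluderDim {ψ | ∃ f ∈ tuples F, ψ = bellmanError M am f h}
    {μ | ∃ π ∈ Pol, ∃ x₁ : X, μ = M.occ π h x₁} ε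

/-- The V-type dimension `d_{RL,V}(ε)`. -/
def dimV [Fintype A] (M : MDP X A) (am : ArgminRule A) (Pol : Set (Policy X A))
    (F : Fin H → Finset (CondDens X A lam)) (ε : ℝ) : ℕ∞ :=
  ⨆ h : Fin H, eluderDim
    {ψ | ∃ f ∈ tuples F,
      ψ = fun x => (∑ a : A, bellmanError M am f h (x, a)) / (Fintype.card A : ℝ)}
    {μ | ∃ π ∈ Pol, ∃ x₁ : X, μ = M.stateOcc π h x₁} ε

end Dimension

/-- Conditionally on the `σ`-algebra `m`, the random element `Y` has law `κ ω`. -/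
def HasCondLaw {Ω E : Type*} [MeasurableSpace Ω] [MeasurableSpace E] (Pr : Measure Ω)
    (m : MeasurableSpace Ω) (Y : Ω → E) (κ : Ω → Measure E) : Prop :=
  ∀ S : Set E, MeasurableSet S → ∀ G : Set Ω, MeasurableSet[m] G →
    Pr (G ∩ Y ⁻¹' S) = ∫⁻ ω in G, κ ω S ∂Pr

section Algorithm

variable {X A : Type*} [MeasurableSpace X] [MeasurableSpace A] {lam : Measure ℝ} [SFinite lam]
  {H : ℕ}

/-- Log-likelihood of `g` at step `h` on the first `k` episodes, with the targets
`z^f_{h,i} = c_{h,i} + y^f_{h,i}`. The logarithm is extended by `log 0 = -∞`. -/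
def logLik (data : ℕ → Fin H → Step X A) (y : ℕ → Fin H → (Fin H → CondDens X A lam) → ℝ)
    (k : ℕ) (h : Fin H) (f : Fin H → CondDens X A lam) (g : CondDens X A lam) : EReal :=
  ∑ i ∈ Finset.range k,
    ENNReal.log (g.dens (data i h).1 ((data i h).2.1 + y i h f) : ℝ≥0∞)

/-- The confidence set after `k` episodes. -/
def confSet (F : Fin H → Finset (CondDens X A lam)) (β : ℝ) (data : ℕ → Fin H → Step X A)
    (y : ℕ → Fin H → (Fin H → CondDens X A lam) → ℝ) (k : ℕ) :
    Set (Fin H → CondDens X A lam) :=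
  {f | f ∈ tuples F ∧ ∀ h, ∀ g ∈ F h,
    logLik data y k h f g - (β : EReal) ≤ logLik data y k h f (f h)}

/-- `min_a f̄_1(x,a)`. -/
def optimisticValue (f : Fin H → CondDens X A lam) (x : X) : ℝ := ⨅ a : A, mean (lawAt f 0) x a

/-- A run of O-DISCO over `K` episodes (numbered `0, …, K-1`) against an adaptive adversary.
`𝒢 k` is the information available just before the rollouts of episode `k`. -/
structure ODiscoRun [Fintype A] [Nonempty A] {Ω : Type*} [mΩ : MeasurableSpace Ω]
    (Pr : Measure Ω) (M : MDP X A) (am : ArgminRule A) (F : Fin H → Finset (CondDens X A lam))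
    (β : ℝ) (K : ℕ) (uae : Bool) where
  𝒢 : Filtration ℕ mΩ
  /-- the initial state of episode `k`, chosen by the adversary -/
  x₁ : ℕ → Ω → X
  /-- the selected tuple `f^{(k)}` -/
  sel : ℕ → Ω → (Fin H → CondDens X A lam)
  /-- the transitions `((x_{h,k}, a_{h,k}), c_{h,k}, x'_{h,k})` -/
  data : ℕ → Ω → Fin H → Step X A
  /-- the sampled next-step values `y^f_{h,k}` -/
  y : ℕ → Ω → Fin H → (Fin H → CondDens X A lam) → ℝ
  measurable_x₁ : ∀ k < K, Measurable[𝒢 k] (x₁ k)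
  measurable_sel : ∀ k < K, ∀ f, MeasurableSet[𝒢 k] {ω | sel k ω = f}
  measurable_data : ∀ k < K, Measurable[𝒢 (k + 1)] (data k)
  measurable_y : ∀ k < K, ∀ h, ∀ f ∈ tuples F, Measurable[𝒢 (k + 1)] (fun ω => y k ω h f)
  sel_mem : ∀ k < K, ∀ ω, sel k ω ∈ tuples F
  /-- optimism: `f^{(k)}` minimizes `min_a f̄_1(x_{1,k},a)` over the confidence set of the data of
  the previous episodes (the choice is free should that set be empty) -/
  sel_optimistic : ∀ k < K, ∀ ω,
    (confSet F β (fun i => data i ω) (fun i => y i ω) k).Nonempty →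
    sel k ω ∈ confSet F β (fun i => data i ω) (fun i => y i ω) k ∧
    ∀ g ∈ confSet F β (fun i => data i ω) (fun i => y i ω) k,
      optimisticValue (sel k ω) (x₁ k ω) ≤ optimisticValue g (x₁ k ω)
  /-- the transitions are collected by rolling in the greedy policy of `f^{(k)}` from `x_{1,k}` -/
  data_law : ∀ k < K, HasCondLaw Pr (𝒢 k) (data k)
    (fun ω => M.episodeLaw H uae (greedyPolicy am (sel k ω)) (x₁ k ω))
  /-- given the past and the transitions of episode `k`, `y^f_{h,k} ∼ f_{h+1}(x', a')` with
  `x' = x'_{h,k}` and `a' = argmin_a f̄_{h+1}(x', a)` (any coupling of the draws over `h, f`) -/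
  y_law : ∀ k < K, ∀ h : Fin H, ∀ f ∈ tuples F,
    HasCondLaw Pr (𝒢 k ⊔ MeasurableSpace.comap (data k) inferInstance) (fun ω => y k ω h f)
      (fun ω => lawAt f (h.val + 1)
        ((data k ω h).2.2, greedyAct am (lawAt f (h.val + 1)) (data k ω h).2.2))

variable [Fintype A] [Nonempty A] {Ω : Type*} [MeasurableSpace Ω] {Pr : Measure Ω} {M : MDP X A}
  {am : ArgminRule A} {F : Fin H → Finset (CondDens X A lam)} {β : ℝ} {K : ℕ} {uae : Bool}

/-- The policy `π^k` of episode `k`. -/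
def ODiscoRun.pol (R : ODiscoRun Pr M am F β K uae) (k : ℕ) (ω : Ω) : Policy X A :=
  greedyPolicy am (R.sel k ω)

/-- `∑_k (V^{π^k}(x_{1,k}) - V^⋆(x_{1,k}))`. -/
def ODiscoRun.regret (R : ODiscoRun Pr M am F β K uae) (ω : Ω) : ℝ :=
  ∑ k ∈ Finset.range K,
    (M.value H (R.pol k ω) (R.x₁ k ω) - M.optValue H (R.x₁ k ω))

/-- `∑_k Var(Z^{π^k}(x_{1,k}))`. -/
def ODiscoRun.sumVar (R : ODiscoRun Pr M am F β K uae) (ω : Ω) : ℝ :=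
  ∑ k ∈ Finset.range K, M.returnVar H (R.pol k ω) (R.x₁ k ω)

end Algorithm

/-- `β = log(H K |F| / δ)`. -/
def threshold {X A : Type*} [MeasurableSpace X] [MeasurableSpace A] {lam : Measure ℝ} {H : ℕ}
    (F : Fin H → Finset (CondDens X A lam)) (K : ℕ) (δ : ℝ) : ℝ :=
  Real.log ((H : ℝ) * K * ((∏ h, (F h).card : ℕ) : ℝ) / δ)

/-- `H √(a · V · D · β · L) + a · H^{5/2} · D · β · L`. -/
def secondOrderBound (H : ℕ) (a V D β L : ℝ) : ℝ :=
  (H : ℝ) * √(a * V * D * β * L) + a * (H : ℝ) ^ (5 / 2 : ℝ) * D * β * L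

end DistRL

end

universe u v w

open DistRL

/-!
The triangular discrimination of two densities on `[0, 1]` bounds the difference of their means by
`s · variance + D_△ / s`, where the variance is that of either density and `0 < s ≤ 1`, and makes
their variances comparable up to the factor `1 + 1/H` and an error of order `H · D_△`.

Backward induction and Bellman completeness give a fixed point `f*` of the optimal distributional
Bellman operator in `ℱ`. Every policy has nonnegative drift relative to `x ↦ min_a f̄*_h(x, a)`,
so that `min_a f̄*₁ ≤ V*`, and optimism puts the value predicted by the learner below `V*`
whenever `f*` lies in the confidence set.

Given the past and the explored pair, `z^f` is drawn from the density `g` of the Bellman image of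
`f`. Hence `∏ q / f*` and `∏ exp (D_△ / 4) √(f / g)` along the recorded data have expectation at
most `1`, the latter because `E √(f / g) ≤ 1 - D_△ / 4`. Markov's inequality and a union bound
over `ℱ`, `h` and `k` show that with probability at least `1 - δ` the fixed point never leaves the
confidence sets and every member of them has past discrimination `O(β)`. The eluder dimension and
a layer-cake argument bound the current discriminations in terms of the past ones.

By the performance difference lemma the regret of an episode is at most a sum of mean differences
between `f_h` and its Bellman image along the played policy. The predicted variances that this
brings in satisfy, by the law of total variance, a backward recursion with ratio `1 + 1/H`;
unrolled, it costs only a constant factor and leaves the one-step variances of the predicted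
values, whose sum is the variance of a martingale differing from the return by the accumulated
drift. Optimizing over `s` gives the second-order bound.
-/

noncomputable section

namespace DistRL

section Densities

variable {E : Type*} [MeasurableSpace E]

/-- The triangular discrimination `D_△` of two densities with respect to `lam`. -/
def triDens (lam : Measure E) (p q : E → ℝ≥0) : ℝ :=
  ∫ y, ((p y : ℝ) - q y) ^ 2 / ((p y : ℝ) + q y) ∂lam

/-- `p` is a probability density with respect to `lam`. -/
structure IsDensity (lam : Measure E) (p : E → ℝ≥0) : Prop where
  measurable : Measurable p
  lintegral_eq_one : ∫⁻ y, (p y : ℝ≥0∞) ∂lam = 1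

/-- The law with density `p` with respect to `lam`. -/
def densLaw (lam : Measure E) (p : E → ℝ≥0) : Measure E := lam.withDensity fun y => (p y : ℝ≥0∞)

variable {lam : Measure E} {p q : E → ℝ≥0}

lemma IsDensity.isProbabilityMeasure (hp : IsDensity lam p) :
    IsProbabilityMeasure (densLaw lam p) :=
  ⟨by simp [densLaw, hp.lintegral_eq_one]⟩

lemma IsDensity.integrable (hp : IsDensity lam p) : Integrable (fun y => (p y : ℝ)) lam := by
  simpa using integrable_toReal_of_lintegral_ne_top
    hp.measurable.coe_nnreal_ennreal.aemeasurable (by simp [hp.lintegral_eq_one])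

lemma IsDensity.integral_eq_one (hp : IsDensity lam p) : ∫ y, (p y : ℝ) ∂lam = 1 := by
  have h := integral_toReal (μ := lam) hp.measurable.coe_nnreal_ennreal.aemeasurable (by simp)
  simpa [hp.lintegral_eq_one] using h

lemma IsDensity.integral_densLaw (hp : IsDensity lam p) (φ : E → ℝ) :
    ∫ y, φ y ∂(densLaw lam p) = ∫ y, φ y * (p y : ℝ) ∂lam := by
  simp only [densLaw, integral_withDensity_eq_integral_smul hp.measurable, NNReal.smul_def,
    smul_eq_mul, mul_comm]

lemma IsDensity.integrable_mul (hp : IsDensity lam p) {φ : E → ℝ}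
    (hφ : Integrable φ (densLaw lam p)) : Integrable (fun y => φ y * (p y : ℝ)) lam := by
  simpa only [densLaw, integrable_withDensity_iff_integrable_smul hp.measurable,
    NNReal.smul_def, smul_eq_mul, mul_comm] using hφ

lemma sub_sq_div_add_le (a b : ℝ≥0) : ((a : ℝ) - b) ^ 2 / ((a : ℝ) + b) ≤ (a : ℝ) + b := by
  refine div_le_of_le_mul₀ (by positivity) (by positivity) ?_
  nlinarith [mul_nonneg a.2 b.2, NNReal.coe_nonneg a, NNReal.coe_nonneg b]

lemma two_mul_mul_sub_le (x : ℝ) (a b : ℝ≥0) :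
    2 * (x * ((a : ℝ) - b)) ≤ x ^ 2 * ((a : ℝ) + b) + ((a : ℝ) - b) ^ 2 / ((a : ℝ) + b) := by
  rcases eq_or_ne (a + b) 0 with h | h
  · obtain ⟨rfl, rfl⟩ := add_eq_zero.1 h
    simp
  · have hne : (a : ℝ) + b ≠ 0 := by exact_mod_cast h
    have hsq : 0 ≤ (x * ((a : ℝ) + b) - (a - b)) ^ 2 / ((a : ℝ) + b) := by positivity
    have hexp : (x * ((a : ℝ) + b) - (a - b)) ^ 2 / ((a : ℝ) + b) =
        x ^ 2 * ((a : ℝ) + b) + ((a : ℝ) - b) ^ 2 / ((a : ℝ) + b) - 2 * (x * ((a : ℝ) - b)) := by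
      field_simp
      ring
    linarith

lemma sqrt_mul_le_sub_sub_sq_div (a b : ℝ≥0) :
    √((a : ℝ) * b) ≤ ((a : ℝ) + b) / 2 - ((a : ℝ) - b) ^ 2 / ((a : ℝ) + b) / 4 := by
  obtain ⟨u, hu, hua⟩ : ∃ u : ℝ, 0 ≤ u ∧ (a : ℝ) = u ^ 2 :=
    ⟨√a, Real.sqrt_nonneg _, (Real.sq_sqrt a.2).symm⟩
  obtain ⟨v, hv, hvb⟩ : ∃ v : ℝ, 0 ≤ v ∧ (b : ℝ) = v ^ 2 :=
    ⟨√b, Real.sqrt_nonneg _, (Real.sq_sqrt b.2).symm⟩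
  have h : (u ^ 2 - v ^ 2) ^ 2 / (u ^ 2 + v ^ 2) ≤ 2 * (u - v) ^ 2 := by
    refine div_le_of_le_mul₀ (by positivity) (by positivity) ?_
    nlinarith [mul_nonneg (sq_nonneg (u - v)) (sq_nonneg (u - v))]
  rw [hua, hvb, ← mul_pow, Real.sqrt_sq (by positivity)]
  nlinarith

lemma triDens_nonneg (lam : Measure E) (p q : E → ℝ≥0) : 0 ≤ triDens lam p q :=
  integral_nonneg fun y => by positivity

lemma triDens_comm (lam : Measure E) (p q : E → ℝ≥0) : triDens lam p q = triDens lam q p := by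
  simp only [triDens, sub_sq_comm, add_comm]

lemma integrable_triDens (hp : IsDensity lam p) (hq : IsDensity lam q) :
    Integrable (fun y => ((p y : ℝ) - q y) ^ 2 / ((p y : ℝ) + q y)) lam := by
  have hpm := hp.measurable
  have hqm := hq.measurable
  refine (hp.integrable.add hq.integrable).mono'
    (Measurable.div (by fun_prop) (by fun_prop)).aestronglyMeasurable (.of_forall fun y => ?_)
  rw [Real.norm_of_nonneg (by positivity)]
  exact sub_sq_div_add_le _ _

lemma triDens_le_two (hp : IsDensity lam p) (hq : IsDensity lam q) : triDens lam p q ≤ 2 := by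
  calc triDens lam p q ≤ ∫ y, ((p y : ℝ) + q y) ∂lam :=
        integral_mono (integrable_triDens hp hq) (hp.integrable.add hq.integrable)
          fun y => sub_sq_div_add_le _ _
    _ = 2 := by
        rw [integral_add hp.integrable hq.integrable, hp.integral_eq_one, hq.integral_eq_one]
        norm_num

theorem sq_integral_sub_integral_le (hp : IsDensity lam p) (hq : IsDensity lam q) {φ : E → ℝ}
    (hφp : MemLp φ 2 (densLaw lam p)) (hφq : MemLp φ 2 (densLaw lam q)) :
    (∫ y, φ y ∂(densLaw lam p) - ∫ y, φ y ∂(densLaw lam q)) ^ 2 ≤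
      (∫ y, φ y ^ 2 ∂(densLaw lam p) + ∫ y, φ y ^ 2 ∂(densLaw lam q)) * triDens lam p q := by
  have := hp.isProbabilityMeasure
  have := hq.isProbabilityMeasure
  have i₁p := hp.integrable_mul (hφp.integrable one_le_two)
  have i₁q := hq.integrable_mul (hφq.integrable one_le_two)
  have i₂p := hp.integrable_mul hφp.integrable_sq
  have i₂q := hq.integrable_mul hφq.integrable_sq
  have iD := integrable_triDens hp hq
  simp only [hp.integral_densLaw, hq.integral_densLaw]
  rw [← integral_sub i₁p i₁q, ← integral_add i₂p i₂q]
  have hquad : ∀ s : ℝ, 0 ≤ (∫ y, (φ y ^ 2 * (p y : ℝ) + φ y ^ 2 * (q y : ℝ)) ∂lam) * (s * s) +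
      -(2 * ∫ y, (φ y * (p y : ℝ) - φ y * (q y : ℝ)) ∂lam) * s + triDens lam p q := fun s => by
    have h : ∫ y, 2 * s * (φ y * (p y : ℝ) - φ y * (q y : ℝ)) ∂lam ≤
        ∫ y, (s * s * (φ y ^ 2 * (p y : ℝ) + φ y ^ 2 * (q y : ℝ)) +
          ((p y : ℝ) - q y) ^ 2 / ((p y : ℝ) + q y)) ∂lam :=
      integral_mono ((i₁p.sub i₁q).const_mul _) (((i₂p.add i₂q).const_mul _).add iD) fun y => by
        linarith [two_mul_mul_sub_le (s * φ y) (p y) (q y)]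
    rw [integral_add (f := fun y => s * s * (φ y ^ 2 * (p y : ℝ) + φ y ^ 2 * (q y : ℝ)))
      ((i₂p.add i₂q).const_mul _) iD, integral_const_mul, integral_const_mul, ← triDens] at h
    linarith
  have hdisc := discrim_le_zero hquad
  rw [discrim] at hdisc
  linarith

lemma coe_mul_rpow_half_div (a b : ℝ≥0) :
    (b : ℝ≥0∞) * ((a : ℝ≥0∞) / b) ^ (1 / 2 : ℝ) = ENNReal.ofReal √((a : ℝ) * b) := by
  rcases eq_or_ne b 0 with rfl | hb
  · simp
  · have hsqrt : √(b : ℝ) ≠ 0 := by simpa [Real.sqrt_eq_zero'] using hb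
    rw [← ENNReal.coe_div hb, ← ENNReal.coe_rpow_of_nonneg _ (by norm_num), ← ENNReal.coe_mul,
      ← ENNReal.ofReal_coe_nnreal]
    push_cast
    rw [← Real.sqrt_eq_rpow, Real.sqrt_div a.coe_nonneg, Real.sqrt_mul a.coe_nonneg]
    congr 1
    field_simp
    rw [Real.sq_sqrt b.coe_nonneg, mul_comm]

/- The left side is `1 - h²` for the squared Hellinger distance `h²`, which dominates `D_△ / 4`. -/
theorem lintegral_mul_rpow_half_div_le (hp : IsDensity lam p) (hq : IsDensity lam q) :
    ∫⁻ y, (q y : ℝ≥0∞) * ((p y : ℝ≥0∞) / q y) ^ (1 / 2 : ℝ) ∂lam ≤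
      ENNReal.ofReal (1 - triDens lam p q / 4) := by
  have ipq := (hp.integrable.add hq.integrable).div_const 2
  have iD := (integrable_triDens hp hq).div_const 4
  calc ∫⁻ y, (q y : ℝ≥0∞) * ((p y : ℝ≥0∞) / q y) ^ (1 / 2 : ℝ) ∂lam
      ≤ ∫⁻ y, ENNReal.ofReal (((p y : ℝ) + q y) / 2 -
          ((p y : ℝ) - q y) ^ 2 / ((p y : ℝ) + q y) / 4) ∂lam :=
        lintegral_mono fun y => (coe_mul_rpow_half_div _ _).trans_le
          (ENNReal.ofReal_le_ofReal (sqrt_mul_le_sub_sub_sq_div _ _))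
    _ = ENNReal.ofReal (∫ y, (((p y : ℝ) + q y) / 2 -
          ((p y : ℝ) - q y) ^ 2 / ((p y : ℝ) + q y) / 4) ∂lam) :=
        (ofReal_integral_eq_lintegral_ofReal (ipq.sub iD) (.of_forall fun y =>
          (Real.sqrt_nonneg _).trans (sqrt_mul_le_sub_sub_sq_div (p y) (q y)))).symm
    _ = ENNReal.ofReal (1 - triDens lam p q / 4) := by
        have hmean : ∫ y, ((p y : ℝ) + q y) ∂lam = 2 := by
          rw [integral_add hp.integrable hq.integrable, hp.integral_eq_one, hq.integral_eq_one]
          norm_num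
        rw [integral_sub (f := fun y => ((p y : ℝ) + q y) / 2) ipq iD, integral_div, integral_div,
          hmean, triDens]
        norm_num

end Densities

section UnitInterval

variable {μ : Measure ℝ} [IsProbabilityMeasure μ]

lemma memLp_id_of_ae_mem_Icc (hμ : ∀ᵐ y ∂μ, y ∈ Set.Icc (0 : ℝ) 1) (r : ℝ≥0∞) : MemLp id r μ :=
  memLp_of_bounded hμ aestronglyMeasurable_id r

lemma integral_mem_Icc (hμ : ∀ᵐ y ∂μ, y ∈ Set.Icc (0 : ℝ) 1) :
    ∫ y, y ∂μ ∈ Set.Icc (0 : ℝ) 1 :=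
  (convex_Icc 0 1).integral_mem isClosed_Icc hμ
    ((memLp_id_of_ae_mem_Icc hμ 1).integrable le_rfl)

lemma variance_id_le_integral_sq_sub (μ : Measure ℝ) [IsProbabilityMeasure μ] (m : ℝ) :
    Var[id; μ] ≤ ∫ y, (y - m) ^ 2 ∂μ := by
  rw [← variance_sub_const aestronglyMeasurable_id m]
  exact variance_le_expectation_sq (by fun_prop)

lemma sq_sub_le_one {y m : ℝ} (hy : y ∈ Set.Icc (0 : ℝ) 1) (hm : m ∈ Set.Icc (0 : ℝ) 1) :
    (y - m) ^ 2 ≤ 1 := by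
  rw [sq_le_one_iff_abs_le_one, abs_le]
  constructor <;> linarith [hy.1, hy.2, hm.1, hm.2]

lemma memLp_sq_sub (hμ : ∀ᵐ y ∂μ, y ∈ Set.Icc (0 : ℝ) 1) {m : ℝ} (hm : m ∈ Set.Icc (0 : ℝ) 1)
    (r : ℝ≥0∞) : MemLp (fun y => (y - m) ^ 2) r μ :=
  memLp_of_bounded (a := 0) (b := 1)
    (hμ.mono fun _ hy => ⟨sq_nonneg _, sq_sub_le_one hy hm⟩) (by fun_prop) r

lemma integral_sq_sq_sub_le (hμ : ∀ᵐ y ∂μ, y ∈ Set.Icc (0 : ℝ) 1) {m : ℝ}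
    (hm : m ∈ Set.Icc (0 : ℝ) 1) : ∫ y, ((y - m) ^ 2) ^ 2 ∂μ ≤ ∫ y, (y - m) ^ 2 ∂μ :=
  integral_mono_ae (memLp_sq_sub hμ hm 2).integrable_sq
    ((memLp_sq_sub hμ hm 1).integrable le_rfl)
    (hμ.mono fun _ hy => pow_le_of_le_one (sq_nonneg _) (sq_sub_le_one hy hm) two_ne_zero)

lemma integral_sq_le_one (hμ : ∀ᵐ y ∂μ, y ∈ Set.Icc (0 : ℝ) 1) : ∫ y, y ^ 2 ∂μ ≤ 1 := by
  simpa using integral_mono_ae (memLp_id_of_ae_mem_Icc hμ 2).integrable_sq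
    (integrable_const (1 : ℝ)) (hμ.mono fun _ hy => pow_le_one₀ hy.1 hy.2)

end UnitInterval

section SecondOrder

lemma le_add_div_of_sq_sub_le {w v D s : ℝ} (hv : 0 ≤ v) (hD : 0 ≤ D) (hs : 0 < s) (hs1 : s ≤ 1)
    (h : (w - v) ^ 2 ≤ (w + v) * D) : w ≤ (1 + 2 * s) * v + D / s := by
  by_contra! hlt
  have hDs : D ≤ D / s := le_div_self hD hs hs1
  have hcancel : s * (D / s) = D := mul_div_cancel₀ D hs.ne'
  have hsv : 0 ≤ s * v := by positivity
  nlinarith [mul_nonneg hsv (by linarith : 0 ≤ w - v - D / s),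
    mul_nonneg hD (by linarith : 0 ≤ w - v)]

lemma le_add_div_of_sq_le {b v D s : ℝ} (hv : 0 ≤ v) (hD : 0 ≤ D) (hs : 0 < s) (hs1 : s ≤ 1)
    (h : b ^ 2 ≤ (4 * v + D) * D) : b ≤ 2 * s * v + D / s := by
  have hDs : D ≤ D / s := le_div_self hD hs hs1
  have hcancel : s * (D / s) = D := mul_div_cancel₀ D hs.ne'
  refine le_of_abs_le (abs_le_of_sq_le_sq (h.trans ?_) (by positivity))
  nlinarith [sq_nonneg (s * v), mul_le_mul hDs hDs hD (by positivity)]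

variable {lam : Measure ℝ} {p q : ℝ → ℝ≥0}

lemma ae_densLaw {E : Type*} [MeasurableSpace E] {lam : Measure E} {S : Set E}
    (hS : ∀ᵐ y ∂lam, y ∈ S) (p : E → ℝ≥0) : ∀ᵐ y ∂(densLaw lam p), y ∈ S :=
  (withDensity_absolutelyContinuous lam _).ae_le hS

theorem sq_mean_sub_le (hlam : ∀ᵐ y ∂lam, y ∈ Set.Icc (0 : ℝ) 1) (hp : IsDensity lam p)
    (hq : IsDensity lam q) :
    (∫ y, y ∂(densLaw lam p) - ∫ y, y ∂(densLaw lam q)) ^ 2 ≤ 2 * triDens lam p q := by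
  have := hp.isProbabilityMeasure
  have := hq.isProbabilityMeasure
  have hP := ae_densLaw hlam p
  have hQ := ae_densLaw hlam q
  refine (sq_integral_sub_integral_le hp hq (memLp_id_of_ae_mem_Icc hP 2)
    (memLp_id_of_ae_mem_Icc hQ 2)).trans
    (mul_le_mul_of_nonneg_right ?_ (triDens_nonneg lam p q))
  exact (add_le_add (integral_sq_le_one hP) (integral_sq_le_one hQ)).trans_eq one_add_one_eq_two

lemma integral_sq_sub_mean_le (hlam : ∀ᵐ y ∂lam, y ∈ Set.Icc (0 : ℝ) 1) (hp : IsDensity lam p)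
    (hq : IsDensity lam q) {s : ℝ} (hs : 0 < s) (hs1 : s ≤ 1) :
    ∫ y, (y - ∫ z, z ∂(densLaw lam q)) ^ 2 ∂(densLaw lam p) ≤
      (1 + 2 * s) * Var[id; densLaw lam q] + triDens lam p q / s := by
  have := hp.isProbabilityMeasure
  have := hq.isProbabilityMeasure
  have hP := ae_densLaw hlam p
  have hQ := ae_densLaw hlam q
  have hm := integral_mem_Icc hQ
  have hD := triDens_nonneg lam p q
  refine le_add_div_of_sq_sub_le (variance_nonneg _ _) hD hs hs1 ?_
  simp only [variance_eq_integral measurable_id.aemeasurable, id]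
  refine (sq_integral_sub_integral_le hp hq (memLp_sq_sub hP hm 2)
    (memLp_sq_sub hQ hm 2)).trans (mul_le_mul_of_nonneg_right ?_ hD)
  exact add_le_add (integral_sq_sq_sub_le hP hm) (integral_sq_sq_sub_le hQ hm)

theorem mean_sub_le (hlam : ∀ᵐ y ∂lam, y ∈ Set.Icc (0 : ℝ) 1) (hp : IsDensity lam p)
    (hq : IsDensity lam q) {s : ℝ} (hs : 0 < s) (hs1 : s ≤ 1) :
    ∫ y, y ∂(densLaw lam p) - ∫ y, y ∂(densLaw lam q) ≤
      2 * s * Var[id; densLaw lam q] + triDens lam p q / s := by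
  have := hp.isProbabilityMeasure
  have := hq.isProbabilityMeasure
  have hP := memLp_id_of_ae_mem_Icc (ae_densLaw hlam p) 2
  have hQ := memLp_id_of_ae_mem_Icc (ae_densLaw hlam q) 2
  have hD := triDens_nonneg lam p q
  have hCS := sq_integral_sub_integral_le hp hq (hP.sub (memLp_const (∫ z, z ∂(densLaw lam q))))
    (hQ.sub (memLp_const (∫ z, z ∂(densLaw lam q))))
  have hcenter : ∀ {μ : Measure ℝ} [IsProbabilityMeasure μ], MemLp id 2 μ →
      ∫ y, (y - ∫ z, z ∂(densLaw lam q)) ∂μ = ∫ y, y ∂μ - ∫ z, z ∂(densLaw lam q) := fun h => by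
    rw [integral_sub (f := fun y => y) (h.integrable one_le_two) (integrable_const _)]
    simp
  simp only [Pi.sub_apply, id, hcenter hP, hcenter hQ, sub_self, sub_zero] at hCS
  refine le_add_div_of_sq_le (variance_nonneg _ _) hD hs hs1
    (hCS.trans (mul_le_mul_of_nonneg_right ?_ hD))
  have hsecond := integral_sq_sub_mean_le hlam hp hq one_pos le_rfl
  have hvar : ∫ y, (y - ∫ z, z ∂(densLaw lam q)) ^ 2 ∂(densLaw lam q) = Var[id; densLaw lam q] :=
    (variance_eq_integral measurable_id.aemeasurable).symm
  linarith

theorem variance_densLaw_le (hlam : ∀ᵐ y ∂lam, y ∈ Set.Icc (0 : ℝ) 1) (hp : IsDensity lam p)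
    (hq : IsDensity lam q) {s : ℝ} (hs : 0 < s) (hs1 : s ≤ 1) :
    Var[id; densLaw lam p] ≤ (1 + 2 * s) * Var[id; densLaw lam q] + triDens lam p q / s := by
  have := hp.isProbabilityMeasure
  exact (variance_id_le_integral_sq_sub _ _).trans
    (integral_sq_sub_mean_le hlam hp hq hs hs1)

end SecondOrder

section Eluder

lemma exists_coloring_sum_le {ι : Type*} [LinearOrder ι] {a : ι → ι → ℝ} {m : ℕ} (hm : 0 < m)
    {ε : ℝ} (T : Finset ι) (hrow : ∀ k ∈ T, ∑ i ∈ T with i < k, a k i ≤ m * ε) :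
    ∃ col : ι → Fin m, ∀ k ∈ T, ∑ i ∈ T with i < k ∧ col i = col k, a k i ≤ ε := by
  induction T using Finset.induction_on_max with
  | empty => exact ⟨fun _ => ⟨0, hm⟩, by simp⟩
  | insert n T hlt ih =>
    have hn : n ∉ T := fun h => (hlt n h).false
    have hbelow : ∀ k ∈ insert n T, {i ∈ insert n T | i < k} = {i ∈ T | i < k} := fun k hk => by
      rw [Finset.filter_insert, if_neg]
      rcases Finset.mem_insert.1 hk with rfl | hk
      exacts [lt_irrefl _, (hlt k hk).not_gt]
    have hall : {i ∈ T | i < n} = T := Finset.filter_true_of_mem hlt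
    obtain ⟨col, hcol⟩ := ih fun k hk =>
      hbelow k (Finset.mem_insert_of_mem hk) ▸ hrow k (Finset.mem_insert_of_mem hk)
    obtain ⟨j, -, hj⟩ : ∃ j ∈ (Finset.univ : Finset (Fin m)),
        ∑ i ∈ T with col i = j, a n i ≤ ε := by
      refine Finset.exists_le_of_sum_le ⟨⟨0, hm⟩, Finset.mem_univ _⟩ ?_
      have hrow_n := hrow n (Finset.mem_insert_self n T)
      rw [hbelow n (Finset.mem_insert_self n T), hall] at hrow_n
      simpa [Finset.sum_fiberwise] using hrow_n
    have hupdate : ∀ i ∈ T, Function.update col n j i = col i := fun i hi =>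
      Function.update_of_ne (hlt i hi).ne _ _
    refine ⟨Function.update col n j, fun k hk => ?_⟩
    rw [← Finset.filter_filter, hbelow k hk, Finset.filter_filter]
    rcases Finset.mem_insert.1 hk with rfl | hkT
    · refine (Finset.sum_congr (Finset.filter_congr fun i hi => ?_) fun _ _ => rfl).trans_le hj
      simp only [hlt i hi, true_and, hupdate i hi, Function.update_self]
    · refine (Finset.sum_congr (Finset.filter_congr fun i hi => ?_) fun _ _ => rfl).trans_le
        (hcol k hkT)
      rw [hupdate i hi, hupdate k hkT]

variable {S : Type*} [MeasurableSpace S] {Ψ : Set (S → ℝ)} {𝔇 : Set (Measure S)} {ε₀ : ℝ}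
  {ψ : ℕ → S → ℝ} {μ : ℕ → Measure S} {K D : ℕ}

lemma card_le_of_eluderDim_le (hdim : eluderDim Ψ 𝔇 ε₀ ≤ D) {ε : ℝ} (hε : ε₀ ≤ ε) (U : Finset ℕ)
    (hψ : ∀ k ∈ U, ψ k ∈ Ψ) (hμ : ∀ k ∈ U, μ k ∈ 𝔇) (hlarge : ∀ k ∈ U, ε < |∫ s, ψ k s ∂(μ k)|)
    (hpast : ∀ k ∈ U, ∑ i ∈ U with i < k, |∫ s, ψ k s ∂(μ i)| ≤ ε) : U.card ≤ D := by
  let e := U.orderEmbOfFin rfl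
  have he : ∀ t, e t ∈ U := Finset.orderEmbOfFin_mem U rfl
  have hsum : ∀ t, ∑ i ∈ Finset.univ.filter (· < t), |∫ s, ψ (e t) s ∂(μ (e i))| ≤
      ∑ i ∈ U with i < e t, |∫ s, ψ (e t) s ∂(μ i)| := fun t => by
    refine (Finset.sum_map _ e.toEmbedding fun i => |∫ s, ψ (e t) s ∂(μ i)|).symm.trans_le ?_
    refine Finset.sum_le_sum_of_subset_of_nonneg (fun i hi => ?_) fun i _ _ => abs_nonneg _
    obtain ⟨t', ht', rfl⟩ := Finset.mem_map.1 hi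
    exact Finset.mem_filter.2 ⟨he t', e.strictMono (Finset.mem_filter.1 ht').2⟩
  have hcard : (U.card : ℕ∞) ≤ eluderDim Ψ 𝔇 ε₀ :=
    le_sSup ⟨U.card, rfl, fun t => μ (e t), fun t => hμ _ (he t), ε, hε, fun t =>
      ⟨ψ (e t), hψ _ (he t), hlarge _ (he t), (hsum t).trans (hpast _ (he t))⟩⟩
  exact_mod_cast hcard.trans hdim

lemma card_filter_lt_le_of_eluderDim_le (hdim : eluderDim Ψ 𝔇 ε₀ ≤ D) (hψ : ∀ k < K, ψ k ∈ Ψ)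
    (hμ : ∀ k < K, μ k ∈ 𝔇) {m : ℕ} (hm : 0 < m) {ε : ℝ} (hε : ε₀ ≤ ε)
    (hrow : ∀ k < K, ∑ i ∈ Finset.range k, |∫ s, ψ k s ∂(μ i)| ≤ m * ε) :
    ((Finset.range K).filter (fun k => ε < |∫ s, ψ k s ∂(μ k)|)).card ≤ m * D := by
  set T := (Finset.range K).filter (fun k => ε < |∫ s, ψ k s ∂(μ k)|)
  have hT : ∀ k ∈ T, k < K ∧ ε < |∫ s, ψ k s ∂(μ k)| := fun k hk => by simpa [T] using hk
  obtain ⟨col, hcol⟩ := exists_coloring_sum_le (a := fun k i => |∫ s, ψ k s ∂(μ i)|) hm T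
    fun k hk => (Finset.sum_le_sum_of_subset_of_nonneg
      (fun i hi => Finset.mem_range.2 (Finset.mem_filter.1 hi).2)
      fun i _ _ => abs_nonneg _).trans (hrow k (hT k hk).1)
  have hclass : ∀ j : Fin m, (T.filter (col · = j)).card ≤ D := fun j => by
    have hU : ∀ k ∈ T.filter (col · = j), k ∈ T ∧ col k = j := fun k => by simp
    refine card_le_of_eluderDim_le hdim hε _ (fun k hk => hψ k (hT k (hU k hk).1).1)
      (fun k hk => hμ k (hT k (hU k hk).1).1) (fun k hk => (hT k (hU k hk).1).2) fun k hk => ?_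
    refine (Finset.sum_congr ?_ fun _ _ => rfl).trans_le (hcol k (hU k hk).1)
    rw [Finset.filter_filter]
    exact Finset.filter_congr fun i _ => by rw [(hU k hk).2, and_comm]
  have hcard := Finset.card_le_mul_card_image_of_maps_to (s := T) (t := Finset.univ) (f := col)
    (fun _ _ => Finset.mem_univ _) D fun j _ => hclass j
  rwa [Finset.card_univ, Fintype.card_fin, mul_comm] at hcard

lemma sub_le_setIntegral_indicator_Iio {a b c : ℝ} (hac : a ≤ c) :
    a - b ≤ ∫ ε in Set.Ioc b c, (Set.Iio a).indicator 1 ε := by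
  rw [integral_indicator_one measurableSet_Iio, Measure.real_def,
    Measure.restrict_apply measurableSet_Iio]
  have hsub : Set.Ioo b a ⊆ Set.Iio a ∩ Set.Ioc b c := fun ε hε =>
    ⟨hε.2, hε.1, hε.2.le.trans hac⟩
  have hfin : volume (Set.Iio a ∩ Set.Ioc b c) ≠ ∞ :=
    measure_ne_top_of_subset Set.inter_subset_right measure_Ioc_lt_top.ne
  calc a - b ≤ (volume (Set.Ioo b a)).toReal := by
        rw [Real.volume_Ioo]
        exact le_max_left _ _
    _ ≤ _ := ENNReal.toReal_mono hfin (measure_mono hsub)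

lemma setIntegral_div_add_one {B b c : ℝ} (hb : 0 < b) (hbc : b ≤ c) :
    IntegrableOn (fun ε => B / ε + 1) (Set.Ioc b c) ∧
      ∫ ε in Set.Ioc b c, (B / ε + 1) = B * Real.log (c / b) + (c - b) := by
  have hii : IntervalIntegrable (fun ε : ℝ => B / ε) volume b c :=
    (continuousOn_const.div continuousOn_id fun ε hε =>
      (hb.trans_le (Set.uIcc_of_le hbc ▸ hε).1).ne').intervalIntegrable
  constructor
  · exact (intervalIntegrable_iff_integrableOn_Ioc_of_le hbc).1
      (hii.add intervalIntegrable_const)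
  · rw [← intervalIntegral.integral_of_le hbc, intervalIntegral.integral_add hii (by simp)]
    simp only [div_eq_mul_inv, intervalIntegral.integral_const_mul,
      integral_inv_of_pos hb (hb.trans_le hbc)]
    simp

/- Layer cake: `a k = ∫ 𝟙[ε < a k] dε`, so the total is the integral over `ε` of the number of
members above `ε`. -/
lemma sum_le_of_card_filter_lt_le {a : ℕ → ℝ} {B D : ℝ} (hK : 0 < K) (hB : 0 ≤ B) (hD : 1 ≤ D)
    (ha : ∀ k < K, a k ≤ 2)
    (hcount : ∀ ε : ℝ, 1 / (K : ℝ) ≤ ε →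
      (((Finset.range K).filter (fun k => ε < a k)).card : ℝ) ≤ (B / ε + 1) * D) :
    ∑ k ∈ Finset.range K, a k ≤ (B + 3) * D * (1 + Real.log K) := by
  have hKr : (0 : ℝ) < K := by exact_mod_cast hK
  have hb : (0 : ℝ) < 1 / K := by positivity
  have hb2 : 1 / (K : ℝ) ≤ 2 := by
    rw [div_le_iff₀ hKr]
    have : (1 : ℝ) ≤ K := by exact_mod_cast hK
    linarith
  obtain ⟨hint, hval⟩ := setIntegral_div_add_one (B := B) hb hb2
  have hlayer : ∑ k ∈ Finset.range K, (a k - 1 / K) ≤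
      D * (B * Real.log (2 / (1 / K)) + (2 - 1 / K)) := by
    have hind : ∀ k ∈ Finset.range K, Integrable ((Set.Iio (a k)).indicator (1 : ℝ → ℝ))
        (volume.restrict (Set.Ioc (1 / (K : ℝ)) 2)) := fun k _ =>
      (integrable_const (1 : ℝ)).indicator measurableSet_Iio
    refine (Finset.sum_le_sum fun k hk =>
      sub_le_setIntegral_indicator_Iio (ha k (Finset.mem_range.1 hk))).trans ?_
    rw [← integral_finsetSum _ hind, ← hval, ← integral_const_mul]
    refine setIntegral_mono_on (integrable_finsetSum _ hind) (hint.const_mul D)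
      measurableSet_Ioc fun ε hε => ?_
    simpa [Set.indicator_apply, mul_comm] using hcount ε hε.1.le
  have hlog : Real.log (2 / (1 / K)) ≤ 1 + Real.log K := by
    rw [div_div_eq_mul_div, div_one, Real.log_mul two_ne_zero hKr.ne']
    linarith [Real.log_two_lt_d9]
  have hsum : ∑ k ∈ Finset.range K, (a k - 1 / K) = ∑ k ∈ Finset.range K, a k - 1 := by
    rw [Finset.sum_sub_distrib, Finset.sum_const, Finset.card_range, nsmul_eq_mul,
      mul_one_div_cancel hKr.ne']
  have hlog0 := Real.log_natCast_nonneg K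
  have hDB : D * (B * Real.log (2 / (1 / K))) ≤ D * (B * (1 + Real.log K)) := by gcongr
  nlinarith [mul_nonneg (zero_le_one.trans hD) hb.le, mul_nonneg (zero_le_one.trans hD) hlog0]

theorem sum_le_of_eluderDim_le (hK : 0 < K) (hdim : eluderDim Ψ 𝔇 (1 / K) ≤ D)
    (hψ : ∀ k < K, ψ k ∈ Ψ) (hμ : ∀ k < K, μ k ∈ 𝔇) {B : ℝ} (hB : 0 ≤ B)
    (hpast : ∀ k < K, ∑ i ∈ Finset.range k, |∫ s, ψ k s ∂(μ i)| ≤ B)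
    (htwo : ∀ k < K, |∫ s, ψ k s ∂(μ k)| ≤ 2) :
    ∑ k ∈ Finset.range K, |∫ s, ψ k s ∂(μ k)| ≤
      (B + 3) * ((max 1 D : ℕ) : ℝ) * (1 + Real.log K) := by
  refine sum_le_of_card_filter_lt_le hK hB (by exact_mod_cast le_max_left 1 D) htwo
    fun ε hε => ?_
  have hε0 : 0 < ε := (by positivity : (0 : ℝ) < 1 / K).trans_le hε
  have hcard := card_filter_lt_le_of_eluderDim_le hdim hψ hμ (Nat.succ_pos ⌊B / ε⌋₊) hε
    fun k hk => (hpast k hk).trans <| by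
      rw [← div_le_iff₀ hε0]
      exact_mod_cast (Nat.lt_floor_add_one (B / ε)).le
  calc (((Finset.range K).filter (fun k => ε < |∫ s, ψ k s ∂(μ k)|)).card : ℝ)
      ≤ ((⌊B / ε⌋₊ : ℝ) + 1) * (D : ℝ) := by exact_mod_cast hcard
    _ ≤ (B / ε + 1) * ((max 1 D : ℕ) : ℝ) := by
        gcongr
        · exact Nat.floor_le (by positivity)
        · exact le_max_right 1 D

end Eluder

section BddMeas

variable {E G : Type*} [MeasurableSpace E] [MeasurableSpace G]

/-- Bounded measurable real functions; they are integrable against every finite measure and stable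
under integration along Markov kernels, so no separate integrability bookkeeping is needed. -/
structure BddMeas (φ : E → ℝ) : Prop where
  measurable : Measurable φ
  exists_bound : ∃ B, ∀ x, |φ x| ≤ B

namespace BddMeas

variable {φ χ : E → ℝ}

lemma integrable (hφ : BddMeas φ) (μ : Measure E) [IsFiniteMeasure μ] : Integrable φ μ := by
  obtain ⟨B, hB⟩ := hφ.exists_bound
  exact Integrable.of_bound hφ.measurable.aestronglyMeasurable B
    (Filter.Eventually.of_forall hB)

lemma const (c : ℝ) : BddMeas (fun _ : E => c) := ⟨measurable_const, |c|, fun _ => le_rfl⟩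

lemma add (hφ : BddMeas φ) (hχ : BddMeas χ) : BddMeas (fun x => φ x + χ x) := by
  obtain ⟨B, hB⟩ := hφ.exists_bound
  obtain ⟨D, hD⟩ := hχ.exists_bound
  exact ⟨hφ.measurable.add hχ.measurable, B + D,
    fun x => (abs_add_le _ _).trans (add_le_add (hB x) (hD x))⟩

lemma mul (hφ : BddMeas φ) (hχ : BddMeas χ) : BddMeas (fun x => φ x * χ x) := by
  obtain ⟨B, hB⟩ := hφ.exists_bound
  obtain ⟨D, hD⟩ := hχ.exists_bound
  refine ⟨hφ.measurable.mul hχ.measurable, B * D, fun x => ?_⟩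
  rw [abs_mul]
  exact mul_le_mul (hB x) (hD x) (abs_nonneg _) ((abs_nonneg _).trans (hB x))

lemma sub (hφ : BddMeas φ) (hχ : BddMeas χ) : BddMeas (fun x => φ x - χ x) := by
  simpa [sub_eq_add_neg] using hφ.add ((const (-1)).mul hχ)

lemma sq (hφ : BddMeas φ) : BddMeas (fun x => φ x ^ 2) := by
  simpa only [pow_two] using hφ.mul hφ

lemma comp (hφ : BddMeas φ) {g : G → E} (hg : Measurable g) : BddMeas (fun x => φ (g x)) :=
  ⟨hφ.measurable.comp hg, hφ.exists_bound.imp fun _ h x => h (g x)⟩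

lemma sum {ι : Type*} (s : Finset ι) {φ : ι → E → ℝ} (h : ∀ i ∈ s, BddMeas (φ i)) :
    BddMeas (fun x => ∑ i ∈ s, φ i x) := by
  classical
  induction s using Finset.induction_on with
  | empty => simpa using const 0
  | insert a s ha ih =>
    simp only [Finset.sum_insert ha]
    exact (h a (Finset.mem_insert_self _ _)).add
      (ih fun i hi => h i (Finset.mem_insert_of_mem hi))

lemma of_mem_Icc {B : ℝ} (h : Measurable φ) (h0 : ∀ x, 0 ≤ φ x) (h1 : ∀ x, φ x ≤ B) :
    BddMeas φ := ⟨h, B, fun x => by rw [abs_of_nonneg (h0 x)]; exact h1 x⟩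

lemma integral_kernel_prod {φ : E × G → ℝ} (hφ : BddMeas φ) (κ : Kernel E G)
    [IsMarkovKernel κ] : BddMeas (fun x => ∫ y, φ (x, y) ∂(κ x)) := by
  obtain ⟨B, hB⟩ := hφ.exists_bound
  refine ⟨(StronglyMeasurable.integral_kernel_prod_right' (κ := κ)
    hφ.measurable.stronglyMeasurable).measurable, B, fun x => ?_⟩
  have := norm_integral_le_of_norm_le_const (μ := κ x) (f := fun y => φ (x, y)) (C := B)
    (Filter.Eventually.of_forall fun y => hB (x, y))
  simpa using this

lemma integral_kernel {φ : G → ℝ} (hφ : BddMeas φ) (κ : Kernel E G)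
    [IsMarkovKernel κ] : BddMeas (fun x => ∫ y, φ y ∂(κ x)) :=
  integral_kernel_prod (φ := fun p : E × G => φ p.2) (hφ.comp measurable_snd) κ

end BddMeas

lemma integral_id_prod {φ : E × G → ℝ} (hφ : Measurable φ) (κ : Kernel E G) [IsSFiniteKernel κ]
    (x : E) : ∫ p, φ p ∂((Kernel.id ×ₖ κ) x) = ∫ y, φ (x, y) ∂(κ x) := by
  rw [Kernel.prod_apply, Kernel.id_apply, Measure.dirac_prod,
    integral_map measurable_prodMk_left.aemeasurable hφ.aestronglyMeasurable]

end BddMeas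

section Roll

variable {X A : Type*} [MeasurableSpace X] [MeasurableSpace A] (M : MDP X A) (π : Policy X A)

/-- The law of an observed transition given its state-action pair. -/
def MDP.obs (h : ℕ) : Kernel (X × A) (Step X A) := Kernel.id ×ₖ (M.C h ×ₖ M.P h)

instance (h : ℕ) : IsMarkovKernel (M.obs h) := by unfold MDP.obs; infer_instance

lemma stepKernel_eq_obs_comp (h : ℕ) (ρ : Kernel X A) :
    M.stepKernel h ρ = M.obs h ∘ₖ (Kernel.id ×ₖ ρ) := rfl

lemma integral_obs {φ : Step X A → ℝ} (hφ : Measurable φ) (h : ℕ) (xa : X × A) :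
    ∫ s, φ s ∂(M.obs h xa) = ∫ p, φ (xa, p) ∂((M.C h xa).prod (M.P h xa)) := by
  rw [MDP.obs, integral_id_prod hφ, Kernel.prod_apply]

lemma lintegral_obs {φ : Step X A → ℝ≥0∞} (hφ : Measurable φ) (h : ℕ) (xa : X × A) :
    ∫⁻ s, φ s ∂(M.obs h xa) = ∫⁻ c, ∫⁻ x', φ (xa, c, x') ∂(M.P h xa) ∂(M.C h xa) := by
  rw [MDP.obs, Kernel.lintegral_id_prod hφ, Kernel.prod_apply,
    lintegral_prod _ (by fun_prop)]

lemma integral_stepKernel {φ : Step X A → ℝ} (hφ : BddMeas φ) (h : ℕ) (ρ : Kernel X A)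
    [IsMarkovKernel ρ] (x : X) :
    ∫ s, φ s ∂(M.stepKernel h ρ x) =
      ∫ a, ∫ p, φ ((x, a), p) ∂((M.C h (x, a)).prod (M.P h (x, a))) ∂(ρ x) := by
  rw [stepKernel_eq_obs_comp, Kernel.integral_comp (hφ.integrable _),
    integral_id_prod (hφ.integral_kernel _).measurable]
  simp only [integral_obs M hφ.measurable]

lemma integral_roll_succ {n : ℕ} {φ : (Fin (n + 1) → Step X A) → ℝ} (hφ : BddMeas φ) (h : ℕ)
    (x : X) :
    ∫ τ, φ τ ∂(M.roll π (n + 1) h x) =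
      ∫ s, ∫ τ, φ (Fin.cons (α := fun _ => Step X A) s τ) ∂(M.roll π n (h + 1) s.2.2)
        ∂(M.stepKernel h (π.kern h) x) := by
  rw [MDP.roll, Kernel.map_apply _ (measurable_cons n),
    integral_map (measurable_cons n).aemeasurable hφ.measurable.aestronglyMeasurable,
    integral_compProd ((hφ.comp (measurable_cons n)).integrable _)]
  rfl

/-- The law of the state reached after `i` steps from a state at step `h`. -/
def MDP.stateLaw : ℕ → ℕ → Kernel X X
  | _, 0 => Kernel.id
  | h, i + 1 => MDP.stateLaw (h + 1) i ∘ₖ (M.P h ∘ₖ (Kernel.id ×ₖ π.kern h))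

instance isMarkovKernel_stateLaw (h i : ℕ) : IsMarkovKernel (M.stateLaw π h i) := by
  induction i generalizing h with
  | zero => unfold MDP.stateLaw; infer_instance
  | succ i ih => have := ih (h + 1); unfold MDP.stateLaw; infer_instance

lemma stateLaw_succ (h i : ℕ) :
    M.stateLaw π h (i + 1) =
      (M.P (h + i) ∘ₖ (Kernel.id ×ₖ π.kern (h + i))) ∘ₖ M.stateLaw π h i := by
  induction i generalizing h with
  | zero => simp [MDP.stateLaw]
  | succ i ih =>
    rw [MDP.stateLaw, ih (h + 1), MDP.stateLaw.eq_2 M π h i, ← Kernel.comp_assoc,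
      show h + 1 + i = h + (i + 1) by ring]
    simp only [Kernel.comp_assoc]

lemma map_snd_stepKernel (h : ℕ) (ρ : Kernel X A) :
    (M.stepKernel h ρ).map (fun s => s.2.2) = M.P h ∘ₖ (Kernel.id ×ₖ ρ) := by
  rw [stepKernel_eq_obs_comp, Kernel.map_comp]
  congr 1
  have : (fun s : Step X A => s.2.2) = Prod.snd ∘ Prod.snd := rfl
  rw [this, Kernel.map_comp_right _ measurable_snd measurable_snd, ← Kernel.snd_eq,
    ← Kernel.snd_eq, MDP.obs, Kernel.snd_prod, Kernel.snd_prod]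

lemma map_fst_stepKernel (h : ℕ) (ρ : Kernel X A) :
    (M.stepKernel h ρ).map (fun s => s.1) = Kernel.id ×ₖ ρ := by
  rw [stepKernel_eq_obs_comp, Kernel.map_comp]
  have : (M.obs h).map (fun s : Step X A => s.1) = Kernel.id := by
    change (M.obs h).map Prod.fst = _
    rw [← Kernel.fst_eq, MDP.obs, Kernel.fst_prod]
  rw [this, Kernel.id_comp]

lemma map_roll_zero (n h : ℕ) :
    (M.roll π (n + 1) h).map (fun τ => τ 0) = M.stepKernel h (π.kern h) := by
  rw [MDP.roll, ← Kernel.map_comp_right _ (measurable_cons n) (measurable_pi_apply 0)]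
  have : ((fun τ : Fin (n + 1) → Step X A => τ 0) ∘
      fun p : Step X A × (Fin n → Step X A) => Fin.cons (α := fun _ => Step X A) p.1 p.2) =
      Prod.fst := by ext p <;> simp
  rw [this, ← Kernel.fst_eq, Kernel.fst_compProd]

lemma map_roll_succ (n h : ℕ) (i : Fin n) :
    (M.roll π (n + 1) h).map (fun τ => τ i.succ) =
      (M.roll π n (h + 1)).map (fun τ => τ i) ∘ₖ (M.P h ∘ₖ (Kernel.id ×ₖ π.kern h)) := by
  rw [MDP.roll, ← Kernel.map_comp_right _ (measurable_cons n) (measurable_pi_apply i.succ)]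
  have : ((fun τ : Fin (n + 1) → Step X A => τ i.succ) ∘
      fun p : Step X A × (Fin n → Step X A) => Fin.cons (α := fun _ => Step X A) p.1 p.2) =
      (fun τ => τ i) ∘ Prod.snd := by ext p <;> simp
  have hm : Measurable (fun s : Step X A => s.2.2) := measurable_snd.comp measurable_snd
  rw [this, Kernel.map_comp_right _ measurable_snd (measurable_pi_apply i), ← Kernel.snd_eq,
    show (M.roll π n (h + 1)).comap (fun p : X × Step X A => p.2.2.2)
      (measurable_snd.comp (measurable_snd.comp measurable_snd)) =
      Kernel.prodMkLeft X ((M.roll π n (h + 1)).comap (fun s : Step X A => s.2.2) hm) from rfl,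
    ← Kernel.comp_eq_snd_compProd, Kernel.map_comp, ← map_snd_stepKernel M h (π.kern h),
    Kernel.comp_map _ _ hm, Kernel.comap_map_comm _ hm (measurable_pi_apply i)]

lemma map_roll_apply (n h : ℕ) (i : Fin n) :
    (M.roll π n h).map (fun τ => τ i) =
      M.stepKernel (h + i) (π.kern (h + i)) ∘ₖ M.stateLaw π h i := by
  induction n generalizing h with
  | zero => exact i.elim0
  | succ n ih =>
    refine Fin.cases ?_ (fun j => ?_) i
    · rw [map_roll_zero]; simp [MDP.stateLaw]
    · rw [map_roll_succ, ih, Fin.val_succ, MDP.stateLaw, Kernel.comp_assoc,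
        show h + 1 + (j : ℕ) = h + (j + 1) by ring]

variable {H : ℕ}

lemma occ_eq (h : Fin H) :
    M.occ π h = (Kernel.id ×ₖ π.kern h) ∘ₖ M.stateLaw π 0 h := by
  have : (fun τ : Fin H → Step X A => (τ h).1) = Prod.fst ∘ fun τ => τ h := rfl
  rw [MDP.occ, this, Kernel.map_comp_right _ (measurable_pi_apply h) measurable_fst,
    map_roll_apply, Kernel.map_comp, zero_add]
  congr 1
  exact map_fst_stepKernel M h (π.kern h)

instance (h : Fin H) : IsMarkovKernel (M.occ π h) := by
  rw [occ_eq]; infer_instance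

lemma stateOcc_eq (h : Fin H) : M.stateOcc π h = M.stateLaw π 0 h := by
  have : (fun τ : Fin H → Step X A => (τ h).1.1) = Prod.fst ∘ fun τ => (τ h).1 := rfl
  rw [MDP.stateOcc, this, Kernel.map_comp_right _ (by fun_prop) measurable_fst]
  change (M.occ π h).map Prod.fst = _
  rw [occ_eq, Kernel.map_comp, ← Kernel.fst_eq, Kernel.fst_prod, Kernel.id_comp]

instance (h : Fin H) : IsMarkovKernel (M.stateOcc π h) := by
  rw [stateOcc_eq]; infer_instance

lemma map_roll_eq_obs_comp_occ (h : Fin H) :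
    (M.roll π H 0).map (fun τ => τ h) = M.obs h ∘ₖ M.occ π h := by
  rw [map_roll_apply, occ_eq, zero_add, stepKernel_eq_obs_comp, Kernel.comp_assoc]

lemma stateLaw_succ_eq_comp_occ (h : Fin H) :
    M.stateLaw π 0 (h + 1) = M.P h ∘ₖ M.occ π h := by
  rw [stateLaw_succ, occ_eq, zero_add, Kernel.comp_assoc]

end Roll

/-- Truncation to `[0, B]`; it makes almost surely bounded costs and returns bounded everywhere. -/
def clamp (B z : ℝ) : ℝ := max 0 (min B z)

lemma clamp_of_mem {B z : ℝ} (hz : z ∈ Set.Icc 0 B) : clamp B z = z := by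
  rw [clamp, min_eq_right hz.2, max_eq_right hz.1]

lemma bddMeas_clamp {B : ℝ} (hB : 0 ≤ B) : BddMeas (clamp B) :=
  BddMeas.of_mem_Icc (B := B) (by unfold clamp; fun_prop) (fun _ => le_max_left _ _)
    fun _ => max_le hB (min_le_left _ _)

section Martingale

variable {X A : Type*} [MeasurableSpace X] [MeasurableSpace A] (M : MDP X A) (π : Policy X A)
  (w : ℕ → X → ℝ)

/-- The one-step lookahead `E[c + w_{t+1}(x')]` of a potential `w`. Clamping the cost, which changes
it on a null set only, makes every integrand bounded. -/
def MDP.lookahead (t : ℕ) (xa : X × A) : ℝ :=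
  ∫ p, (clamp 1 p.1 + w (t + 1) p.2) ∂((M.C t xa).prod (M.P t xa))

/-- The one-step conditional variance `Var(c + w_{t+1}(x'))`. -/
def MDP.stepVar (t : ℕ) (xa : X × A) : ℝ :=
  ∫ p, (clamp 1 p.1 + w (t + 1) p.2 - M.lookahead w t xa) ^ 2 ∂((M.C t xa).prod (M.P t xa))

/-- The Bellman residual `E[c + w_{t+1}(x')] - w_t(x)` of a potential `w`. -/
def MDP.drift (t : ℕ) (xa : X × A) : ℝ := M.lookahead w t xa - w t xa.1

/-- The return of a trajectory with clamped costs; almost surely equal to `ret`. -/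
def clampedRet {n : ℕ} (τ : Fin n → Step X A) : ℝ := ∑ i, clamp 1 (τ i).2.1

/-- The martingale part of the return of an `n`-step trajectory from state `x` at step `h`, relative
to the potential `w`. -/
def MDP.fluctuation (n h : ℕ) (x : X) (τ : Fin n → Step X A) : ℝ :=
  clampedRet τ - w h x - ∑ i : Fin n, M.drift w (h + i) (τ i).1

/-- The martingale increment of the step `s` taken at time `h` from state `x`. The trailing
difference vanishes as soon as `s` starts at `x`; with it, `fluctuation_cons` holds pointwise. -/
def MDP.increment (h : ℕ) (x : X) (s : Step X A) : ℝ :=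
  clamp 1 s.2.1 + w (h + 1) s.2.2 - M.lookahead w h s.1 + (w h s.1.1 - w h x)

variable {w}

lemma bddMeas_clamp_add (t : ℕ) (hw : BddMeas (w (t + 1))) :
    BddMeas (fun p : ℝ × X => clamp 1 p.1 + w (t + 1) p.2) :=
  ((bddMeas_clamp zero_le_one).comp measurable_fst).add (hw.comp measurable_snd)

lemma bddMeas_lookahead (t : ℕ) (hw : BddMeas (w (t + 1))) : BddMeas (M.lookahead w t) := by
  have := (bddMeas_clamp_add t hw).integral_kernel (M.C t ×ₖ M.P t)
  simp only [Kernel.prod_apply] at this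
  exact this

lemma bddMeas_stepVar (t : ℕ) (hw : BddMeas (w (t + 1))) : BddMeas (M.stepVar w t) := by
  have := BddMeas.integral_kernel_prod (φ := fun q : (X × A) × ℝ × X =>
    (clamp 1 q.2.1 + w (t + 1) q.2.2 - M.lookahead w t q.1) ^ 2)
    ((((bddMeas_clamp_add t hw).comp measurable_snd).sub
      ((bddMeas_lookahead M t hw).comp measurable_fst)).sq) (M.C t ×ₖ M.P t)
  simp only [Kernel.prod_apply] at this
  exact this

lemma stepVar_nonneg (t : ℕ) (xa : X × A) : 0 ≤ M.stepVar w t xa :=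
  integral_nonneg fun _ => sq_nonneg _

lemma bddMeas_clampedRet (n : ℕ) : BddMeas (clampedRet : (Fin n → Step X A) → ℝ) :=
  BddMeas.sum _ fun _ _ => (bddMeas_clamp zero_le_one).comp (by fun_prop)

lemma bddMeas_sum_fst {n : ℕ} {φ : Fin n → X × A → ℝ} (hφ : ∀ i, BddMeas (φ i)) :
    BddMeas (fun τ : Fin n → Step X A => ∑ i, φ i (τ i).1) :=
  BddMeas.sum _ fun i _ => (hφ i).comp (by fun_prop)

lemma bddMeas_drift (hw : ∀ t, BddMeas (w t)) (t : ℕ) : BddMeas (M.drift w t) :=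
  (bddMeas_lookahead M t (hw _)).sub ((hw t).comp measurable_fst)

lemma bddMeas_fluctuation (hw : ∀ t, BddMeas (w t)) (n h : ℕ) (x : X) :
    BddMeas (M.fluctuation w n h x) :=
  ((bddMeas_clampedRet n).sub (BddMeas.const _)).sub
    (bddMeas_sum_fst fun _ => bddMeas_drift M hw _)

lemma bddMeas_increment (hw : ∀ t, BddMeas (w t)) (h : ℕ) (x : X) :
    BddMeas (M.increment w h x) :=
  (((bddMeas_clamp_add h (hw _)).comp (by fun_prop)).sub
    ((bddMeas_lookahead M h (hw _)).comp (by fun_prop))).add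
    (((hw h).comp (by fun_prop)).sub (BddMeas.const _))

lemma fluctuation_zero (h : ℕ) (hend : ∀ x, w h x = 0) (x : X) (τ : Fin 0 → Step X A) :
    M.fluctuation w 0 h x τ = 0 := by
  simp [MDP.fluctuation, clampedRet, hend]

lemma fluctuation_cons (n h : ℕ) (x : X) (s : Step X A) (τ : Fin n → Step X A) :
    M.fluctuation w (n + 1) h x (Fin.cons (α := fun _ => Step X A) s τ) =
      M.increment w h x s + M.fluctuation w n (h + 1) s.2.2 τ := by
  have hshift (i : Fin n) : h + ((i : ℕ) + 1) = h + 1 + i := by ring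
  simp only [MDP.fluctuation, clampedRet, MDP.increment, MDP.drift, Fin.sum_univ_succ,
    Fin.cons_zero, Fin.cons_succ, Fin.val_zero, Fin.val_succ, add_zero, hshift]
  ring

lemma integral_const_add {E : Type*} [MeasurableSpace E] {μ : Measure E} [IsProbabilityMeasure μ]
    {φ : E → ℝ} (hφ : Integrable φ μ) (c : ℝ) : ∫ x, (c + φ x) ∂μ = c + ∫ x, φ x ∂μ := by
  rw [integral_add (integrable_const c) hφ]
  simp

lemma integral_const_add_sq {E : Type*} [MeasurableSpace E] {μ : Measure E}
    [IsProbabilityMeasure μ] {φ : E → ℝ} (hφ : BddMeas φ) (hmean : ∫ x, φ x ∂μ = 0) (c : ℝ) :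
    ∫ x, (c + φ x) ^ 2 ∂μ = c ^ 2 + ∫ x, φ x ^ 2 ∂μ := by
  simp only [add_sq, add_assoc]
  rw [integral_const_add ((((BddMeas.const _).mul hφ).add hφ.sq).integrable μ),
    integral_add (((BddMeas.const _).mul hφ).integrable μ) (hφ.sq.integrable μ),
    integral_const_mul, hmean, mul_zero, zero_add]

lemma integral_increment (hw : ∀ t, BddMeas (w t)) (h : ℕ) (ρ : Kernel X A) [IsMarkovKernel ρ]
    (x : X) : ∫ s, M.increment w h x s ∂(M.stepKernel h ρ x) = 0 := by
  rw [integral_stepKernel M (bddMeas_increment M hw h x)]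
  refine integral_eq_zero_of_ae (Filter.Eventually.of_forall fun a => ?_)
  simp only [MDP.increment, sub_self, add_zero, Pi.zero_apply]
  rw [integral_sub ((bddMeas_clamp_add h (hw _)).integrable _) (integrable_const _)]
  simp [MDP.lookahead]

lemma integral_sq_increment (hw : ∀ t, BddMeas (w t)) (h : ℕ) (ρ : Kernel X A)
    [IsMarkovKernel ρ] (x : X) :
    ∫ s, M.increment w h x s ^ 2 ∂(M.stepKernel h ρ x) =
      ∫ s, M.stepVar w h s.1 ∂(M.stepKernel h ρ x) := by
  rw [integral_stepKernel M (bddMeas_increment M hw h x).sq,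
    integral_stepKernel M ((bddMeas_stepVar M h (hw _)).comp measurable_fst)]
  simp [MDP.increment, MDP.stepVar]

lemma integral_fluctuation (hw : ∀ t, BddMeas (w t)) (n h : ℕ) (hend : ∀ x, w (h + n) x = 0)
    (x : X) : ∫ τ, M.fluctuation w n h x τ ∂(M.roll π n h x) = 0 := by
  induction n generalizing h x with
  | zero => simp [fluctuation_zero M h hend]
  | succ n ih =>
    have htail := ih (h + 1) (by simpa only [add_assoc, add_comm 1] using hend)
    rw [integral_roll_succ M π (bddMeas_fluctuation M hw _ h x)]
    simp only [fluctuation_cons]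
    calc ∫ s, ∫ τ, (M.increment w h x s + M.fluctuation w n (h + 1) s.2.2 τ)
          ∂(M.roll π n (h + 1) s.2.2) ∂(M.stepKernel h (π.kern h) x)
        = ∫ s, M.increment w h x s ∂(M.stepKernel h (π.kern h) x) := by
          refine integral_congr_ae (Filter.Eventually.of_forall fun s => ?_)
          dsimp only
          rw [integral_const_add ((bddMeas_fluctuation M hw n (h + 1) _).integrable _), htail,
            add_zero]
      _ = 0 := integral_increment M hw h (π.kern h) x

lemma integral_sq_fluctuation (hw : ∀ t, BddMeas (w t)) (n h : ℕ)
    (hend : ∀ x, w (h + n) x = 0) (x : X) :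
    ∫ τ, M.fluctuation w n h x τ ^ 2 ∂(M.roll π n h x) =
      ∫ τ, ∑ i : Fin n, M.stepVar w (h + i) (τ i).1 ∂(M.roll π n h x) := by
  induction n generalizing h x with
  | zero => simp [fluctuation_zero M h hend]
  | succ n ih =>
    have hend' : ∀ x, w (h + 1 + n) x = 0 := by simpa only [add_assoc, add_comm 1] using hend
    have hshift (i : Fin n) : h + ((i : ℕ) + 1) = h + 1 + i := by ring
    have hvar (t : ℕ) := bddMeas_stepVar M t (hw (t + 1))
    have htail := ((bddMeas_sum_fst fun i : Fin n => hvar (h + 1 + i)).integral_kernel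
      (M.roll π n (h + 1))).comp (g := fun s : Step X A => s.2.2) (by fun_prop)
    rw [integral_roll_succ M π (bddMeas_fluctuation M hw _ h x).sq,
      integral_roll_succ M π (bddMeas_sum_fst fun i : Fin (n + 1) => hvar (h + i))]
    simp only [fluctuation_cons, Fin.sum_univ_succ, Fin.cons_zero, Fin.cons_succ, Fin.val_zero,
      Fin.val_succ, add_zero, hshift, integral_const_add
        ((bddMeas_sum_fst fun i : Fin n => hvar (h + 1 + i)).integrable _),
      integral_const_add_sq (bddMeas_fluctuation M hw n (h + 1) _)
        (integral_fluctuation M π hw n (h + 1) hend' _), ih (h + 1) hend']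
    rw [integral_add ((bddMeas_increment M hw h x).sq.integrable _) (htail.integrable _),
      integral_add (((hvar h).comp measurable_fst).integrable _) (htail.integrable _),
      integral_sq_increment M hw h (π.kern h) x]

section Horizon

variable {H : ℕ}

lemma integral_sum_roll {φ : Fin H → X × A → ℝ} (hφ : ∀ h, BddMeas (φ h)) (x : X) :
    ∫ τ, ∑ h, φ h (τ h).1 ∂(M.roll π H 0 x) = ∑ h, ∫ xa, φ h xa ∂(M.occ π h x) := by
  rw [integral_finsetSum _ fun h _ => ((hφ h).comp (by fun_prop)).integrable _]
  refine Finset.sum_congr rfl fun h _ => ?_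
  rw [MDP.occ, Kernel.map_apply _ (by fun_prop), integral_map
    (by fun_prop : Measurable fun τ : Fin H → Step X A => (τ h).1).aemeasurable
    (hφ h).measurable.aestronglyMeasurable]

lemma ae_cost_mem_Icc (h : Fin H) (x : X) :
    ∀ᵐ τ ∂(M.roll π H 0 x), (τ h).2.1 ∈ Set.Icc (0 : ℝ) 1 := by
  have hm : MeasurableSet {s : Step X A | s.2.1 ∈ Set.Icc (0 : ℝ) 1} :=
    measurableSet_Icc.preimage (by fun_prop : Measurable fun s : Step X A => s.2.1)
  have hstep : ∀ᵐ s ∂(((M.roll π H 0).map (fun τ => τ h)) x), s.2.1 ∈ Set.Icc (0 : ℝ) 1 := by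
    rw [map_roll_eq_obs_comp_occ]
    refine Kernel.ae_comp_of_ae_ae hm (Filter.Eventually.of_forall fun xa => ?_)
    rw [MDP.obs, Kernel.prod_apply, Kernel.id_apply, Measure.dirac_prod,
      ae_map_iff (by fun_prop) hm, Kernel.prod_apply]
    exact Measure.quasiMeasurePreserving_fst.ae (M.cost_mem h xa)
  rw [Kernel.map_apply _ (measurable_pi_apply h)] at hstep
  exact ae_of_ae_map (measurable_pi_apply h).aemeasurable hstep

lemma ret_ae_eq_clampedRet (x : X) :
    (ret : (Fin H → Step X A) → ℝ) =ᵐ[M.roll π H 0 x] clampedRet := by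
  filter_upwards [ae_all_iff.2 fun h => ae_cost_mem_Icc M π h x] with τ hτ
  exact Finset.sum_congr rfl fun h _ => (clamp_of_mem (hτ h)).symm

lemma value_eq_integral_clampedRet (x : X) :
    M.value H π x = ∫ τ, clampedRet τ ∂(M.roll π H 0 x) :=
  integral_congr_ae (ret_ae_eq_clampedRet M π x)

lemma value_sub_eq_sum_drift (hw : ∀ t, BddMeas (w t)) (hend : ∀ x, w H x = 0) (x : X) :
    M.value H π x - w 0 x = ∑ h : Fin H, ∫ xa, M.drift w h xa ∂(M.occ π h x) := by
  have hret := bddMeas_clampedRet (X := X) (A := A) H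
  have hdrift := bddMeas_sum_fst fun h : Fin H => bddMeas_drift M hw h
  have hzero := integral_fluctuation M π hw H 0 (by simpa using hend) x
  simp only [MDP.fluctuation, zero_add] at hzero
  rw [integral_sub ((hret.sub (BddMeas.const _)).integrable _) (hdrift.integrable _),
    integral_sub (hret.integrable _) (integrable_const _), integral_const, probReal_univ,
    one_smul, ← value_eq_integral_clampedRet,
    integral_sum_roll M π fun h => bddMeas_drift M hw h] at hzero
  linarith

lemma variance_sum_drift_le (hw : ∀ t, BddMeas (w t)) (x : X) :
    Var[fun τ => ∑ h : Fin H, M.drift w h (τ h).1; M.roll π H 0 x] ≤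
      H * ∑ h : Fin H, ∫ xa, M.drift w h xa ^ 2 ∂(M.occ π h x) := by
  have hdrift := bddMeas_sum_fst fun h : Fin H => bddMeas_drift M hw h
  have hsq (h : Fin H) := (bddMeas_drift M hw h).sq
  refine (variance_le_expectation_sq hdrift.measurable.aestronglyMeasurable).trans ?_
  rw [← integral_sum_roll M π hsq, ← integral_const_mul]
  refine integral_mono (hdrift.sq.integrable _)
    (((bddMeas_sum_fst hsq).integrable _).const_mul _) fun τ => ?_
  simpa using sq_sum_le_card_mul_sum_sq (s := Finset.univ)
    (f := fun h : Fin H => M.drift w h (τ h).1)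

lemma variance_sub_le {E : Type*} [MeasurableSpace E] {μ : Measure E} [IsProbabilityMeasure μ]
    {φ χ : E → ℝ} (hφ : BddMeas φ) (hχ : BddMeas χ) :
    Var[fun x => φ x - χ x; μ] ≤ 2 * Var[φ; μ] + 2 * Var[χ; μ] := by
  have hdev {ξ : E → ℝ} (hξ : BddMeas ξ) : BddMeas fun x => (ξ x - μ[ξ]) ^ 2 :=
    (hξ.sub (BddMeas.const _)).sq
  rw [variance_eq_integral (hφ.sub hχ).measurable.aemeasurable,
    variance_eq_integral hφ.measurable.aemeasurable,
    variance_eq_integral hχ.measurable.aemeasurable, ← integral_const_mul, ← integral_const_mul,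
    ← integral_add (((hdev hφ).integrable μ).const_mul 2) (((hdev hχ).integrable μ).const_mul 2),
    integral_sub (hφ.integrable μ) (hχ.integrable μ)]
  refine integral_mono ((hdev (hφ.sub hχ)).integrable μ |>.congr ?_)
    ((((hdev hφ).integrable μ).const_mul 2).add (((hdev hχ).integrable μ).const_mul 2))
    fun x => ?_
  · rw [integral_sub (hφ.integrable μ) (hχ.integrable μ)]
  · nlinarith only [sq_nonneg ((φ x - μ[φ]) + (χ x - μ[χ]))]

lemma sum_stepVar_le (hw : ∀ t, BddMeas (w t)) (hend : ∀ x, w H x = 0) (x : X) :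
    ∑ h : Fin H, ∫ xa, M.stepVar w h xa ∂(M.occ π h x) ≤
      2 * M.returnVar H π x +
        2 * H * ∑ h : Fin H, ∫ xa, M.drift w h xa ^ 2 ∂(M.occ π h x) := by
  have hend' : ∀ x, w (0 + H) x = 0 := by simpa using hend
  have hret := bddMeas_clampedRet (X := X) (A := A) H
  calc ∑ h : Fin H, ∫ xa, M.stepVar w h xa ∂(M.occ π h x)
      = ∫ τ, M.fluctuation w H 0 x τ ^ 2 ∂(M.roll π H 0 x) := by
        rw [integral_sq_fluctuation M π hw H 0 hend' x]
        simp only [zero_add]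
        rw [integral_sum_roll M π fun h => bddMeas_stepVar M h (hw _)]
    _ = Var[M.fluctuation w H 0 x; M.roll π H 0 x] :=
        (variance_of_integral_eq_zero (bddMeas_fluctuation M hw H 0 x).measurable.aemeasurable
          (integral_fluctuation M π hw H 0 hend' x)).symm
    _ ≤ 2 * Var[fun τ => clampedRet τ - w 0 x; M.roll π H 0 x] +
          2 * Var[fun τ => ∑ h : Fin H, M.drift w h (τ h).1; M.roll π H 0 x] := by
        have hsplit : M.fluctuation w H 0 x =
            fun τ => clampedRet τ - w 0 x - ∑ h : Fin H, M.drift w h (τ h).1 := by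
          funext τ
          simp only [MDP.fluctuation, zero_add]
        rw [hsplit]
        exact variance_sub_le (hret.sub (BddMeas.const (w 0 x)))
          (bddMeas_sum_fst fun h : Fin H => bddMeas_drift M hw h)
    _ ≤ 2 * M.returnVar H π x +
          2 * H * ∑ h : Fin H, ∫ xa, M.drift w h xa ^ 2 ∂(M.occ π h x) := by
        rw [variance_sub_const hret.measurable.aestronglyMeasurable, MDP.returnVar,
          variance_congr (ret_ae_eq_clampedRet M π x)]
        linarith [variance_sum_drift_le (H := H) M π hw x]

end Horizon

end Martingale

section KernelMoments

lemma integral_const_add_sq_eq {μ : Measure ℝ} [IsProbabilityMeasure μ]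
    (hμ : MemLp id 2 μ) (a : ℝ) :
    ∫ y, (a + y) ^ 2 ∂μ = (a + ∫ y, y ∂μ) ^ 2 + Var[id; μ] := by
  have hshift : Var[fun y => a + y; μ] = Var[id; μ] :=
    variance_const_add (X := id) aestronglyMeasurable_id a
  have hmean : ∫ y, a + y ∂μ = a + ∫ y, y ∂μ := integral_const_add (hμ.integrable one_le_two) a
  rw [variance_eq_sub (X := fun y => a + y) ((memLp_const a).add hμ), hmean] at hshift
  simp only [Pi.pow_apply] at hshift
  linarith

variable {E : Type*} [MeasurableSpace E] {d : Kernel E ℝ} [IsMarkovKernel d]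

lemma bddMeas_integral_id (hd : ∀ x, ∀ᵐ y ∂(d x), y ∈ Set.Icc (0 : ℝ) 1) :
    BddMeas (fun x => ∫ y, y ∂(d x)) :=
  BddMeas.of_mem_Icc (StronglyMeasurable.integral_kernel (κ := d) (f := fun y : ℝ => y)
    stronglyMeasurable_id).measurable (fun x => (integral_mem_Icc (hd x)).1)
    fun x => (integral_mem_Icc (hd x)).2

lemma variance_id_le_one {μ : Measure ℝ} [IsProbabilityMeasure μ]
    (hμ : ∀ᵐ y ∂μ, y ∈ Set.Icc (0 : ℝ) 1) : Var[id; μ] ≤ 1 :=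
  (variance_le_expectation_sq measurable_id.aestronglyMeasurable).trans
    (integral_sq_le_one hμ)

lemma bddMeas_variance_id (hd : ∀ x, ∀ᵐ y ∂(d x), y ∈ Set.Icc (0 : ℝ) 1) :
    BddMeas (fun x => Var[id; d x]) := by
  refine BddMeas.of_mem_Icc ?_ (fun x => variance_nonneg _ _) fun x => variance_id_le_one (hd x)
  have hm := (bddMeas_integral_id hd).measurable
  simp only [variance_eq_integral measurable_id.aemeasurable, id]
  exact (StronglyMeasurable.integral_kernel_prod_right' (κ := d)
    (f := fun p : E × ℝ => (p.2 - ∫ y, y ∂(d p.1)) ^ 2)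
    ((measurable_snd.sub (hm.comp measurable_fst)).pow_const 2).stronglyMeasurable).measurable

end KernelMoments

section CondDens

variable {X A : Type*} [MeasurableSpace X] [MeasurableSpace A] {lam : Measure ℝ} {H : ℕ}

lemma CondDens.isDensity (f : CondDens X A lam) (xa : X × A) : IsDensity lam (f.dens xa) :=
  ⟨f.measurable_dens.comp measurable_prodMk_left, f.lintegral_eq_one xa⟩

lemma CondDens.law_apply [SFinite lam] (f : CondDens X A lam) (xa : X × A) :
    f.law xa = densLaw lam (f.dens xa) := by
  rw [CondDens.law, Kernel.withDensity_apply _ f.measurable_dens.coe_nnreal_ennreal,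
    Kernel.const_apply]
  rfl

instance [SFinite lam] (f : CondDens X A lam) : IsMarkovKernel f.law :=
  ⟨fun xa => by rw [f.law_apply]; exact (f.isDensity xa).isProbabilityMeasure⟩

lemma lawAt_of_lt [SFinite lam] (f : Fin H → CondDens X A lam) (h : Fin H) :
    lawAt f h = (f h).law := by simp [lawAt]

lemma lawAt_end [SFinite lam] (f : Fin H → CondDens X A lam) :
    lawAt f H = Kernel.const (X × A) (Measure.dirac 0) := by simp [lawAt]

instance [SFinite lam] (f : Fin H → CondDens X A lam) (n : ℕ) : IsMarkovKernel (lawAt f n) := by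
  unfold lawAt
  split_ifs <;> infer_instance

lemma ae_law [SFinite lam] (hlam : ∀ᵐ y ∂lam, y ∈ Set.Icc (0 : ℝ) 1) (f : CondDens X A lam)
    (xa : X × A) : ∀ᵐ y ∂(f.law xa), y ∈ Set.Icc (0 : ℝ) 1 := by
  rw [f.law_apply]; exact ae_densLaw hlam _

lemma ae_lawAt [SFinite lam] (hlam : ∀ᵐ y ∂lam, y ∈ Set.Icc (0 : ℝ) 1)
    (f : Fin H → CondDens X A lam) (n : ℕ) (xa : X × A) :
    ∀ᵐ y ∂(lawAt f n xa), y ∈ Set.Icc (0 : ℝ) 1 := by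
  unfold lawAt
  split_ifs
  · exact ae_law hlam _ xa
  · rw [Kernel.const_apply, ae_dirac_eq, Filter.eventually_pure]; simp

lemma triDisc_law [SigmaFinite lam] (f g : CondDens X A lam) (xa : X × A) :
    triDisc lam (f.law xa) (g.law xa) = triDens lam (f.dens xa) (g.dens xa) := by
  have hrn (f : CondDens X A lam) := Measure.rnDeriv_withDensity lam
    (f.isDensity xa).measurable.coe_nnreal_ennreal
  rw [f.law_apply, g.law_apply, triDisc, triDens]
  refine integral_congr_ae ?_
  filter_upwards [hrn f, hrn g] with y hf hg
  simp only [densLaw, hf, hg, ENNReal.coe_toReal]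

lemma bddMeas_triDens [SFinite lam] (f g : CondDens X A lam) :
    BddMeas (fun xa => triDens lam (f.dens xa) (g.dens xa)) := by
  refine BddMeas.of_mem_Icc ?_ (fun _ => triDens_nonneg lam _ _)
    fun xa => triDens_le_two (f.isDensity xa) (g.isDensity xa)
  have hf : Measurable (fun p : (X × A) × ℝ => (f.dens p.1 p.2 : ℝ)) :=
    f.measurable_dens.coe_nnreal_real
  have hg : Measurable (fun p : (X × A) × ℝ => (g.dens p.1 p.2 : ℝ)) :=
    g.measurable_dens.coe_nnreal_real
  exact (StronglyMeasurable.integral_prod_right' (ν := lam) (f := fun p : (X × A) × ℝ =>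
    ((f.dens p.1 p.2 : ℝ) - g.dens p.1 p.2) ^ 2 / ((f.dens p.1 p.2 : ℝ) + g.dens p.1 p.2))
    (((hf.sub hg).pow_const 2).div (hf.add hg)).stronglyMeasurable).measurable

lemma bddMeas_variance_dens [SFinite lam] (hlam : ∀ᵐ y ∂lam, y ∈ Set.Icc (0 : ℝ) 1)
    (f : CondDens X A lam) : BddMeas (fun xa => Var[id; densLaw lam (f.dens xa)]) := by
  simpa only [CondDens.law_apply] using bddMeas_variance_id (ae_law hlam f)

end CondDens

section Bellman

variable {X A : Type*} [MeasurableSpace X] [MeasurableSpace A] (M : MDP X A)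
  (am : ArgminRule A)

lemma measurable_greedyAct (d : Kernel (X × A) ℝ) : Measurable (greedyAct am d) :=
  am.measurable_act.comp (measurable_mean d)

lemma measurable_graph_greedyAct (d : Kernel (X × A) ℝ) :
    Measurable (fun x => (x, greedyAct am d x)) :=
  measurable_id.prodMk (measurable_greedyAct am d)

/-- The law `d(x, a)` at the greedy action `a = argmin_a d̄(x, a)`, as a kernel in `x`. -/
def greedyLaw (d : Kernel (X × A) ℝ) : Kernel X ℝ :=
  d.comap (fun x => (x, greedyAct am d x)) (measurable_graph_greedyAct am d)

instance (d : Kernel (X × A) ℝ) [IsMarkovKernel d] : IsMarkovKernel (greedyLaw am d) := by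
  unfold greedyLaw; infer_instance

lemma id_prod_greedyKernel (d : Kernel (X × A) ℝ) :
    Kernel.id ×ₖ greedyKernel am d =
      Kernel.deterministic (fun x => (x, greedyAct am d x)) (measurable_graph_greedyAct am d) :=
  Kernel.deterministic_prod_deterministic measurable_id (measurable_greedyAct am d)

lemma bellmanOpt_eq_map_prod_greedyLaw (h : ℕ) (d : Kernel (X × A) ℝ) :
    M.bellmanOpt am h d = (M.C h ×ₖ (greedyLaw am d ∘ₖ M.P h)).map (fun p => p.1 + p.2) := by
  rw [MDP.bellmanOpt, MDP.bellman, id_prod_greedyKernel, ← Kernel.comp_assoc,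
    Kernel.comp_deterministic_eq_comap]
  rfl

variable {d : Kernel (X × A) ℝ} [IsMarkovKernel d]

lemma integral_bellmanOpt {φ : ℝ → ℝ} (hφ : BddMeas φ) (h : ℕ) (xa : X × A) :
    ∫ z, φ z ∂(M.bellmanOpt am h d xa) =
      ∫ p, ∫ y, φ (p.1 + y) ∂(greedyLaw am d p.2) ∂((M.C h xa).prod (M.P h xa)) := by
  have hadd : Measurable (fun p : ℝ × ℝ => p.1 + p.2) := by fun_prop
  have hin : BddMeas (fun p : ℝ × X => ∫ y, φ (p.1 + y) ∂(greedyLaw am d p.2)) :=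
    BddMeas.integral_kernel_prod (φ := fun q : (ℝ × X) × ℝ => φ (q.1.1 + q.2))
      (hφ.comp (by fun_prop)) ((greedyLaw am d).comap Prod.snd measurable_snd)
  rw [bellmanOpt_eq_map_prod_greedyLaw, Kernel.map_apply _ hadd,
    integral_map hadd.aemeasurable hφ.measurable.aestronglyMeasurable, Kernel.prod_apply,
    integral_prod _ ((hφ.comp hadd).integrable _), integral_prod _ (hin.integrable _)]
  congr 1
  ext c
  exact Kernel.integral_comp ((hφ.comp (by fun_prop)).integrable _)

lemma lintegral_bellmanOpt {φ : ℝ → ℝ≥0∞} (hφ : Measurable φ) (h : ℕ) (xa : X × A) :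
    ∫⁻ z, φ z ∂(M.bellmanOpt am h d xa) =
      ∫⁻ c, ∫⁻ x', ∫⁻ y, φ (c + y) ∂(greedyLaw am d x') ∂(M.P h xa) ∂(M.C h xa) := by
  have hadd : Measurable (fun p : ℝ × ℝ => p.1 + p.2) := by fun_prop
  rw [bellmanOpt_eq_map_prod_greedyLaw, Kernel.map_apply _ hadd, lintegral_map hφ hadd,
    Kernel.prod_apply, lintegral_prod _ (by fun_prop)]
  congr 1
  ext c
  exact Kernel.lintegral_comp _ _ _ (by fun_prop)

lemma integral_bellmanOpt_of_ae_mem_Icc (hd : ∀ xa, ∀ᵐ y ∂(d xa), y ∈ Set.Icc (0 : ℝ) 1)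
    {h : ℕ} {xa : X × A} (hT : ∀ᵐ z ∂(M.bellmanOpt am h d xa), z ∈ Set.Icc (0 : ℝ) 1)
    {φ : ℝ → ℝ} (hφ : BddMeas fun z => φ (clamp 2 z)) :
    ∫ z, φ z ∂(M.bellmanOpt am h d xa) =
      ∫ p, ∫ y, φ (clamp 1 p.1 + y) ∂(greedyLaw am d p.2) ∂((M.C h xa).prod (M.P h xa)) := by
  calc ∫ z, φ z ∂(M.bellmanOpt am h d xa)
      = ∫ z, φ (clamp 2 z) ∂(M.bellmanOpt am h d xa) := by
        refine integral_congr_ae ?_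
        filter_upwards [hT] with z hz
        rw [clamp_of_mem ⟨hz.1, hz.2.trans one_le_two⟩]
    _ = ∫ p, ∫ y, φ (clamp 2 (p.1 + y)) ∂(greedyLaw am d p.2) ∂((M.C h xa).prod (M.P h xa)) :=
        integral_bellmanOpt M am hφ h xa
    _ = _ := by
        have hcost : ∀ᵐ p ∂((M.C h xa).prod (M.P h xa)), p.1 ∈ Set.Icc (0 : ℝ) 1 :=
          Measure.quasiMeasurePreserving_fst.ae (M.cost_mem h xa)
        refine integral_congr_ae ?_
        filter_upwards [hcost] with p hp
        refine integral_congr_ae ?_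
        filter_upwards [hd (p.2, greedyAct am d p.2)] with y hy
        rw [clamp_of_mem hp, clamp_of_mem ⟨add_nonneg hp.1 hy.1, by linarith [hp.2, hy.2]⟩]

end Bellman

section Potential

variable {X A : Type*} [MeasurableSpace X] [MeasurableSpace A] {M : MDP X A}
  (am : ArgminRule A) {lam : Measure ℝ} {H : ℕ} [SFinite lam]

/-- The value `min_a f̄_t(x,a)` that `f` predicts at step `t`. -/
def potential (f : Fin H → CondDens X A lam) (t : ℕ) (x : X) : ℝ :=
  ∫ y, y ∂(greedyLaw am (lawAt f t) x)

lemma potential_le_mean (f : Fin H → CondDens X A lam) (t : ℕ) (x : X) (a : A) :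
    potential am f t x ≤ mean (lawAt f t) x a :=
  am.act_le (mean (lawAt f t) x) a

lemma optimisticValue_eq_potential [Finite A] [Nonempty A] (f : Fin H → CondDens X A lam)
    (x : X) : optimisticValue f x = potential am f 0 x :=
  le_antisymm (ciInf_le (Set.finite_range _).bddBelow _)
    (le_ciInf fun a => potential_le_mean am f 0 x a)

lemma potential_end (f : Fin H → CondDens X A lam) (x : X) : potential am f H x = 0 := by
  rw [potential, lawAt_end]
  exact integral_dirac' _ _ stronglyMeasurable_id

lemma variance_greedyLaw_end (f : Fin H → CondDens X A lam) (x : X) :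
    Var[id; greedyLaw am (lawAt f H) x] = 0 := by
  rw [lawAt_end]
  exact variance_dirac _

variable {am} (hlam : ∀ᵐ y ∂lam, y ∈ Set.Icc (0 : ℝ) 1)
include hlam

lemma ae_greedyLaw (f : Fin H → CondDens X A lam) (t : ℕ) (x : X) :
    ∀ᵐ y ∂(greedyLaw am (lawAt f t) x), y ∈ Set.Icc (0 : ℝ) 1 :=
  ae_lawAt hlam f t _

lemma bddMeas_potential (f : Fin H → CondDens X A lam) (t : ℕ) : BddMeas (potential am f t) :=
  bddMeas_integral_id (ae_greedyLaw hlam f t)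

lemma bddMeas_variance_greedyLaw (f : Fin H → CondDens X A lam) (t : ℕ) :
    BddMeas (fun x => Var[id; greedyLaw am (lawAt f t) x]) :=
  bddMeas_variance_id (ae_greedyLaw hlam f t)

lemma integral_bellmanOpt_eq_lookahead (f : Fin H → CondDens X A lam) {h : ℕ} {xa : X × A}
    (hT : ∀ᵐ z ∂(M.bellmanOpt am h (lawAt f (h + 1)) xa), z ∈ Set.Icc (0 : ℝ) 1) :
    ∫ z, z ∂(M.bellmanOpt am h (lawAt f (h + 1)) xa) = M.lookahead (potential am f) h xa := by
  rw [integral_bellmanOpt_of_ae_mem_Icc M am (ae_lawAt hlam f (h + 1)) hT (φ := fun z => z)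
    (bddMeas_clamp zero_le_two), MDP.lookahead]
  congr 1
  ext p
  exact integral_const_add
    ((memLp_id_of_ae_mem_Icc (ae_greedyLaw hlam f (h + 1) p.2) 1).integrable le_rfl) _

lemma variance_bellmanOpt (f : Fin H → CondDens X A lam) {h : ℕ} {xa : X × A}
    (hT : ∀ᵐ z ∂(M.bellmanOpt am h (lawAt f (h + 1)) xa), z ∈ Set.Icc (0 : ℝ) 1) :
    Var[id; M.bellmanOpt am h (lawAt f (h + 1)) xa] =
      M.stepVar (potential am f) h xa +
        ∫ x', Var[id; greedyLaw am (lawAt f (h + 1)) x'] ∂(M.P h xa) := by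
  have hw := bddMeas_potential (am := am) hlam f (h + 1)
  have hV := (bddMeas_variance_greedyLaw (am := am) hlam f (h + 1)).comp
    (g := fun p : ℝ × X => p.2) measurable_snd
  have hinner (p : ℝ × X) :
      ∫ y, (clamp 1 p.1 + y - M.lookahead (potential am f) h xa) ^ 2
        ∂(greedyLaw am (lawAt f (h + 1)) p.2) =
      (clamp 1 p.1 + potential am f (h + 1) p.2 - M.lookahead (potential am f) h xa) ^ 2 +
        Var[id; greedyLaw am (lawAt f (h + 1)) p.2] := by
    simp only [add_sub_right_comm]
    exact integral_const_add_sq_eq (memLp_id_of_ae_mem_Icc (ae_greedyLaw hlam f _ _) 2) _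
  rw [variance_eq_integral measurable_id.aemeasurable]
  simp only [id, integral_bellmanOpt_eq_lookahead hlam f hT]
  rw [integral_bellmanOpt_of_ae_mem_Icc M am (ae_lawAt hlam f (h + 1)) hT
      (φ := fun z => (z - M.lookahead (potential am f) h xa) ^ 2)
      ((bddMeas_clamp zero_le_two).sub (BddMeas.const _)).sq]
  simp only [hinner]
  rw [integral_add ((((bddMeas_clamp_add h hw).sub (BddMeas.const _)).sq).integrable _)
    (hV.integrable _), integral_prod _ (hV.integrable _), MDP.stepVar]
  simp

end Potential

section Gap

lemma one_add_one_div_pow_le (H : ℕ) : (1 + 1 / (H : ℝ)) ^ H ≤ 3 := by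
  rw [one_div]
  exact Real.one_add_inv_pow_le_exp.trans (Real.exp_one_lt_d9.le.trans (by norm_num))

lemma le_pow_mul_sum_of_backward_recursion {r : ℝ} (hr : 1 ≤ r) {H : ℕ} {v : ℕ → ℝ}
    {u : Fin H → ℝ} (hu : ∀ t, 0 ≤ u t) (hend : v H = 0)
    (hrec : ∀ t : Fin H, v t ≤ r * (u t + v (t + 1))) {t : ℕ} (ht : t ≤ H) :
    v t ≤ r ^ H * ∑ j, u j := by
  induction H generalizing v t with
  | zero => simp [Nat.le_zero.1 ht, hend]
  | succ H ih =>
    have htail {s : ℕ} (hs : s ≤ H) : v (s + 1) ≤ r ^ H * ∑ j : Fin H, u j.succ :=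
      ih (v := fun s => v (s + 1)) (fun j => hu j.succ) hend (fun j => hrec j.succ) hs
    have hpow : 1 ≤ r ^ H := one_le_pow₀ hr
    have hsum : 0 ≤ ∑ j : Fin H, u j.succ := Finset.sum_nonneg fun j _ => hu j.succ
    have hu0 : u 0 ≤ r ^ H * u 0 := le_mul_of_one_le_left (hu 0) hpow
    rw [Fin.sum_univ_succ, pow_succ', mul_assoc, mul_add]
    rcases t with _ | s
    · exact (hrec 0).trans (mul_le_mul_of_nonneg_left (add_le_add hu0 (htail H.zero_le))
        (by linarith))
    · refine (htail (Nat.le_of_succ_le_succ ht)).trans ?_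
      have hmul : 0 ≤ r ^ H * ∑ j : Fin H, u j.succ := by positivity
      nlinarith [hu 0]

variable {X A : Type*} [MeasurableSpace X] [MeasurableSpace A] (M : MDP X A)
  (am : ArgminRule A) {lam : Measure ℝ} {H : ℕ}

/-- `g_h` is a density of `T_h^{⋆,D} f_{h+1}`, for every `h`. -/
def IsBellmanImage [SFinite lam] (f g : Fin H → CondDens X A lam) : Prop :=
  ∀ h : Fin H, M.bellmanOpt am h (lawAt f (h + 1)) = (g h).law

/-- The expected Bellman errors of `f` along its greedy policy. -/
def errorSum [SFinite lam] (f : Fin H → CondDens X A lam) (x : X) : ℝ :=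
  ∑ h : Fin H, ∫ xa, bellmanError M am f h xa ∂(M.occ (greedyPolicy am f) h x)

/-- The expected variance of `f_t` at step `t` of its greedy policy. -/
def varAt [SFinite lam] (f : Fin H → CondDens X A lam) (x : X) (t : ℕ) : ℝ :=
  ∫ x', Var[id; greedyLaw am (lawAt f t) x'] ∂(M.stateLaw (greedyPolicy am f) 0 t x)

variable {M am} [SigmaFinite lam] {f g : Fin H → CondDens X A lam}

lemma bellmanError_eq (hg : IsBellmanImage M am f g) (h : Fin H) (xa : X × A) :
    bellmanError M am f h xa = triDens lam ((f h).dens xa) ((g h).dens xa) := by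
  rw [bellmanError, hg h, lawAt_of_lt, triDisc_law]

lemma bddMeas_bellmanError (hg : IsBellmanImage M am f g) (h : Fin H) :
    BddMeas (bellmanError M am f h) := by
  rw [funext (bellmanError_eq hg h)]
  exact bddMeas_triDens _ _

lemma bellmanError_nonneg (hg : IsBellmanImage M am f g) (h : Fin H) (xa : X × A) :
    0 ≤ bellmanError M am f h xa := by
  rw [bellmanError_eq hg]
  exact triDens_nonneg _ _ _

lemma bellmanError_le_two (hg : IsBellmanImage M am f g) (h : Fin H) (xa : X × A) :
    bellmanError M am f h xa ≤ 2 := by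
  rw [bellmanError_eq hg]
  exact triDens_le_two ((f h).isDensity xa) ((g h).isDensity xa)

lemma potential_eq (f : Fin H → CondDens X A lam) (h : Fin H) (x : X) :
    potential am f h x =
      ∫ y, y ∂(densLaw lam ((f h).dens (x, greedyAct am (lawAt f h) x))) := by
  rw [← CondDens.law_apply, ← lawAt_of_lt]
  rfl

variable (M) in
lemma integral_occ_greedy (f : Fin H → CondDens X A lam) {φ : X × A → ℝ} (hφ : BddMeas φ)
    (h : Fin H) (x : X) :
    ∫ xa, φ xa ∂(M.occ (greedyPolicy am f) h x) =
      ∫ x', φ (x', greedyAct am (lawAt f h) x') ∂(M.stateLaw (greedyPolicy am f) 0 h x) := by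
  rw [occ_eq, Kernel.integral_comp (hφ.integrable _)]
  congr 1 with x'
  change ∫ z, φ z ∂((Kernel.id ×ₖ greedyKernel am (lawAt f h)) x') = _
  rw [id_prod_greedyKernel, Kernel.deterministic_apply,
    integral_dirac' _ _ hφ.measurable.stronglyMeasurable]

lemma integral_occ_greedy_mono {φ χ : X × A → ℝ} (hφ : BddMeas φ) (hχ : BddMeas χ) (h : Fin H)
    (hle : ∀ x', φ (x', greedyAct am (lawAt f h) x') ≤ χ (x', greedyAct am (lawAt f h) x'))
    (x : X) :
    ∫ xa, φ xa ∂(M.occ (greedyPolicy am f) h x) ≤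
      ∫ xa, χ xa ∂(M.occ (greedyPolicy am f) h x) := by
  rw [integral_occ_greedy M f hφ, integral_occ_greedy M f hχ]
  exact integral_mono ((hφ.comp (measurable_graph_greedyAct am _)).integrable _)
    ((hχ.comp (measurable_graph_greedyAct am _)).integrable _) hle

variable (hlam : ∀ᵐ y ∂lam, y ∈ Set.Icc (0 : ℝ) 1)
include hlam

lemma ae_bellmanOpt (hg : IsBellmanImage M am f g) (h : Fin H) (xa : X × A) :
    ∀ᵐ z ∂(M.bellmanOpt am h (lawAt f (h + 1)) xa), z ∈ Set.Icc (0 : ℝ) 1 := by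
  rw [hg h]
  exact ae_law hlam _ xa

lemma lookahead_eq (hg : IsBellmanImage M am f g) (h : Fin H) (xa : X × A) :
    M.lookahead (potential am f) h xa = ∫ y, y ∂(densLaw lam ((g h).dens xa)) := by
  rw [← integral_bellmanOpt_eq_lookahead hlam f (ae_bellmanOpt hlam hg h xa), hg h,
    CondDens.law_apply]

lemma varAt_eq (f : Fin H → CondDens X A lam) (x : X) (h : Fin H) :
    varAt M am f x h =
      ∫ xa, Var[id; densLaw lam ((f h).dens xa)] ∂(M.occ (greedyPolicy am f) h x) := by
  rw [integral_occ_greedy M f (bddMeas_variance_dens hlam (f h)), varAt]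
  congr 1 with x'
  rw [← CondDens.law_apply, ← lawAt_of_lt]
  rfl

lemma varAt_succ (f : Fin H → CondDens X A lam) (x : X) (h : Fin H) :
    varAt M am f x (h + 1) =
      ∫ xa, ∫ x', Var[id; greedyLaw am (lawAt f (h + 1)) x'] ∂(M.P h xa)
        ∂(M.occ (greedyPolicy am f) h x) := by
  rw [varAt, stateLaw_succ_eq_comp_occ,
    Kernel.integral_comp ((bddMeas_variance_greedyLaw hlam f (h + 1)).integrable _)]

lemma variance_dens_le (hg : IsBellmanImage M am f g) (h : Fin H) (xa : X × A) :
    Var[id; densLaw lam ((f h).dens xa)] ≤ (1 + 1 / (H : ℝ)) *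
      (M.stepVar (potential am f) h xa + 2 * H * bellmanError M am f h xa +
        ∫ x', Var[id; greedyLaw am (lawAt f (h + 1)) x'] ∂(M.P h xa)) := by
  have hH : (1 : ℝ) ≤ H := by exact_mod_cast h.pos
  have hvar := variance_bellmanOpt hlam f (ae_bellmanOpt hlam hg h xa)
  rw [hg h, CondDens.law_apply] at hvar
  have hle := variance_densLaw_le hlam ((f h).isDensity xa) ((g h).isDensity xa)
    (s := 1 / (2 * H)) (by positivity) (by rw [div_le_one (by positivity)]; linarith)
  rw [← bellmanError_eq hg, hvar] at hle
  have herr := bellmanError_nonneg hg h xa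
  have hcoef : (1 : ℝ) + 2 * (1 / (2 * H)) = 1 + 1 / H := by field_simp
  have hdiv : bellmanError M am f h xa / (1 / (2 * H)) = 2 * H * bellmanError M am f h xa := by
    field_simp
  rw [hcoef, hdiv] at hle
  have hslack : 0 ≤ 1 / (H : ℝ) * (2 * H * bellmanError M am f h xa) := by positivity
  linarith

lemma varAt_recursion (hg : IsBellmanImage M am f g) (x : X) (h : Fin H) :
    varAt M am f x h ≤ (1 + 1 / (H : ℝ)) *
      ((∫ xa, M.stepVar (potential am f) h xa ∂(M.occ (greedyPolicy am f) h x) +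
        2 * H * ∫ xa, bellmanError M am f h xa ∂(M.occ (greedyPolicy am f) h x)) +
        varAt M am f x (h + 1)) := by
  have hstep := bddMeas_stepVar M h (bddMeas_potential (am := am) hlam f (h + 1))
  have herr := (BddMeas.const (2 * (H : ℝ))).mul (bddMeas_bellmanError hg h)
  have hnext := (bddMeas_variance_greedyLaw (am := am) hlam f (h + 1)).integral_kernel (M.P h)
  rw [varAt_eq hlam, varAt_succ hlam, ← integral_const_mul,
    ← integral_add (hstep.integrable _) (herr.integrable _),
    ← integral_add ((hstep.add herr).integrable _) (hnext.integrable _), ← integral_const_mul]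
  exact integral_mono ((bddMeas_variance_dens hlam (f h)).integrable _)
    ((((hstep.add herr).add hnext).integrable _).const_mul _)
    fun xa => variance_dens_le hlam hg h xa

lemma sum_sq_drift_le (hg : IsBellmanImage M am f g) (x : X) :
    ∑ h : Fin H, ∫ xa, M.drift (potential am f) h xa ^ 2 ∂(M.occ (greedyPolicy am f) h x) ≤
      2 * errorSum M am f x := by
  rw [errorSum, Finset.mul_sum]
  refine Finset.sum_le_sum fun h _ => ?_
  rw [← integral_const_mul]
  refine integral_occ_greedy_mono (bddMeas_drift M (bddMeas_potential hlam f) h).sq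
    ((BddMeas.const 2).mul (bddMeas_bellmanError hg h)) h (fun x' => ?_) x
  rw [MDP.drift, lookahead_eq hlam hg, potential_eq, bellmanError_eq hg, triDens_comm]
  exact sq_mean_sub_le hlam ((g h).isDensity _) ((f h).isDensity _)

lemma sum_varAt_le (hg : IsBellmanImage M am f g) (x : X) :
    ∑ h : Fin H, varAt M am f x h ≤
      6 * H * M.returnVar H (greedyPolicy am f) x + 18 * H ^ 2 * errorSum M am f x := by
  let u (h : Fin H) : ℝ :=
    ∫ xa, M.stepVar (potential am f) h xa ∂(M.occ (greedyPolicy am f) h x) +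
      2 * H * ∫ xa, bellmanError M am f h xa ∂(M.occ (greedyPolicy am f) h x)
  have hu (h : Fin H) : 0 ≤ u h :=
    add_nonneg (integral_nonneg fun xa => stepVar_nonneg M h xa)
      (mul_nonneg (by positivity) (integral_nonneg fun xa => bellmanError_nonneg hg h xa))
  have hvarAt (h : Fin H) : varAt M am f x h ≤ 3 * ∑ j, u j :=
    (le_pow_mul_sum_of_backward_recursion (v := varAt M am f x)
      (le_add_of_nonneg_right (by positivity : 0 ≤ 1 / (H : ℝ))) hu
      (by simp only [varAt, variance_greedyLaw_end, integral_zero])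
      (varAt_recursion hlam hg x) h.2.le).trans
    (mul_le_mul_of_nonneg_right (one_add_one_div_pow_le H) (Finset.sum_nonneg fun j _ => hu j))
  have hsum : ∑ j, u j ≤
      2 * M.returnVar H (greedyPolicy am f) x + 6 * H * errorSum M am f x := by
    have hstep := sum_stepVar_le M (greedyPolicy am f) (bddMeas_potential hlam f)
      (potential_end am f) x
    have hdrift := mul_le_mul_of_nonneg_left (sum_sq_drift_le hlam hg x)
      (by positivity : (0 : ℝ) ≤ 2 * H)
    rw [Finset.sum_add_distrib, ← Finset.mul_sum, ← errorSum]
    linarith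
  calc ∑ h : Fin H, varAt M am f x h ≤ ∑ _h : Fin H, 3 * ∑ j, u j :=
        Finset.sum_le_sum fun h _ => hvarAt h
    _ = 3 * H * ∑ j, u j := by simp; ring
    _ ≤ 3 * H * (2 * M.returnVar H (greedyPolicy am f) x + 6 * H * errorSum M am f x) :=
        mul_le_mul_of_nonneg_left hsum (by positivity)
    _ = _ := by ring

theorem value_sub_potential_le (hg : IsBellmanImage M am f g) (x : X) {s : ℝ} (hs : 0 < s)
    (hs1 : s ≤ 1) :
    M.value H (greedyPolicy am f) x - potential am f 0 x ≤
      2 * s * (6 * H * M.returnVar H (greedyPolicy am f) x + 18 * H ^ 2 * errorSum M am f x) +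
        errorSum M am f x / s := by
  have hw := bddMeas_potential (am := am) hlam f
  refine le_trans ?_ (add_le_add_left
    (mul_le_mul_of_nonneg_left (sum_varAt_le hlam hg x) (by positivity)) _)
  rw [value_sub_eq_sum_drift M _ hw (potential_end am f), errorSum, Finset.mul_sum,
    Finset.sum_div, ← Finset.sum_add_distrib]
  refine Finset.sum_le_sum fun h _ => ?_
  have hvar := (BddMeas.const (2 * s)).mul (bddMeas_variance_dens hlam (f h))
  have herr := (bddMeas_bellmanError hg h).mul (BddMeas.const s⁻¹)
  simp only [← div_eq_mul_inv] at herr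
  rw [varAt_eq hlam, ← integral_const_mul, ← integral_div,
    ← integral_add (hvar.integrable _) (herr.integrable _)]
  refine integral_occ_greedy_mono (bddMeas_drift M hw h) (hvar.add herr) h (fun x' => ?_) x
  rw [MDP.drift, lookahead_eq hlam hg, potential_eq, bellmanError_eq hg, triDens_comm]
  exact mean_sub_le hlam ((g h).isDensity _) ((f h).isDensity _) hs hs1

/-- Every policy has nonnegative drift relative to the potential of a Bellman fixed point. -/
theorem potential_le_optValue (hf : IsBellmanImage M am f f) (x : X) :
    potential am f 0 x ≤ M.optValue H x := by
  have : Nonempty (Policy X A) := ⟨greedyPolicy am f⟩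
  refine le_ciInf fun π => ?_
  rw [← sub_nonneg, value_sub_eq_sum_drift M π (bddMeas_potential hlam f) (potential_end am f)]
  refine Finset.sum_nonneg fun h _ => integral_nonneg fun xa => sub_nonneg.2 ?_
  rw [lookahead_eq hlam hf, ← CondDens.law_apply, ← lawAt_of_lt]
  exact potential_le_mean am f h xa.1 xa.2

end Gap

section Complete

variable {X A : Type*} [MeasurableSpace X] [MeasurableSpace A] {M : MDP X A}
  {am : ArgminRule A} {lam : Measure ℝ} [SFinite lam] {H : ℕ}
  {F : Fin H → Finset (CondDens X A lam)} {Pol : Set (Policy X A)}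

lemma lawAt_mem_lawClass {f : Fin H → CondDens X A lam} (hf : f ∈ tuples F) (n : ℕ) :
    lawAt f n ∈ lawClass F n := by
  unfold lawAt lawClass
  split_ifs
  · exact ⟨_, hf _, rfl⟩
  · rfl

lemma exists_isBellmanImage (hPol : ∀ f ∈ tuples F, greedyPolicy am f ∈ Pol)
    (hcomplete : BellmanComplete M Pol F) {f : Fin H → CondDens X A lam} (hf : f ∈ tuples F) :
    ∃ g ∈ tuples F, IsBellmanImage M am f g := by
  have himage (h : Fin H) : ∃ g ∈ F h, M.bellmanOpt am h (lawAt f (h + 1)) = g.law := by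
    have := hcomplete _ (hPol f hf) h h.2 _ (lawAt_mem_lawClass hf (h + 1))
    rwa [lawClass, dif_pos h.2] at this
  choose g hgF hg using himage
  exact ⟨g, hgF, hg⟩

lemma lawAt_update_of_ne (f : Fin H → CondDens X A lam) (i : Fin H) (g : CondDens X A lam)
    {n : ℕ} (hn : n ≠ i) : lawAt (Function.update f i g) n = lawAt f n := by
  unfold lawAt
  split_ifs with hnH
  · rw [Function.update_of_ne (Fin.ne_of_val_ne hn)]
  · rfl

/-- Backward induction: the condition at step `h` only involves `f_h` and `f_{h+1}`. -/
theorem exists_fixedPoint (hF : ∀ h, (F h).Nonempty)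
    (hPol : ∀ f ∈ tuples F, greedyPolicy am f ∈ Pol) (hcomplete : BellmanComplete M Pol F) :
    ∃ f ∈ tuples F, IsBellmanImage M am f f := by
  suffices hfrom : ∀ t ≤ H, ∃ f ∈ tuples F, ∀ h : Fin H, t ≤ h →
      M.bellmanOpt am h (lawAt f (h + 1)) = (f h).law by
    obtain ⟨f, hf, hfix⟩ := hfrom 0 H.zero_le
    exact ⟨f, hf, fun h => hfix h (Nat.zero_le _)⟩
  intro t ht
  induction ht using Nat.decreasingInduction with
  | self =>
    choose f hf using hF
    exact ⟨f, hf, fun h hh => absurd h.2 hh.not_gt⟩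
  | of_succ t ht ih =>
    obtain ⟨f, hf, hfix⟩ := ih
    obtain ⟨g, hgF, hg⟩ := exists_isBellmanImage hPol hcomplete hf
    let i : Fin H := ⟨t, ht⟩
    refine ⟨Function.update f i (g i), fun h => ?_, fun h hh => ?_⟩
    · rcases eq_or_ne h i with rfl | hne
      · rw [Function.update_self]
        exact hgF _
      · rw [Function.update_of_ne hne]
        exact hf h
    · rw [lawAt_update_of_ne f i _ (Nat.lt_succ_of_le hh).ne']
      rcases eq_or_ne h i with rfl | hne
      · rw [Function.update_self]
        exact hg _
      · rw [Function.update_of_ne hne]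
        exact hfix h (lt_of_le_of_ne hh fun he => hne (Fin.ext he.symm))

end Complete

section CondLaw

lemma lintegral_prodMk_of_condLaw {Ω Ω' E : Type*} [MeasurableSpace Ω] [MeasurableSpace Ω']
    [MeasurableSpace E] {Pr : Measure Ω} [IsProbabilityMeasure Pr] {I : Ω → Ω'}
    (hI : Measurable I) {Y : Ω → E} (hY : Measurable Y) (κ : Kernel Ω' E) [IsMarkovKernel κ]
    (h : ∀ S, MeasurableSet S → ∀ G, MeasurableSet G →
      Pr (I ⁻¹' G ∩ Y ⁻¹' S) = ∫⁻ ω in I ⁻¹' G, κ (I ω) S ∂Pr)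
    {Φ : Ω' × E → ℝ≥0∞} (hΦ : Measurable Φ) :
    ∫⁻ ω, Φ (I ω, Y ω) ∂Pr = ∫⁻ ω, ∫⁻ e, Φ (I ω, e) ∂(κ (I ω)) ∂Pr := by
  have hIY : Measurable (fun ω => (I ω, Y ω)) := hI.prodMk hY
  have := Measure.isProbabilityMeasure_map (μ := Pr) hI.aemeasurable
  have hjoint : Pr.map (fun ω => (I ω, Y ω)) = (Pr.map I) ⊗ₘ κ := by
    refine Measure.ext_prod fun {G S} hG hS => ?_
    rw [Measure.map_apply hIY (hG.prod hS), Measure.compProd_apply_prod hG hS,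
      setLIntegral_map hG (κ.measurable_coe hS) hI, ← h S hS G hG]
    rfl
  rw [← lintegral_map hΦ hIY, hjoint, Measure.lintegral_compProd hΦ,
    lintegral_map hΦ.lintegral_kernel_prod_right' hI]

lemma HasCondLaw.lintegral_eq {Ω Ω' E : Type*} {m : MeasurableSpace Ω} [mΩ : MeasurableSpace Ω]
    [MeasurableSpace Ω'] [mE : MeasurableSpace E] {Pr : Measure Ω} [IsProbabilityMeasure Pr]
    (hm : m ≤ mΩ) {Y : Ω → E} (hY : Measurable Y) {κ : Ω → Measure E} (hκ : Measurable[m] κ)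
    (hprob : ∀ ω, IsProbabilityMeasure (κ ω)) (h : HasCondLaw Pr m Y κ) {I : Ω → Ω'}
    (hI : Measurable[m] I) {Φ : Ω' × E → ℝ≥0∞} (hΦ : Measurable Φ) :
    ∫⁻ ω, Φ (I ω, Y ω) ∂Pr = ∫⁻ ω, ∫⁻ e, Φ (I ω, e) ∂(κ ω) ∂Pr :=
  @lintegral_prodMk_of_condLaw Ω Ω E mΩ m mE Pr _ id (measurable_id'' hm) Y hY
    (@Kernel.mk Ω E m mE κ hκ) (@IsMarkovKernel.mk Ω E m mE _ hprob) h
    (fun p => Φ (I p.1, p.2)) (hΦ.comp ((hI.comp measurable_fst).prodMk measurable_snd))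

lemma measurable_of_finite_selection {Ω ι X Y : Type*} [MeasurableSpace Ω] [MeasurableSpace X]
    [MeasurableSpace Y] {s : Set ι} (hs : s.Finite) {sel : Ω → ι} (hsel : ∀ ω, sel ω ∈ s)
    (hmeas : ∀ i, MeasurableSet {ω | sel ω = i}) {x : Ω → X} (hx : Measurable x)
    {κ : ι → X → Y} (hκ : ∀ i, Measurable (κ i)) :
    Measurable (fun ω => κ (sel ω) (x ω)) := by
  intro T hT
  have hunion : (fun ω => κ (sel ω) (x ω)) ⁻¹' T =
      ⋃ i ∈ s, {ω | sel ω = i} ∩ (fun ω => κ i (x ω)) ⁻¹' T := by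
    ext ω
    simpa using fun _ => hsel ω
  rw [hunion]
  exact hs.measurableSet_biUnion fun i _ => (hmeas i).inter (((hκ i).comp hx) hT)

lemma coe_piFinset_eq_tuples {X A : Type*} [MeasurableSpace X] [MeasurableSpace A]
    {lam : Measure ℝ} {H : ℕ} (F : Fin H → Finset (CondDens X A lam)) :
    (Fintype.piFinset F : Set (Fin H → CondDens X A lam)) = tuples F := by
  ext f
  simp [tuples]

lemma finite_tuples {X A : Type*} [MeasurableSpace X] [MeasurableSpace A]
    {lam : Measure ℝ} {H : ℕ} (F : Fin H → Finset (CondDens X A lam)) : (tuples F).Finite :=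
  coe_piFinset_eq_tuples F ▸ Finset.finite_toSet _

end CondLaw

section Run

variable {X A : Type*} [MeasurableSpace X] [MeasurableSpace A] [Fintype A] [Nonempty A]
  {H : ℕ}

/-- The law of the state-action pair recorded at step `h` of an episode. -/
def MDP.explore (M : MDP X A) (uae : Bool) (π : Policy X A) (h : Fin H) : Kernel X (X × A) :=
  if uae then
    (Kernel.id ×ₖ Kernel.const X (PMF.uniformOfFintype A).toMeasure) ∘ₖ M.stateOcc π h
  else M.occ π h

instance (M : MDP X A) (uae : Bool) (π : Policy X A) (h : Fin H) :
    IsMarkovKernel (M.explore uae π h) := by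
  unfold MDP.explore
  split_ifs <;> infer_instance

instance (M : MDP X A) (π : Policy X A) (h : Fin H) : IsMarkovKernel (M.uaeKernel π h) := by
  unfold MDP.uaeKernel; infer_instance

lemma map_episodeLaw (M : MDP X A) (uae : Bool) (π : Policy X A) (h : Fin H) (x : X) :
    (M.episodeLaw H uae π x).map (fun τ => τ h) = (M.obs h ∘ₖ M.explore uae π h) x := by
  unfold MDP.episodeLaw MDP.explore
  split_ifs
  · refine (measurePreserving_eval (fun h => M.uaeKernel π h x) h).map_eq.trans ?_
    rw [MDP.uaeKernel, stepKernel_eq_obs_comp, Kernel.comp_assoc]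
  · rw [← map_roll_eq_obs_comp_occ, Kernel.map_apply _ (measurable_pi_apply h)]

variable {lam : Measure ℝ} [SFinite lam] {Ω : Type*} [mΩ : MeasurableSpace Ω] {Pr : Measure Ω}
  {M : MDP X A} {am : ArgminRule A} {F : Fin H → Finset (CondDens X A lam)} {β : ℝ} {K : ℕ}
  {uae : Bool} (R : ODiscoRun Pr M am F β K uae)

namespace ODiscoRun

/-- The law of the state-action pair recorded at step `h` of episode `k`, given the past. -/
def expl (k : ℕ) (h : Fin H) (ω : Ω) : Measure (X × A) :=
  M.explore uae (greedyPolicy am (R.sel k ω)) h (R.x₁ k ω)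

instance (k : ℕ) (h : Fin H) (ω : Ω) : IsProbabilityMeasure (R.expl k h ω) := by
  unfold expl; infer_instance

/-- The regression pair `((x_{h,k}, a_{h,k}), z^f_{h,k})`. -/
def target (k : ℕ) (h : Fin H) (f : Fin H → CondDens X A lam) (ω : Ω) : (X × A) × ℝ :=
  ((R.data k ω h).1, (R.data k ω h).2.1 + R.y k ω h f)

lemma measurable_data_apply {k : ℕ} (hk : k < K) (h : Fin H) :
    Measurable[R.𝒢 (k + 1)] (fun ω => R.data k ω h) :=
  (measurable_pi_apply h).comp (R.measurable_data k hk)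

lemma measurable_target {k : ℕ} (hk : k < K) (h : Fin H) {f : Fin H → CondDens X A lam}
    (hf : f ∈ tuples F) : Measurable[R.𝒢 (k + 1)] (R.target k h f) := by
  have hdata := R.measurable_data_apply hk h
  exact hdata.fst.prodMk (hdata.snd.fst.add (R.measurable_y k hk h f hf))

lemma measurable_selected {Y : Type*} [MeasurableSpace Y] {k : ℕ} (hk : k < K)
    {κ : (Fin H → CondDens X A lam) → X → Y} (hκ : ∀ f, Measurable (κ f)) :
    Measurable[R.𝒢 k] (fun ω => κ (R.sel k ω) (R.x₁ k ω)) :=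
  @measurable_of_finite_selection Ω _ X Y (R.𝒢 k) _ _ _ (finite_tuples F) _
    (R.sel_mem k hk) (R.measurable_sel k hk) _ (R.measurable_x₁ k hk) _ hκ

lemma hasCondLaw_data_apply {k : ℕ} (hk : k < K) (h : Fin H) :
    HasCondLaw Pr (R.𝒢 k) (fun ω => R.data k ω h)
      (fun ω => (M.obs h ∘ₖ M.explore uae (greedyPolicy am (R.sel k ω)) h) (R.x₁ k ω)) := by
  intro S hS G hG
  refine (R.data_law k hk _ (measurable_pi_apply h hS) G hG).trans (lintegral_congr fun ω => ?_)
  beta_reduce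
  rw [← map_episodeLaw, Measure.map_apply (measurable_pi_apply h) hS]

lemma measurable_prod_mul_target (h : Fin H) {f : Fin H → CondDens X A lam} (hf : f ∈ tuples F)
    {c : ℕ → Ω → ℝ≥0∞} (hc : ∀ i < K, Measurable[R.𝒢 i] (c i))
    {Φ : (X × A) × ℝ → ℝ≥0∞} (hΦ : Measurable Φ) {n : ℕ} (hn : n ≤ K) :
    Measurable[R.𝒢 n] (fun ω => ∏ i ∈ Finset.range n, (c i ω * Φ (R.target i h f ω))) := by
  refine Finset.measurable_prod _ fun i hi => ?_
  have hin : i < n := Finset.mem_range.1 hi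
  exact ((hc i (hin.trans_le hn)).mono (R.𝒢.mono hin.le) le_rfl).mul
    ((hΦ.comp (R.measurable_target (hin.trans_le hn) h hf)).mono (R.𝒢.mono hin) le_rfl)

variable [IsProbabilityMeasure Pr]

lemma lintegral_mul_data {k : ℕ} (hk : k < K) (h : Fin H) {W : Ω → ℝ≥0∞}
    (hW : Measurable[R.𝒢 k] W) {Ψ : Step X A → ℝ≥0∞} (hΨ : Measurable Ψ) :
    ∫⁻ ω, W ω * Ψ (R.data k ω h) ∂Pr =
      ∫⁻ ω, W ω * ∫⁻ xa, ∫⁻ s, Ψ s ∂(M.obs h xa) ∂(R.expl k h ω) ∂Pr := by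
  refine (HasCondLaw.lintegral_eq (R.𝒢.le k) ((R.measurable_data_apply hk h).mono (R.𝒢.le _) le_rfl)
    (R.measurable_selected hk (κ := fun f x =>
      (M.obs h ∘ₖ M.explore uae (greedyPolicy am f) h) x) fun f => Kernel.measurable _)
    (fun ω => inferInstance) (R.hasCondLaw_data_apply hk h) hW
    (Φ := fun p => p.1 * Ψ p.2) (by fun_prop)).trans (lintegral_congr fun ω => ?_)
  rw [lintegral_const_mul _ hΨ, Kernel.lintegral_comp _ _ _ hΨ]
  rfl

lemma lintegral_mul_target_eq_greedyLaw {k : ℕ} (hk : k < K) (h : Fin H)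
    {f : Fin H → CondDens X A lam} (hf : f ∈ tuples F) {W : Ω → ℝ≥0∞} (hW : Measurable[R.𝒢 k] W)
    {Φ : (X × A) × ℝ → ℝ≥0∞} (hΦ : Measurable Φ) :
    ∫⁻ ω, W ω * Φ (R.target k h f ω) ∂Pr =
      ∫⁻ ω, W ω * ∫⁻ y, Φ ((R.data k ω h).1, (R.data k ω h).2.1 + y)
        ∂(greedyLaw am (lawAt f (h + 1)) (R.data k ω h).2.2) ∂Pr := by
  have hle : R.𝒢 k ⊔ MeasurableSpace.comap (R.data k) MeasurableSpace.pi ≤ mΩ :=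
    sup_le (R.𝒢.le k) ((R.measurable_data k hk).mono (R.𝒢.le _) le_rfl).comap_le
  have hdata : Measurable[R.𝒢 k ⊔ MeasurableSpace.comap (R.data k) MeasurableSpace.pi]
      (fun ω => R.data k ω h) :=
    (measurable_pi_apply h).comp ((comap_measurable (R.data k)).mono le_sup_right le_rfl)
  refine (HasCondLaw.lintegral_eq hle ((R.measurable_y k hk h f hf).mono (R.𝒢.le _) le_rfl)
    ((Kernel.measurable (greedyLaw am (lawAt f (h + 1)))).comp hdata.snd.snd)
    (fun ω => inferInstanceAs (IsProbabilityMeasure (greedyLaw am _ _))) (R.y_law k hk h f hf)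
    ((hW.mono le_sup_left le_rfl).prodMk hdata)
    (Φ := fun p => p.1.1 * Φ (p.1.2.1, p.1.2.2.1 + p.2)) (by fun_prop)).trans
      (lintegral_congr fun ω => ?_)
  exact lintegral_const_mul _ (by fun_prop)

lemma lintegral_mul_target {k : ℕ} (hk : k < K) (h : Fin H) {f : Fin H → CondDens X A lam}
    (hf : f ∈ tuples F) {W : Ω → ℝ≥0∞} (hW : Measurable[R.𝒢 k] W)
    {Φ : (X × A) × ℝ → ℝ≥0∞} (hΦ : Measurable Φ) :
    ∫⁻ ω, W ω * Φ (R.target k h f ω) ∂Pr =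
      ∫⁻ ω, W ω * ∫⁻ xa, ∫⁻ z, Φ (xa, z) ∂(M.bellmanOpt am h (lawAt f (h + 1)) xa)
        ∂(R.expl k h ω) ∂Pr := by
  have hΨ : Measurable fun s : Step X A =>
      ∫⁻ y, Φ (s.1, s.2.1 + y) ∂(greedyLaw am (lawAt f (h + 1)) s.2.2) :=
    Measurable.lintegral_kernel_prod_right' (f := fun p : Step X A × ℝ => Φ (p.1.1, p.1.2.1 + p.2))
      (κ := (greedyLaw am (lawAt f (h + 1))).comap (fun s : Step X A => s.2.2) (by fun_prop))
      (by fun_prop)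
  rw [R.lintegral_mul_target_eq_greedyLaw hk h hf hW hΦ, R.lintegral_mul_data hk h hW hΨ]
  refine lintegral_congr fun ω => congrArg (W ω * ·) (lintegral_congr fun xa => ?_)
  rw [lintegral_obs M hΨ, lintegral_bellmanOpt M am (by fun_prop)]

lemma lintegral_prod_mul_target_le_one (h : Fin H) {f : Fin H → CondDens X A lam}
    (hf : f ∈ tuples F) {c : ℕ → Ω → ℝ≥0∞} (hc : ∀ i < K, Measurable[R.𝒢 i] (c i))
    {Φ : (X × A) × ℝ → ℝ≥0∞} (hΦ : Measurable Φ)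
    (hle : ∀ i < K, ∀ ω, c i ω * ∫⁻ xa, ∫⁻ z, Φ (xa, z)
      ∂(M.bellmanOpt am h (lawAt f (h + 1)) xa) ∂(R.expl i h ω) ≤ 1) {n : ℕ} (hn : n ≤ K) :
    ∫⁻ ω, ∏ i ∈ Finset.range n, (c i ω * Φ (R.target i h f ω)) ∂Pr ≤ 1 := by
  induction n with
  | zero => simp
  | succ n ih =>
    have hn' : n < K := hn
    calc ∫⁻ ω, ∏ i ∈ Finset.range (n + 1), (c i ω * Φ (R.target i h f ω)) ∂Pr
        = ∫⁻ ω, ((∏ i ∈ Finset.range n, (c i ω * Φ (R.target i h f ω))) * c n ω) *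
            Φ (R.target n h f ω) ∂Pr := by simp only [Finset.prod_range_succ, mul_assoc]
      _ = ∫⁻ ω, ((∏ i ∈ Finset.range n, (c i ω * Φ (R.target i h f ω))) * c n ω) *
            ∫⁻ xa, ∫⁻ z, Φ (xa, z) ∂(M.bellmanOpt am h (lawAt f (h + 1)) xa)
              ∂(R.expl n h ω) ∂Pr :=
          R.lintegral_mul_target hn' h hf
            ((R.measurable_prod_mul_target h hf hc hΦ hn'.le).mul (hc n hn')) hΦ
      _ ≤ ∫⁻ ω, ∏ i ∈ Finset.range n, (c i ω * Φ (R.target i h f ω)) ∂Pr := by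
          refine lintegral_mono fun ω => ?_
          rw [mul_assoc]
          exact mul_le_of_le_one_right' (hle n hn' ω)
      _ ≤ 1 := ih hn'.le

end ODiscoRun

end Run

section Likelihood

lemma sum_log_eq_log_prod {ι : Type*} (s : Finset ι) (a : ι → ℝ≥0∞) :
    ∑ i ∈ s, ENNReal.log (a i) = ENNReal.log (∏ i ∈ s, a i) := by
  classical
  induction s using Finset.induction_on with
  | empty => simp
  | insert i s hi ih => rw [Finset.sum_insert hi, Finset.prod_insert hi, ENNReal.log_mul_add, ih]

lemma log_sub_le_log_iff {x y : ℝ≥0∞} {β : ℝ} :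
    ENNReal.log x - (β : EReal) ≤ ENNReal.log y ↔ x ≤ y * ENNReal.ofReal (Real.exp β) := by
  have hβ : ENNReal.log (ENNReal.ofReal (Real.exp β)) = β := by
    rw [ENNReal.log_ofReal_of_pos (Real.exp_pos _), Real.log_exp]
  rw [EReal.sub_le_iff_le_add (Or.inl (EReal.coe_ne_bot β)) (Or.inl (EReal.coe_ne_top β)), ← hβ,
    ← ENNReal.log_mul_add, ENNReal.log_le_log_iff]

variable {ι : Type*} {s : Finset ι} {a b : ι → ℝ≥0}

lemma ne_zero_of_prod_div_ne_top (ha : ∀ i ∈ s, a i ≠ 0)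
    (h : ∏ i ∈ s, ((a i : ℝ≥0∞) / b i) ≠ ∞) : ∀ i ∈ s, b i ≠ 0 := by
  classical
  intro i hi h0
  refine h ?_
  rw [← Finset.mul_prod_erase s _ hi, h0, ENNReal.coe_zero,
    ENNReal.div_zero (ENNReal.coe_ne_zero.2 (ha i hi)), ENNReal.top_mul]
  exact Finset.prod_ne_zero_iff.2 fun j hj => ENNReal.div_ne_zero.2
    ⟨ENNReal.coe_ne_zero.2 (ha j (Finset.mem_of_mem_erase hj)), ENNReal.coe_ne_top⟩

lemma prod_div_eq_div_prod (hb : ∀ i ∈ s, b i ≠ 0) :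
    ∏ i ∈ s, ((a i : ℝ≥0∞) / b i) = (((∏ i ∈ s, a i) / ∏ i ∈ s, b i : ℝ≥0) : ℝ≥0∞) := by
  rw [← Finset.prod_div_distrib, ENNReal.ofNNReal_finsetProd]
  exact Finset.prod_congr rfl fun i hi => (ENNReal.coe_div (hb i hi)).symm

lemma prod_le_of_prod_div_le {B : ℝ≥0∞} (hB : B ≠ ∞)
    (h : ∏ i ∈ s, ((a i : ℝ≥0∞) / b i) ≤ B) :
    ∏ i ∈ s, (a i : ℝ≥0∞) ≤ (∏ i ∈ s, (b i : ℝ≥0∞)) * B := by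
  by_cases ha : ∀ i ∈ s, a i ≠ 0
  · have hb := ne_zero_of_prod_div_ne_top ha (ne_top_of_le_ne_top hB h)
    have hb' : ∏ i ∈ s, b i ≠ 0 := Finset.prod_ne_zero_iff.2 hb
    rw [prod_div_eq_div_prod hb, ENNReal.coe_div hb'] at h
    simp only [← ENNReal.ofNNReal_finsetProd]
    exact (ENNReal.div_le_iff' (ENNReal.coe_ne_zero.2 hb') ENNReal.coe_ne_top).1 h
  · push Not at ha
    obtain ⟨i, hi, hai⟩ := ha
    rw [Finset.prod_eq_zero hi (ENNReal.coe_eq_zero.2 hai)]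
    exact zero_le

lemma prod_exp_mul_rpow_half_div (hb : ∀ i ∈ s, b i ≠ 0) (e : ι → ℝ) :
    ∏ i ∈ s, (ENNReal.ofReal (Real.exp (e i)) * ((a i : ℝ≥0∞) / b i) ^ (1 / 2 : ℝ)) =
      ENNReal.ofReal (Real.exp (∑ i ∈ s, e i) *
        (((∏ i ∈ s, a i) / ∏ i ∈ s, b i : ℝ≥0) : ℝ) ^ (1 / 2 : ℝ)) := by
  rw [Finset.prod_mul_distrib, ENNReal.prod_rpow_of_nonneg (by norm_num), prod_div_eq_div_prod hb,
    ← ENNReal.ofReal_prod_of_nonneg fun i _ => (Real.exp_pos _).le, ← Real.exp_sum,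
    ENNReal.ofReal_mul (Real.exp_pos _).le,
    ← ENNReal.ofReal_rpow_of_nonneg (NNReal.coe_nonneg _) (by norm_num), ENNReal.ofReal_coe_nnreal]

lemma le_of_exp_mul_rpow_half_lt {t r α β : ℝ} (hr : Real.exp (-β) ≤ r)
    (h : Real.exp t * r ^ (1 / 2 : ℝ) < Real.exp α) : t ≤ α + β / 2 := by
  have hlow : Real.exp (-β / 2) ≤ r ^ (1 / 2 : ℝ) := by
    calc Real.exp (-β / 2) = Real.exp (-β) ^ (1 / 2 : ℝ) := by
          rw [← Real.exp_mul, mul_one_div]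
      _ ≤ r ^ (1 / 2 : ℝ) := Real.rpow_le_rpow (Real.exp_pos _).le hr (by norm_num)
  have hexp : Real.exp (t + -β / 2) < Real.exp α := by
    rw [Real.exp_add]
    exact (mul_le_mul_of_nonneg_left hlow (Real.exp_pos _).le).trans_lt h
  linarith [Real.exp_lt_exp.1 hexp]

lemma sum_le_of_prod_rpow_half_lt {e : ι → ℝ} {α β : ℝ} (hb : ∀ i ∈ s, b i ≠ 0)
    (hab : ∏ i ∈ s, (b i : ℝ≥0∞) ≤ (∏ i ∈ s, (a i : ℝ≥0∞)) * ENNReal.ofReal (Real.exp β))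
    (h : ∏ i ∈ s, (ENNReal.ofReal (Real.exp (e i)) * ((a i : ℝ≥0∞) / b i) ^ (1 / 2 : ℝ)) <
      ENNReal.ofReal (Real.exp α)) :
    ∑ i ∈ s, e i ≤ α + β / 2 := by
  rw [prod_exp_mul_rpow_half_div hb, ENNReal.ofReal_lt_ofReal_iff (Real.exp_pos _)] at h
  refine le_of_exp_mul_rpow_half_lt ?_ h
  have hpos : (0 : ℝ) < ((∏ i ∈ s, b i : ℝ≥0) : ℝ) :=
    NNReal.coe_pos.2 (pos_iff_ne_zero.2 (Finset.prod_ne_zero_iff.2 hb))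
  simp only [← ENNReal.ofNNReal_finsetProd] at hab
  rw [← ENNReal.ofReal_coe_nnreal, ← ENNReal.ofReal_coe_nnreal (p := ∏ i ∈ s, a i),
    ← ENNReal.ofReal_mul (NNReal.coe_nonneg _),
    ENNReal.ofReal_le_ofReal_iff (by positivity)] at hab
  rw [NNReal.coe_div, le_div_iff₀ hpos, Real.exp_neg, inv_mul_le_iff₀ (Real.exp_pos _), mul_comm]
  exact hab

end Likelihood

section Events

variable {X A : Type*} [MeasurableSpace X] [MeasurableSpace A] {lam : Measure ℝ} {H : ℕ}

section Law

variable (f g : CondDens X A lam)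

lemma CondDens.measurable_coe : Measurable (fun p : (X × A) × ℝ => (f.dens p.1 p.2 : ℝ≥0∞)) :=
  f.measurable_dens.coe_nnreal_ennreal

lemma CondDens.measurable_div :
    Measurable (fun p : (X × A) × ℝ => (f.dens p.1 p.2 : ℝ≥0∞) / g.dens p.1 p.2) :=
  f.measurable_coe.div g.measurable_coe

variable [SFinite lam]

lemma lintegral_law (xa : X × A) {φ : ℝ → ℝ≥0∞} (hφ : Measurable φ) :
    ∫⁻ z, φ z ∂(f.law xa) = ∫⁻ z, (f.dens xa z : ℝ≥0∞) * φ z ∂lam := by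
  rw [f.law_apply, densLaw, lintegral_withDensity_eq_lintegral_mul _
    (f.isDensity xa).measurable.coe_nnreal_ennreal hφ]
  rfl

lemma lintegral_div_law_le_one (xa : X × A) :
    ∫⁻ z, (f.dens xa z : ℝ≥0∞) / g.dens xa z ∂(g.law xa) ≤ 1 := by
  rw [lintegral_law g xa (φ := fun z => (f.dens xa z : ℝ≥0∞) / g.dens xa z)
    ((f.measurable_div g).comp measurable_prodMk_left)]
  refine (lintegral_mono fun z => ?_).trans (f.lintegral_eq_one xa).le
  exact ENNReal.mul_div_le

lemma lintegral_rpow_half_div_law_le (xa : X × A) :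
    ∫⁻ z, ((f.dens xa z : ℝ≥0∞) / g.dens xa z) ^ (1 / 2 : ℝ) ∂(g.law xa) ≤
      ENNReal.ofReal (1 - triDens lam (f.dens xa) (g.dens xa) / 4) := by
  rw [lintegral_law g xa (φ := fun z => ((f.dens xa z : ℝ≥0∞) / g.dens xa z) ^ (1 / 2 : ℝ))
    (((f.measurable_div g).comp measurable_prodMk_left).pow_const _)]
  exact lintegral_mul_rpow_half_div_le (f.isDensity xa) (g.isDensity xa)

lemma ae_law_dens_ne_zero (xa : X × A) : ∀ᵐ z ∂(f.law xa), f.dens xa z ≠ 0 := by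
  rw [f.law_apply, densLaw,
    ae_withDensity_iff (f.isDensity xa).measurable.coe_nnreal_ennreal]
  exact Filter.Eventually.of_forall fun z hz => ENNReal.coe_ne_zero.1 hz

end Law

lemma lintegral_ofReal_one_sub_div {E : Type*} [MeasurableSpace E] {μ : Measure E}
    [IsProbabilityMeasure μ] {φ : E → ℝ} (hφ : Integrable φ μ) {c : ℝ}
    (hle : ∀ x, φ x / c ≤ 1) :
    ∫⁻ x, ENNReal.ofReal (1 - φ x / c) ∂μ = ENNReal.ofReal (1 - (∫ x, φ x ∂μ) / c) := by
  have hint := hφ.div_const c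
  have hint' : Integrable (fun x => 1 - φ x / c) μ := (integrable_const _).sub hint
  rw [← ofReal_integral_eq_lintegral_ofReal hint'
    (Filter.Eventually.of_forall fun x => sub_nonneg.2 (hle x)),
    integral_sub (integrable_const _) hint, integral_div, integral_const, probReal_univ, one_smul]

variable [SigmaFinite lam] {M : MDP X A} {am : ArgminRule A}

lemma lintegral_rpow_half_div_bellmanOpt_le {f g : Fin H → CondDens X A lam}
    (hg : IsBellmanImage M am f g) (h : Fin H) (μ : Measure (X × A)) [IsProbabilityMeasure μ] :
    ∫⁻ xa, ∫⁻ z, (((f h).dens xa z : ℝ≥0∞) / (g h).dens xa z) ^ (1 / 2 : ℝ)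
      ∂(M.bellmanOpt am h (lawAt f (h + 1)) xa) ∂μ ≤
      ENNReal.ofReal (1 - (∫ xa, bellmanError M am f h xa ∂μ) / 4) := by
  rw [← lintegral_ofReal_one_sub_div ((bddMeas_bellmanError hg h).integrable μ)
    fun xa => by linarith [bellmanError_le_two hg h xa], hg h]
  refine lintegral_mono fun xa => ?_
  rw [bellmanError_eq hg]
  exact lintegral_rpow_half_div_law_le (f h) (g h) xa

variable [Fintype A] [Nonempty A] {Ω : Type*} [mΩ : MeasurableSpace Ω]
  {Pr : Measure Ω} {F : Fin H → Finset (CondDens X A lam)} {β : ℝ} {K : ℕ} {uae : Bool}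
  (R : ODiscoRun Pr M am F β K uae)

namespace ODiscoRun

/-- The likelihood under `q` of the regression pair `((x_{h,k}, a_{h,k}), z^f_{h,k})`. -/
def lik (q : CondDens X A lam) (h : Fin H) (f : Fin H → CondDens X A lam) (k : ℕ) (ω : Ω) : ℝ≥0 :=
  q.dens (R.target k h f ω).1 (R.target k h f ω).2

/-- The expected Bellman error of `f` under the exploration law of episode `k`. -/
def explError (f : Fin H → CondDens X A lam) (h : Fin H) (k : ℕ) (ω : Ω) : ℝ :=
  ∫ xa, bellmanError M am f h xa ∂(R.expl k h ω)

lemma measurable_explError {f g : Fin H → CondDens X A lam} (hg : IsBellmanImage M am f g)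
    (h : Fin H) {k : ℕ} (hk : k < K) : Measurable[R.𝒢 k] (R.explError f h k) :=
  R.measurable_selected hk (κ := fun f' x =>
    ∫ xa, bellmanError M am f h xa ∂(M.explore uae (greedyPolicy am f') h x))
    fun _ => ((bddMeas_bellmanError hg h).integral_kernel _).measurable

variable [IsProbabilityMeasure Pr] {f : Fin H → CondDens X A lam} (hf : f ∈ tuples F)
include hf

lemma measure_exp_le_prod_le (h : Fin H) {c : ℕ → Ω → ℝ≥0∞}
    (hc : ∀ i < K, Measurable[R.𝒢 i] (c i)) {Φ : (X × A) × ℝ → ℝ≥0∞} (hΦ : Measurable Φ)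
    (hle : ∀ i < K, ∀ ω, c i ω * ∫⁻ xa, ∫⁻ z, Φ (xa, z)
      ∂(M.bellmanOpt am h (lawAt f (h + 1)) xa) ∂(R.expl i h ω) ≤ 1) {n : ℕ} (hn : n ≤ K)
    (t : ℝ) :
    Pr {ω | ENNReal.ofReal (Real.exp t) ≤
      ∏ i ∈ Finset.range n, (c i ω * Φ (R.target i h f ω))} ≤ ENNReal.ofReal (Real.exp (-t)) := by
  refine (meas_ge_le_lintegral_div
    ((R.measurable_prod_mul_target h hf hc hΦ hn).mono (R.𝒢.le n) le_rfl).aemeasurable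
    (by simpa using Real.exp_pos t) ENNReal.ofReal_ne_top).trans ?_
  refine (ENNReal.div_le_div_right
    (R.lintegral_prod_mul_target_le_one h hf hc hΦ hle hn) _).trans_eq ?_
  rw [one_div, ← ENNReal.ofReal_inv_of_pos (Real.exp_pos _), Real.exp_neg]

variable {g : Fin H → CondDens X A lam} (hg : IsBellmanImage M am f g)
include hg

lemma measure_prod_lik_div_ge_le (h : Fin H) (q : CondDens X A lam) {n : ℕ} (hn : n ≤ K) (t : ℝ) :
    Pr {ω | ENNReal.ofReal (Real.exp t) ≤ ∏ i ∈ Finset.range n,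
      ((R.lik q h f i ω : ℝ≥0∞) / R.lik (g h) h f i ω)} ≤ ENNReal.ofReal (Real.exp (-t)) := by
  have hle (i : ℕ) (_ : i < K) (ω : Ω) : 1 * ∫⁻ xa, ∫⁻ z, (q.dens xa z : ℝ≥0∞) / (g h).dens xa z
      ∂(M.bellmanOpt am h (lawAt f (h + 1)) xa) ∂(R.expl i h ω) ≤ 1 := by
    rw [one_mul, hg h]
    refine (lintegral_mono fun xa => lintegral_div_law_le_one q (g h) xa).trans_eq ?_
    rw [lintegral_one, measure_univ]
  simpa only [one_mul, lik] using R.measure_exp_le_prod_le hf h (c := fun _ _ => 1)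
    (fun _ _ => measurable_const) (q.measurable_div (g h)) hle hn t

/-- The factor `exp(D/4)` compensates `E[√(f/g)] ≤ 1 - D/4 ≤ exp(-D/4)`. -/
lemma measure_prod_exp_mul_rpow_half_ge_le (h : Fin H) {n : ℕ} (hn : n ≤ K) (t : ℝ) :
    Pr {ω | ENNReal.ofReal (Real.exp t) ≤ ∏ i ∈ Finset.range n,
      (ENNReal.ofReal (Real.exp (R.explError f h i ω / 4)) *
        ((R.lik (f h) h f i ω : ℝ≥0∞) / R.lik (g h) h f i ω) ^ (1 / 2 : ℝ))} ≤
      ENNReal.ofReal (Real.exp (-t)) := by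
  refine R.measure_exp_le_prod_le hf h
    (c := fun i ω => ENNReal.ofReal (Real.exp (R.explError f h i ω / 4)))
    (fun i hi =>
      (Real.measurable_exp.comp ((R.measurable_explError hg h hi).div_const 4)).ennreal_ofReal)
    (((f h).measurable_div (g h)).pow_const _) (fun i _ ω => ?_) hn t
  calc _ ≤ ENNReal.ofReal (Real.exp (R.explError f h i ω / 4)) *
        ENNReal.ofReal (Real.exp (-(R.explError f h i ω / 4))) := by
        refine mul_le_mul_right ((lintegral_rpow_half_div_bellmanOpt_le hg h _).trans
          (ENNReal.ofReal_le_ofReal ?_)) _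
        exact Real.one_sub_le_exp_neg _
    _ = 1 := by
        rw [← ENNReal.ofReal_mul (Real.exp_pos _).le, ← Real.exp_add, add_neg_cancel,
          Real.exp_zero, ENNReal.ofReal_one]

lemma ae_lik_ne_zero (h : Fin H) {k : ℕ} (hk : k < K) :
    ∀ᵐ ω ∂Pr, R.lik (g h) h f k ω ≠ 0 := by
  let S : Set ((X × A) × ℝ) := {p | (g h).dens p.1 p.2 = 0}
  have hS : MeasurableSet S := (g h).measurable_dens (measurableSet_singleton 0)
  have hΦ : Measurable (S.indicator fun _ => (1 : ℝ≥0∞)) := measurable_const.indicator hS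
  have hT : Measurable (R.target k h f) := (R.measurable_target hk h hf).mono (R.𝒢.le _) le_rfl
  have hlaw (xa : X × A) : ∫⁻ z, S.indicator (fun _ => 1) (xa, z) ∂((g h).law xa) = 0 :=
    (lintegral_congr_ae ((ae_law_dens_ne_zero (g h) xa).mono fun z hz =>
      Set.indicator_of_notMem (s := S) hz _)).trans lintegral_zero
  have hzero : ∫⁻ ω, S.indicator (fun _ => 1) (R.target k h f ω) ∂Pr = 0 := by
    simpa only [one_mul, hg h, hlaw, lintegral_zero] using
      R.lintegral_mul_target hk h hf (W := fun _ => 1) measurable_const hΦ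
  filter_upwards [(lintegral_eq_zero_iff (hΦ.comp hT)).1 hzero] with ω hω h0
  have hmem : R.target k h f ω ∈ S := h0
  exact one_ne_zero ((Set.indicator_of_mem hmem _).symm.trans hω)

end ODiscoRun

end Events

section Threshold

variable {X A : Type*} [MeasurableSpace X] [MeasurableSpace A] {lam : Measure ℝ} {H K : ℕ}
  {F : Fin H → Finset (CondDens X A lam)} {δ : ℝ}

lemma prod_card_pos (hF : ∀ h, (F h).Nonempty) : 0 < ∏ h, (F h).card :=
  Finset.prod_pos fun h _ => (hF h).card_pos

lemma card_le_prod_card (hF : ∀ h, (F h).Nonempty) (h : Fin H) :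
    (F h).card ≤ ∏ h, (F h).card :=
  Nat.le_of_dvd (prod_card_pos hF) (Finset.dvd_prod_of_mem _ (Finset.mem_univ h))

lemma mul_exp_neg_threshold (hH : 0 < H) (hK : 0 < K) (hF : ∀ h, (F h).Nonempty) (hδ : 0 < δ) :
    (H : ℝ) * (((∏ h, (F h).card : ℕ) : ℝ) * Real.exp (-threshold F K δ)) = δ / K := by
  have hP : (0 : ℝ) < ((∏ h, (F h).card : ℕ) : ℝ) := Nat.cast_pos.2 (prod_card_pos hF)
  rw [threshold, Real.exp_neg, Real.exp_log (by positivity), inv_div]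
  field_simp

lemma exp_neg_threshold_le (hH : 0 < H) (hK : 0 < K) (hF : ∀ h, (F h).Nonempty) (hδ : 0 < δ) :
    Real.exp (-threshold F K δ) ≤ δ / K := by
  rw [← mul_exp_neg_threshold hH hK hF hδ, ← mul_assoc]
  refine le_mul_of_one_le_left (Real.exp_pos _).le (one_le_mul_of_one_le_of_one_le ?_ ?_)
  · exact_mod_cast hH
  · exact_mod_cast prod_card_pos hF

lemma threshold_pos (hH : 0 < H) (hK : 0 < K) (hF : ∀ h, (F h).Nonempty) (hδ : 0 < δ)
    (hδ1 : δ < 1) : 0 < threshold F K δ := by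
  have hK1 : (1 : ℝ) ≤ K := by exact_mod_cast hK
  have hexp : Real.exp (-threshold F K δ) < 1 :=
    (exp_neg_threshold_le hH hK hF hδ).trans_lt ((div_le_self hδ.le hK1).trans_lt hδ1)
  exact neg_lt_zero.1 (Real.exp_lt_one_iff.1 hexp)

lemma log_two_le_threshold (hH : 0 < H) (hK : 0 < K) (hδ : 0 < δ) (hδ1 : δ < 1)
    (hcard : 2 ≤ ∏ h, (F h).card) : Real.log 2 ≤ threshold F K δ := by
  have hcard' : (2 : ℝ) ≤ ((∏ h, (F h).card : ℕ) : ℝ) := by exact_mod_cast hcard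
  have hHK : (1 : ℝ) ≤ H * K := by exact_mod_cast Nat.mul_pos hH hK
  refine Real.log_le_log two_pos ((le_div_iff₀ hδ).2 ?_)
  calc 2 * δ ≤ 2 := by linarith
    _ ≤ ((∏ h, (F h).card : ℕ) : ℝ) := hcard'
    _ ≤ H * K * ((∏ h, (F h).card : ℕ) : ℝ) := le_mul_of_one_le_left (by positivity) hHK

end Threshold

section Good

lemma measure_biUnion_le_ofReal {Ω ι : Type*} [MeasurableSpace Ω] {Pr : Measure Ω}
    {s : Finset ι} {E : ι → Set Ω} {a : ℝ} (h : ∀ i ∈ s, Pr (E i) ≤ ENNReal.ofReal a) :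
    Pr (⋃ i ∈ s, E i) ≤ ENNReal.ofReal (s.card * a) := by
  refine (measure_biUnion_finset_le s E).trans ((Finset.sum_le_sum h).trans_eq ?_)
  rw [Finset.sum_const, nsmul_eq_mul, ENNReal.ofReal_mul (Nat.cast_nonneg _),
    ENNReal.ofReal_natCast]

variable {X A : Type*} [MeasurableSpace X] [MeasurableSpace A] {lam : Measure ℝ} {H : ℕ}
  [SigmaFinite lam] [Fintype A] [Nonempty A] {Ω : Type*} [MeasurableSpace Ω]
  {Pr : Measure Ω} {M : MDP X A} {am : ArgminRule A} {F : Fin H → Finset (CondDens X A lam)}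
  {K : ℕ} {β : ℝ} {uae : Bool} (R : ODiscoRun Pr M am F β K uae)

namespace ODiscoRun

/-- The confidence set available to the learner in episode `k`. -/
def conf (k : ℕ) (ω : Ω) : Set (Fin H → CondDens X A lam) :=
  confSet F β (fun i => R.data i ω) (fun i => R.y i ω) k

/-- The event that every confidence set contains the fixed point `fs` of the Bellman optimality
operator, and only functions with small accumulated Bellman errors. -/
def IsGood (fs : Fin H → CondDens X A lam) (ω : Ω) : Prop :=
  ∀ k < K, fs ∈ R.conf k ω ∧
    ∀ f ∈ R.conf k ω, ∀ h, ∑ i ∈ Finset.range k, R.explError f h i ω ≤ 10 * β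

variable {R}

lemma mem_conf_iff {k : ℕ} {ω : Ω} {f : Fin H → CondDens X A lam} :
    f ∈ R.conf k ω ↔ f ∈ tuples F ∧ ∀ h, ∀ q ∈ F h,
      ∏ i ∈ Finset.range k, (R.lik q h f i ω : ℝ≥0∞) ≤
        (∏ i ∈ Finset.range k, (R.lik (f h) h f i ω : ℝ≥0∞)) * ENNReal.ofReal (Real.exp β) := by
  simp only [conf, confSet, Set.mem_ofPred_eq, logLik, sum_log_eq_log_prod, log_sub_le_log_iff]
  rfl

lemma sum_explError_le_of_mem_conf {k : ℕ} {ω : Ω} {f : Fin H → CondDens X A lam}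
    (hf : f ∈ R.conf k ω) {h : Fin H} {q : CondDens X A lam} (hq : q ∈ F h)
    (hne : ∀ i ∈ Finset.range k, R.lik q h f i ω ≠ 0)
    (hlt : ∏ i ∈ Finset.range k, (ENNReal.ofReal (Real.exp (R.explError f h i ω / 4)) *
      ((R.lik (f h) h f i ω : ℝ≥0∞) / R.lik q h f i ω) ^ (1 / 2 : ℝ)) <
        ENNReal.ofReal (Real.exp (2 * β))) :
    ∑ i ∈ Finset.range k, R.explError f h i ω ≤ 10 * β := by
  have hsum := sum_le_of_prod_rpow_half_lt hne ((mem_conf_iff.1 hf).2 h q hq) hlt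
  rw [← Finset.sum_div] at hsum
  linarith

lemma setOf_not_isGood_subset {fs : Fin H → CondDens X A lam} (hβ : 0 ≤ β)
    (hfs : fs ∈ tuples F) :
    {ω | ¬ R.IsGood fs ω} ⊆ ⋃ k ∈ Finset.Ico 1 K, ({ω | fs ∉ R.conf k ω} ∪
      {ω | ∃ f ∈ R.conf k ω, ∃ h, 10 * β < ∑ i ∈ Finset.range k, R.explError f h i ω}) := by
  intro ω hω
  by_contra hnot
  simp only [Set.mem_iUnion, not_exists, Set.mem_union, Set.mem_ofPred_eq, not_or, not_and,
    not_not, not_lt] at hnot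
  refine hω fun k hk => ?_
  rcases Nat.eq_zero_or_pos k with rfl | hkpos
  · have hexp : 1 ≤ ENNReal.ofReal (Real.exp β) :=
      ENNReal.one_le_ofReal.2 (Real.one_le_exp hβ)
    exact ⟨mem_conf_iff.2 ⟨hfs, fun h q _ => by simpa using hexp⟩,
      fun f _ h => by simpa using hβ⟩
  · exact hnot k (Finset.mem_Ico.2 ⟨hkpos, hk⟩)

variable [IsProbabilityMeasure Pr] {fs : Fin H → CondDens X A lam}

lemma measure_notMem_conf_le (hF : ∀ h, (F h).Nonempty) (hfs : fs ∈ tuples F)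
    (hfix : IsBellmanImage M am fs fs) {k : ℕ} (hk : k ≤ K) :
    Pr {ω | fs ∉ R.conf k ω} ≤
      ENNReal.ofReal (H * (((∏ h, (F h).card : ℕ) : ℝ) * Real.exp (-β))) := by
  have hsub : {ω | fs ∉ R.conf k ω} ⊆ ⋃ h ∈ Finset.univ, ⋃ q ∈ F h,
      {ω | ENNReal.ofReal (Real.exp β) ≤ ∏ i ∈ Finset.range k,
        ((R.lik q h fs i ω : ℝ≥0∞) / R.lik (fs h) h fs i ω)} := by
    intro ω hω
    by_contra hnot
    simp only [Set.mem_iUnion, not_exists, Set.mem_ofPred_eq, not_le] at hnot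
    exact hω (mem_conf_iff.2 ⟨hfs, fun h q hq =>
      prod_le_of_prod_div_le ENNReal.ofReal_ne_top (hnot h (Finset.mem_univ h) q hq).le⟩)
  refine (measure_mono hsub).trans ((measure_biUnion_le_ofReal fun h _ => ?_).trans_eq
    (by rw [Finset.card_univ, Fintype.card_fin]))
  refine (measure_biUnion_le_ofReal fun q _ =>
    R.measure_prod_lik_div_ge_le hfs hfix h q hk β).trans (ENNReal.ofReal_le_ofReal ?_)
  exact mul_le_mul_of_nonneg_right (Nat.cast_le.2 (card_le_prod_card hF h)) (Real.exp_pos _).le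

lemma measure_sum_explError_gt_le
    {img : (Fin H → CondDens X A lam) → Fin H → CondDens X A lam}
    (himgF : ∀ f ∈ tuples F, img f ∈ tuples F)
    (himg : ∀ f ∈ tuples F, IsBellmanImage M am f (img f)) {k : ℕ} (hk : k ≤ K) :
    Pr {ω | ∃ f ∈ R.conf k ω, ∃ h, 10 * β < ∑ i ∈ Finset.range k, R.explError f h i ω} ≤
      ENNReal.ofReal (H * (((∏ h, (F h).card : ℕ) : ℝ) * Real.exp (-(2 * β)))) := by
  classical
  have hmem (f) : f ∈ Fintype.piFinset F ↔ f ∈ tuples F := Fintype.mem_piFinset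
  have hne : ∀ᵐ ω ∂Pr, ∀ i ∈ Finset.range k, ∀ h, ∀ f ∈ Fintype.piFinset F,
      R.lik (img f h) h f i ω ≠ 0 := by
    refine (Filter.eventually_all_finset _).2 fun i hi => Filter.eventually_all.2 fun h =>
      (Filter.eventually_all_finset _).2 fun f hf => ?_
    exact R.ae_lik_ne_zero ((hmem f).1 hf) (himg f ((hmem f).1 hf)) h
      ((Finset.mem_range.1 hi).trans_le hk)
  have hsub : {ω | ∃ f ∈ R.conf k ω, ∃ h,
        10 * β < ∑ i ∈ Finset.range k, R.explError f h i ω} ≤ᵐ[Pr]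
      ⋃ h ∈ Finset.univ, ⋃ f ∈ Fintype.piFinset F,
        {ω | ENNReal.ofReal (Real.exp (2 * β)) ≤ ∏ i ∈ Finset.range k,
          (ENNReal.ofReal (Real.exp (R.explError f h i ω / 4)) *
            ((R.lik (f h) h f i ω : ℝ≥0∞) / R.lik (img f h) h f i ω) ^ (1 / 2 : ℝ))} := by
    filter_upwards [hne] with ω hω ⟨f, hf, h, hlt⟩
    have hfm := (hmem f).2 (mem_conf_iff.1 hf).1
    refine Set.mem_biUnion (Finset.mem_univ h) (Set.mem_biUnion hfm ?_)
    by_contra hnot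
    exact hlt.not_ge (sum_explError_le_of_mem_conf hf (himgF f (mem_conf_iff.1 hf).1 h)
      (fun i hi => hω i hi h f hfm) (not_le.1 hnot))
  refine (measure_mono_ae hsub).trans ((measure_biUnion_le_ofReal fun h _ => ?_).trans_eq
    (by rw [Finset.card_univ, Fintype.card_fin]))
  refine (measure_biUnion_le_ofReal fun f hf => R.measure_prod_exp_mul_rpow_half_ge_le
    ((hmem f).1 hf) (himg f ((hmem f).1 hf)) h hk (2 * β)).trans_eq ?_
  rw [Fintype.card_piFinset]

lemma measure_not_isGood_le {δ : ℝ} {Pol : Set (Policy X A)}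
    (R : ODiscoRun Pr M am F (threshold F K δ) K uae) (hH : 0 < H) (hK : 0 < K)
    (hF : ∀ h, (F h).Nonempty) (hPol : ∀ f ∈ tuples F, greedyPolicy am f ∈ Pol)
    (hcomplete : BellmanComplete M Pol F) (hδ : 0 < δ) (hδ1 : δ < 1) (hfs : fs ∈ tuples F)
    (hfix : IsBellmanImage M am fs fs) : Pr {ω | ¬ R.IsGood fs ω} ≤ ENNReal.ofReal δ := by
  choose! img himgF himg using fun (f : Fin H → CondDens X A lam) (hf : f ∈ tuples F) =>
    exists_isBellmanImage hPol hcomplete hf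
  have hmul := mul_exp_neg_threshold hH hK hF hδ
  refine (measure_mono (setOf_not_isGood_subset (threshold_pos hH hK hF hδ hδ1).le hfs)).trans
    ((measure_biUnion_le_ofReal (a := δ / K * (1 + 1 / K)) fun k hk => ?_).trans
      (ENNReal.ofReal_le_ofReal ?_))
  · have hkK := (Finset.mem_Ico.1 hk).2.le
    refine (measure_union_le _ _).trans ((add_le_add (measure_notMem_conf_le hF hfs hfix hkK)
      (measure_sum_explError_gt_le himgF himg hkK)).trans ?_)
    rw [← ENNReal.ofReal_add (by positivity) (by positivity), hmul]
    refine ENNReal.ofReal_le_ofReal ?_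
    have hexp : Real.exp (-threshold F K δ) ≤ 1 / K :=
      (exp_neg_threshold_le hH hK hF hδ).trans (by gcongr)
    calc _ = δ / K * (1 + Real.exp (-threshold F K δ)) := by
          rw [← hmul, two_mul, neg_add, Real.exp_add]; ring
      _ ≤ δ / K * (1 + 1 / K) := by gcongr
  · rw [Nat.card_Ico, Nat.cast_sub hK, Nat.cast_one]
    calc ((K : ℝ) - 1) * (δ / K * (1 + 1 / K)) = δ - δ / K ^ 2 := by field_simp; ring
      _ ≤ δ := sub_le_self _ (by positivity)

end ODiscoRun

end Good

section Optimization

lemma le_two_mul_sqrt_of_forall_scale {r E X Y : ℝ} (hX : 0 < X) (hXY : X ≤ Y) (hE : E ≤ X)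
    (h : ∀ s, 0 < s → s ≤ 1 → r ≤ s * Y + E / s) : r ≤ 2 * √(X * Y) := by
  have hY : 0 < Y := hX.trans_le hXY
  have hs : 0 < √X / √Y := div_pos (Real.sqrt_pos.2 hX) (Real.sqrt_pos.2 hY)
  have hs1 : √X / √Y ≤ 1 := div_le_one_of_le₀ (Real.sqrt_le_sqrt hXY) (Real.sqrt_nonneg Y)
  calc r ≤ √X / √Y * Y + E / (√X / √Y) := h _ hs hs1
    _ ≤ √X / √Y * Y + X / (√X / √Y) := by gcongr
    _ = √X * (Y / √Y) + X / √X * √Y := by rw [div_div_eq_mul_div]; ring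
    _ = 2 * √(X * Y) := by rw [Real.div_sqrt, Real.div_sqrt, Real.sqrt_mul hX.le]; ring

/-- The right-hand side `H √(a · V · D · β · L) + a · H² · D · β · L` that the argument yields: it
improves the power `H^{5/2}` of the lower-order term of `secondOrderBound` to `H²`. -/
def sharpBound (H : ℕ) (a V D β L : ℝ) : ℝ :=
  (H : ℝ) * √(a * V * D * β * L) + a * (H : ℝ) ^ 2 * D * β * L

variable {H : ℕ} {a V D β L : ℝ}

lemma sharpBound_eq :
    sharpBound H a V D β L = H * √(V * (a * D * β * L)) + H ^ 2 * (a * D * β * L) := by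
  rw [sharpBound]; ring_nf

lemma sharpBound_le_secondOrderBound (hH : 0 < H) (ha : 0 ≤ a) (hD : 0 ≤ D) (hβ : 0 ≤ β)
    (hL : 0 ≤ L) : sharpBound H a V D β L ≤ secondOrderBound H a V D β L := by
  have hpow : (H : ℝ) ^ 2 ≤ (H : ℝ) ^ (5 / 2 : ℝ) := by
    rw [← Real.rpow_natCast]
    exact Real.rpow_le_rpow_of_exponent_le (by exact_mod_cast hH) (by norm_num)
  rw [sharpBound, secondOrderBound]
  gcongr

lemma le_sharpBound_of_forall_scale (hH : 0 < H) {r E : ℝ} (ha : 0 < a) (hV : 0 ≤ V) (hD : 0 < D)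
    (hβ : 0 < β) (hL : 0 < L) (hE : E ≤ 15 * H * (a * D * β * L))
    (h : ∀ s, 0 < s → s ≤ 1 → r ≤ 2 * s * (6 * H * V + 18 * H ^ 2 * E) + E / s) :
    r ≤ 180 * sharpBound H a V D β L := by
  rw [sharpBound_eq]
  have hT : 0 < a * D * β * L := by positivity
  generalize a * D * β * L = T at *
  have hH1 : (1 : ℝ) ≤ H := by exact_mod_cast hH
  have hr : r ≤ 2 * √(15 * H * T * (12 * H * V + 36 * H ^ 2 * (15 * H * T))) := by
    refine le_two_mul_sqrt_of_forall_scale (by positivity) ?_ hE fun s hs hs1 => ?_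
    · have hH2 : (1 : ℝ) ≤ 36 * H ^ 2 := by nlinarith
      exact (le_mul_of_one_le_left (by positivity) hH2).trans
        (le_add_of_nonneg_left (by positivity))
    · calc r ≤ s * (12 * H * V + 36 * H ^ 2 * E) + E / s := (h s hs hs1).trans_eq (by ring)
        _ ≤ s * (12 * H * V + 36 * H ^ 2 * (15 * H * T)) + E / s := by gcongr
  have hsqrt : √(15 * H * T * (12 * H * V + 36 * H ^ 2 * (15 * H * T))) ≤
      90 * (H * √(V * T) + H ^ 2 * T) := by
    refine Real.sqrt_le_iff.2 ⟨by positivity, ?_⟩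
    have hcross : 0 ≤ H * √(V * T) * (H ^ 2 * T) := by positivity
    have hsq : (H * √(V * T)) ^ 2 = H ^ 2 * (V * T) := by rw [mul_pow, Real.sq_sqrt (by positivity)]
    have hVT : 0 ≤ (H : ℝ) ^ 2 * (V * T) := by positivity
    linear_combination 7920 * hVT + 16200 * hcross - 8100 * hsq
  linarith

end Optimization

section ErrorBound

lemma integral_toMeasure_eq_sum {A : Type*} [MeasurableSpace A] [Fintype A] (p : PMF A)
    {φ : A → ℝ} (hφ : Measurable φ) : ∫ a, φ a ∂p.toMeasure = ∑ a, (p a).toReal * φ a := by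
  have hp : p.toMeasure = ∑ a, p a • Measure.dirac a := by
    ext s hs
    rw [PMF.toMeasure_apply p hs, tsum_fintype, Measure.finsetSum_apply]
    refine Finset.sum_congr rfl fun a _ => ?_
    rw [Measure.smul_apply, Measure.dirac_apply' a hs, smul_eq_mul, ← Set.indicator_mul_right]
    simp only [Pi.one_apply, mul_one]
  rw [hp, integral_finsetSum_measure fun a _ =>
    (integrable_dirac' hφ.stronglyMeasurable enorm_lt_top).smul_measure (p.apply_ne_top a)]
  refine Finset.sum_congr rfl fun a _ => ?_
  rw [integral_smul_measure, integral_dirac' _ _ hφ.stronglyMeasurable, smul_eq_mul]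

lemma sum_integral_le_of_eluderDim_le {S : Type*} [MeasurableSpace S] {Ψ : Set (S → ℝ)}
    {𝔇 : Set (Measure S)} {φ : ℕ → S → ℝ} {μ : ℕ → Measure S} [∀ k, IsProbabilityMeasure (μ k)]
    {K d : ℕ} {B : ℝ} (hK : 0 < K) (hdim : eluderDim Ψ 𝔇 (1 / K) ≤ d)
    (hφ : ∀ k < K, φ k ∈ Ψ) (hμ : ∀ k < K, μ k ∈ 𝔇) (hbdd : ∀ k < K, BddMeas (φ k))
    (hnonneg : ∀ k < K, ∀ s, 0 ≤ φ k s) (htwo : ∀ k < K, ∀ s, φ k s ≤ 2) (hB : 0 ≤ B)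
    (hpast : ∀ k < K, ∑ i ∈ Finset.range k, ∫ s, φ k s ∂(μ i) ≤ B) :
    ∑ k ∈ Finset.range K, ∫ s, φ k s ∂(μ k) ≤
      (B + 3) * ((max 1 d : ℕ) : ℝ) * (1 + Real.log K) := by
  have habs (k : ℕ) (hk : k < K) (i : ℕ) : |∫ s, φ k s ∂(μ i)| = ∫ s, φ k s ∂(μ i) :=
    abs_of_nonneg (integral_nonneg (hnonneg k hk))
  rw [← Finset.sum_congr rfl fun k hk => habs k (Finset.mem_range.1 hk) k]
  refine sum_le_of_eluderDim_le hK hdim hφ hμ hB (fun k hk => ?_) fun k hk => ?_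
  · rw [Finset.sum_congr rfl fun i _ => habs k hk i]
    exact hpast k hk
  · rw [habs k hk]
    calc ∫ s, φ k s ∂(μ k) ≤ ∫ _, (2 : ℝ) ∂(μ k) :=
          integral_mono ((hbdd k hk).integrable _) (integrable_const _) (htwo k hk)
      _ = 2 := by simp

variable {X A : Type*} [MeasurableSpace X] [MeasurableSpace A] {lam : Measure ℝ} {H : ℕ}
  [SigmaFinite lam] {M : MDP X A} {am : ArgminRule A} {F : Fin H → Finset (CondDens X A lam)}
  {K d : ℕ} {Pol : Set (Policy X A)} {B : ℝ}

section Card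

variable {fs : Fin H → CondDens X A lam} {f : ℕ → Fin H → CondDens X A lam} {x : ℕ → X}

lemma errorSum_eq_zero (hfix : IsBellmanImage M am fs fs) (x : X) : errorSum M am fs x = 0 := by
  simp [errorSum, bellmanError_eq hfix, triDens]

/- A singleton class has no Bellman errors; otherwise `log 2 ≤ β`, which absorbs the additive
constant of the eluder argument. -/
lemma sum_errorSum_le_threshold_mul (hH : 0 < H) (hK : 0 < K) (hF : ∀ h, (F h).Nonempty) {δ b : ℝ}
    (hδ : 0 < δ) (hδ1 : δ < 1) (hb : 0 ≤ b) (hfs : fs ∈ tuples F)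
    (hfix : IsBellmanImage M am fs fs) (hf : ∀ k < K, f k ∈ tuples F)
    (hsum : ∑ k ∈ Finset.range K, errorSum M am (f k) (x k) ≤ (10 * threshold F K δ + 3) * b) :
    ∑ k ∈ Finset.range K, errorSum M am (f k) (x k) ≤ 15 * threshold F K δ * b := by
  rcases (Nat.one_le_iff_ne_zero.2 (prod_card_pos hF).ne').eq_or_lt with hone | htwo
  · have hsingle (k : ℕ) (hk : k < K) : f k = fs := funext fun h =>
      Finset.card_le_one.1 (hone ▸ card_le_prod_card hF h) _ (hf k hk h) _ (hfs h)
    have hβ := threshold_pos hH hK hF hδ hδ1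
    rw [Finset.sum_eq_zero fun k hk => by
      rw [hsingle k (Finset.mem_range.1 hk), errorSum_eq_zero hfix]]
    positivity
  · have hβ := log_two_le_threshold hH hK hδ hδ1 htwo
    exact hsum.trans (mul_le_mul_of_nonneg_right (by linarith [Real.log_two_gt_d9]) hb)

end Card

lemma sum_errorSum_le_of_forall {f : ℕ → Fin H → CondDens X A lam} {x : ℕ → X} {b : ℝ}
    (h : ∀ h : Fin H, ∑ k ∈ Finset.range K,
      ∫ xa, bellmanError M am (f k) h xa ∂(M.occ (greedyPolicy am (f k)) h (x k)) ≤ b) :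
    ∑ k ∈ Finset.range K, errorSum M am (f k) (x k) ≤ H * b := by
  simp only [errorSum]
  rw [Finset.sum_comm]
  refine (Finset.sum_le_card_nsmul _ _ _ fun i _ => h i).trans_eq ?_
  rw [nsmul_eq_mul, Finset.card_univ, Fintype.card_fin]

variable [Fintype A]

section Average

variable (M am) in
/-- The average of the Bellman error of `f` over the actions, as in the V-type dimension. -/
def avgError (f : Fin H → CondDens X A lam) (h : Fin H) (x : X) : ℝ :=
  (∑ a : A, bellmanError M am f h (x, a)) / (Fintype.card A : ℝ)

variable {f g : Fin H → CondDens X A lam} (hg : IsBellmanImage M am f g) (h : Fin H)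
include hg

lemma bddMeas_avgError : BddMeas (avgError M am f h) := by
  have havg := (BddMeas.sum Finset.univ fun (a : A) _ =>
    (bddMeas_bellmanError hg h).comp (measurable_prodMk_right (y := a))).mul
      (BddMeas.const (Fintype.card A : ℝ)⁻¹)
  simp only [← div_eq_mul_inv] at havg
  exact havg

lemma avgError_nonneg (x : X) : 0 ≤ avgError M am f h x :=
  div_nonneg (Finset.sum_nonneg fun _ _ => bellmanError_nonneg hg h _) (Nat.cast_nonneg _)

lemma avgError_le_two [Nonempty A] (x : X) : avgError M am f h x ≤ 2 := by
  rw [avgError, div_le_iff₀ (Nat.cast_pos.2 Fintype.card_pos)]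
  refine (Finset.sum_le_card_nsmul _ _ 2 fun a _ => bellmanError_le_two hg h (x, a)).trans_eq ?_
  rw [nsmul_eq_mul, Finset.card_univ, mul_comm]

variable [Nonempty A]

lemma bellmanError_le_card_mul_avgError (x : X) (a : A) :
    bellmanError M am f h (x, a) ≤ Fintype.card A * avgError M am f h x := by
  rw [avgError, mul_div_cancel₀ _ (Nat.cast_ne_zero.2 Fintype.card_ne_zero)]
  exact Finset.single_le_sum (f := fun a => bellmanError M am f h (x, a))
    (fun _ _ => bellmanError_nonneg hg h _) (Finset.mem_univ a)

lemma integral_explore_true (π : Policy X A) (x : X) :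
    ∫ xa, bellmanError M am f h xa ∂(M.explore true π h x) =
      ∫ x', avgError M am f h x' ∂(M.stateOcc π h x) := by
  have hbdd := bddMeas_bellmanError hg h
  rw [MDP.explore, if_pos rfl, Kernel.integral_comp (hbdd.integrable _)]
  congr 1 with x'
  rw [integral_id_prod hbdd.measurable, Kernel.const_apply,
    integral_toMeasure_eq_sum _ (hbdd.comp measurable_prodMk_left).measurable, avgError,
    Finset.sum_div]
  simp [PMF.uniformOfFintype_apply, div_eq_inv_mul]

lemma integral_occ_le_card_mul (x : X) :
    ∫ xa, bellmanError M am f h xa ∂(M.occ (greedyPolicy am f) h x) ≤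
      Fintype.card A * ∫ x', avgError M am f h x' ∂(M.stateOcc (greedyPolicy am f) h x) := by
  have hbdd := bddMeas_bellmanError hg h
  rw [integral_occ_greedy M f hbdd, stateOcc_eq, ← integral_const_mul]
  exact integral_mono ((hbdd.comp (measurable_graph_greedyAct am _)).integrable _)
    (((BddMeas.const _).mul (bddMeas_avgError hg h)).integrable _)
    fun x' => bellmanError_le_card_mul_avgError hg h x' _

end Average

variable [Nonempty A] {f : ℕ → Fin H → CondDens X A lam} {x : ℕ → X} (hK : 0 < K)
  (hPol : ∀ f ∈ tuples F, greedyPolicy am f ∈ Pol) (hcomplete : BellmanComplete M Pol F)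
  (hf : ∀ k < K, f k ∈ tuples F) (hB : 0 ≤ B)
include hK hPol hcomplete hf hB

theorem sum_errorSum_le_dimQ (hdim : dimQ M am Pol F (1 / (K : ℝ)) ≤ d)
    (hpast : ∀ k < K, ∀ h, ∑ i ∈ Finset.range k, ∫ xa, bellmanError M am (f k) h xa
      ∂(M.explore false (greedyPolicy am (f i)) h (x i)) ≤ B) :
    ∑ k ∈ Finset.range K, errorSum M am (f k) (x k) ≤
      H * ((B + 3) * ((max 1 d : ℕ) : ℝ) * (1 + Real.log K)) := by
  choose g _ hg using fun k hk => exists_isBellmanImage hPol hcomplete (hf k hk)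
  exact sum_errorSum_le_of_forall fun h => sum_integral_le_of_eluderDim_le
    (μ := fun k => M.occ (greedyPolicy am (f k)) h (x k)) hK ((le_iSup _ h).trans hdim)
    (fun k hk => ⟨f k, hf k hk, rfl⟩) (fun k hk => ⟨_, hPol _ (hf k hk), x k, rfl⟩)
    (fun k hk => bddMeas_bellmanError (hg k hk) h) (fun k hk => bellmanError_nonneg (hg k hk) h)
    (fun k hk => bellmanError_le_two (hg k hk) h) hB fun k hk => hpast k hk h

theorem sum_errorSum_le_dimV (hdim : dimV M am Pol F (1 / (K : ℝ)) ≤ d)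
    (hpast : ∀ k < K, ∀ h, ∑ i ∈ Finset.range k, ∫ xa, bellmanError M am (f k) h xa
      ∂(M.explore true (greedyPolicy am (f i)) h (x i)) ≤ B) :
    ∑ k ∈ Finset.range K, errorSum M am (f k) (x k) ≤
      H * (Fintype.card A * ((B + 3) * ((max 1 d : ℕ) : ℝ) * (1 + Real.log K))) := by
  choose g _ hg using fun k hk => exists_isBellmanImage hPol hcomplete (hf k hk)
  refine sum_errorSum_le_of_forall fun h => ?_
  calc ∑ k ∈ Finset.range K,
        ∫ xa, bellmanError M am (f k) h xa ∂(M.occ (greedyPolicy am (f k)) h (x k))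
      ≤ Fintype.card A * ∑ k ∈ Finset.range K,
          ∫ s, avgError M am (f k) h s ∂(M.stateOcc (greedyPolicy am (f k)) h (x k)) := by
        rw [Finset.mul_sum]
        exact Finset.sum_le_sum fun k hk =>
          integral_occ_le_card_mul (hg k (Finset.mem_range.1 hk)) h (x k)
    _ ≤ _ := by
        refine mul_le_mul_of_nonneg_left (sum_integral_le_of_eluderDim_le
          (μ := fun k => M.stateOcc (greedyPolicy am (f k)) h (x k)) hK ((le_iSup _ h).trans hdim)
          (fun k hk => ⟨f k, hf k hk, rfl⟩) (fun k hk => ⟨_, hPol _ (hf k hk), x k, rfl⟩)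
          (fun k hk => bddMeas_avgError (hg k hk) h) (fun k hk => avgError_nonneg (hg k hk) h)
          (fun k hk s => avgError_le_two (hg k hk) h s) hB fun k hk => ?_) (Nat.cast_nonneg _)
        rw [← Finset.sum_congr rfl fun i _ => integral_explore_true (hg k hk) h _ _]
        exact hpast k hk h

end ErrorBound

section Mixture

variable {X A : Type*} [MeasurableSpace X] [MeasurableSpace A] (M : MDP X A)

lemma integrable_ret (π : Policy X A) (H : ℕ) (x : X) :
    Integrable ret (M.roll π H 0 x) :=
  ((bddMeas_clampedRet H).integrable _).congr (ret_ae_eq_clampedRet M π x).symm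

lemma card_mul_mixtureValue {H K : ℕ} (hK : 0 < K) (π : ℕ → Policy X A) (x : X) :
    (K : ℝ) * M.mixtureValue H K π x = ∑ k ∈ Finset.range K, M.value H (π k) x := by
  rw [MDP.mixtureValue, integral_smul_measure,
    integral_finsetSum_measure fun k _ => integrable_ret M (π k) H x, ENNReal.toReal_inv,
    ENNReal.toReal_natCast, smul_eq_mul, mul_inv_cancel_left₀ (Nat.cast_ne_zero.2 hK.ne')]
  rfl

end Mixture

section Regret

variable {X A : Type*} [MeasurableSpace X] [MeasurableSpace A] {lam : Measure ℝ} {H : ℕ}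
  [SigmaFinite lam] [Fintype A] [Nonempty A] {Ω : Type*} [MeasurableSpace Ω]
  {Pr : Measure Ω} {M : MDP X A} {am : ArgminRule A} {F : Fin H → Finset (CondDens X A lam)}
  {K : ℕ} {uae : Bool} {Pol : Set (Policy X A)} {β : ℝ} {fs : Fin H → CondDens X A lam}

namespace ODiscoRun

section Pathwise

variable (R : ODiscoRun Pr M am F β K uae) {ω : Ω}

lemma sumVar_nonneg (ω : Ω) : 0 ≤ R.sumVar ω :=
  Finset.sum_nonneg fun _ _ => variance_nonneg _ _

lemma card_mul_mixtureValue_sub_optValue (hK : 0 < K) {x : X} (hx : ∀ k < K, R.x₁ k ω = x) :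
    (K : ℝ) * (M.mixtureValue H K (fun k => R.pol k ω) x - M.optValue H x) = R.regret ω := by
  rw [ODiscoRun.regret, Finset.sum_congr rfl fun k hk => by rw [hx k (Finset.mem_range.1 hk)],
    Finset.sum_sub_distrib, ← card_mul_mixtureValue M hK, Finset.sum_const, Finset.card_range,
    nsmul_eq_mul, mul_sub]

variable {R}

lemma IsGood.sel_mem_conf (hgood : R.IsGood fs ω) {k : ℕ} (hk : k < K) :
    R.sel k ω ∈ R.conf k ω :=
  (R.sel_optimistic k hk ω ⟨fs, (hgood k hk).1⟩).1

lemma IsGood.potential_le_optValue (hgood : R.IsGood fs ω) (hfix : IsBellmanImage M am fs fs)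
    (hlam : ∀ᵐ y ∂lam, y ∈ Set.Icc (0 : ℝ) 1) {k : ℕ} (hk : k < K) :
    potential am (R.sel k ω) 0 (R.x₁ k ω) ≤ M.optValue H (R.x₁ k ω) := by
  have hfs := (hgood k hk).1
  have hopt := (R.sel_optimistic k hk ω ⟨fs, hfs⟩).2 fs hfs
  rw [optimisticValue_eq_potential am, optimisticValue_eq_potential am] at hopt
  exact hopt.trans (DistRL.potential_le_optValue hlam hfix _)

lemma IsGood.regret_le (hgood : R.IsGood fs ω) (hfix : IsBellmanImage M am fs fs)
    (hlam : ∀ᵐ y ∂lam, y ∈ Set.Icc (0 : ℝ) 1) (hPol : ∀ f ∈ tuples F, greedyPolicy am f ∈ Pol)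
    (hcomplete : BellmanComplete M Pol F) {s : ℝ} (hs : 0 < s) (hs1 : s ≤ 1) :
    R.regret ω ≤ 2 * s * (6 * H * R.sumVar ω +
        18 * H ^ 2 * ∑ k ∈ Finset.range K, errorSum M am (R.sel k ω) (R.x₁ k ω)) +
      (∑ k ∈ Finset.range K, errorSum M am (R.sel k ω) (R.x₁ k ω)) / s := by
  rw [sumVar, regret, Finset.sum_div, Finset.mul_sum, Finset.mul_sum, ← Finset.sum_add_distrib,
    Finset.mul_sum, ← Finset.sum_add_distrib]
  refine Finset.sum_le_sum fun k hk => ?_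
  have hkK := Finset.mem_range.1 hk
  obtain ⟨g, -, hg⟩ := exists_isBellmanImage hPol hcomplete (R.sel_mem k hkK ω)
  exact (sub_le_sub_left (hgood.potential_le_optValue hfix hlam hkK) _).trans
    (value_sub_potential_le hlam hg (R.x₁ k ω) hs hs1)

end Pathwise

theorem measure_regret_gt_le [IsProbabilityMeasure Pr] {δ a D : ℝ}
    (R : ODiscoRun Pr M am F (threshold F K δ) K uae) (hH : 0 < H) (hK : 0 < K)
    (hlam : ∀ᵐ y ∂lam, y ∈ Set.Icc (0 : ℝ) 1) (hF : ∀ h, (F h).Nonempty)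
    (hPol : ∀ f ∈ tuples F, greedyPolicy am f ∈ Pol) (hcomplete : BellmanComplete M Pol F)
    (hδ : 0 < δ) (hδ1 : δ < 1) (ha : 0 < a) (hD : 0 < D)
    (herr : ∀ ω, (∀ k < K, ∀ h, ∑ i ∈ Finset.range k, R.explError (R.sel k ω) h i ω ≤
        10 * threshold F K δ) →
      ∑ k ∈ Finset.range K, errorSum M am (R.sel k ω) (R.x₁ k ω) ≤
        H * (a * ((10 * threshold F K δ + 3) * D * (1 + Real.log K)))) :
    Pr {ω | ¬ R.regret ω ≤
        180 * sharpBound H a (R.sumVar ω) D (threshold F K δ) (1 + Real.log K)} ≤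
      ENNReal.ofReal δ := by
  obtain ⟨fs, hfs, hfix⟩ := exists_fixedPoint hF hPol hcomplete
  refine (measure_mono fun ω hω => ?_).trans
    (R.measure_not_isGood_le hH hK hF hPol hcomplete hδ hδ1 hfs hfix)
  refine fun hgood => hω ?_
  have hL : 0 < 1 + Real.log K := add_pos_of_pos_of_nonneg one_pos (Real.log_natCast_nonneg K)
  have hsum := herr ω fun k hk => (hgood k hk).2 _ (hgood.sel_mem_conf hk)
  have hsum' := sum_errorSum_le_threshold_mul (b := H * a * D * (1 + Real.log K)) hH hK hF hδ hδ1
    (by positivity) hfs hfix (fun k hk => R.sel_mem k hk ω) (hsum.trans_eq (by ring))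
  exact le_sharpBound_of_forall_scale hH ha (R.sumVar_nonneg ω) hD (threshold_pos hH hK hF hδ hδ1)
    hL (hsum'.trans_eq (by ring)) fun s hs hs1 => hgood.regret_le hfix hlam hPol hcomplete hs hs1

end ODiscoRun

end Regret

end DistRL

end

theorem mainTheorem1_general {X : Type u} {A : Type v} {Ω : Type w} [MeasurableSpace X]
    [Fintype A] [Nonempty A] [MeasurableSpace A] [MeasurableSpace Ω] {Pr : Measure Ω}
    [IsProbabilityMeasure Pr] {lam : Measure ℝ} [SigmaFinite lam]
    (hlam : lam (Set.Icc (0 : ℝ) 1)ᶜ = 0) {H K : ℕ} (hH : 0 < H) (hK : 0 < K) {M : MDP X A}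
    {am : ArgminRule A} {F : Fin H → Finset (CondDens X A lam)} (hF : ∀ h, (F h).Nonempty)
    {Pol : Set (Policy X A)} (hPol : ∀ f ∈ tuples F, greedyPolicy am f ∈ Pol)
    (hcomplete : BellmanComplete M Pol F) {δ : ℝ} (hδ : 0 < δ) (hδ1 : δ < 1) :
    (∀ (R : ODiscoRun Pr M am F (threshold F K δ) K false) (d : ℕ),
      dimQ M am Pol F (1 / (K : ℝ)) ≤ d →
      Pr {ω | ¬ R.regret ω ≤ 180 * sharpBound H 1 (R.sumVar ω) ((max 1 d : ℕ) : ℝ)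
        (threshold F K δ) (1 + Real.log K)} ≤ ENNReal.ofReal δ) ∧
    (∀ (R : ODiscoRun Pr M am F (threshold F K δ) K true) (d : ℕ),
      dimV M am Pol F (1 / (K : ℝ)) ≤ d →
      Pr {ω | ¬ (
        R.regret ω ≤ 180 * sharpBound H (Fintype.card A) (R.sumVar ω) ((max 1 d : ℕ) : ℝ)
          (threshold F K δ) (1 + Real.log K) ∧
        ∀ x : X, (∀ k < K, R.x₁ k ω = x) →
          (K : ℝ) * (M.mixtureValue H K (fun k => R.pol k ω) x - M.optValue H x) ≤
            180 * sharpBound H (Fintype.card A) (R.sumVar ω) ((max 1 d : ℕ) : ℝ)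
              (threshold F K δ) (1 + Real.log K))} ≤ ENNReal.ofReal δ) := by
  have hB : 0 ≤ 10 * threshold F K δ := by linarith [threshold_pos hH hK hF hδ hδ1]
  have hD (d : ℕ) : (0 : ℝ) < ((max 1 d : ℕ) : ℝ) := Nat.cast_pos.2 (lt_max_of_lt_left one_pos)
  refine ⟨fun R d hd => ?_, fun R d hd => ?_⟩
  · refine R.measure_regret_gt_le hH hK hlam hF hPol hcomplete hδ hδ1 one_pos (hD d) fun ω hω => ?_
    rw [one_mul]
    exact sum_errorSum_le_dimQ hK hPol hcomplete (fun k hk => R.sel_mem k hk ω) hB hd hω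
  · refine (measure_mono ?_).trans
      (R.measure_regret_gt_le hH hK hlam hF hPol hcomplete hδ hδ1
        (Nat.cast_pos.2 Fintype.card_pos) (hD d) fun ω hω =>
          sum_errorSum_le_dimV hK hPol hcomplete (fun k hk => R.sel_mem k hk ω) hB hd hω)
    exact fun ω hω hreg => hω
      ⟨hreg, fun x hx => (R.card_mul_mixtureValue_sub_optValue hK hx).trans_le hreg⟩

theorem mainTheorem1 :
    ∃ c : ℝ, 0 < c ∧
      ∀ (X : Type u) (A : Type v) (Ω : Type w) [MeasurableSpace X]
        [Fintype A] [Nonempty A] [MeasurableSpace A] [MeasurableSingletonClass A]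
        [MeasurableSpace Ω] (Pr : Measure Ω) [IsProbabilityMeasure Pr]
        (lam : Measure ℝ) [SigmaFinite lam] (_ : lam (Set.Icc (0 : ℝ) 1)ᶜ = 0)
        (H K : ℕ) (_ : 0 < H) (_ : 0 < K)
        (M : MDP X A) (_ : M.Normalized H) (am : ArgminRule A)
        (F : Fin H → Finset (CondDens X A lam)) (_ : ∀ h, (F h).Nonempty)
        (Pol : Set (Policy X A)) (_ : ∀ f ∈ tuples F, greedyPolicy am f ∈ Pol)
        (_ : BellmanComplete M Pol F)
        (δ : ℝ) (_ : 0 < δ) (_ : δ < 1),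
        -- without uniform action exploration
        (∀ (R : ODiscoRun Pr M am F (threshold F K δ) K false)
          (d : ℕ), dimQ M am Pol F (1 / (K : ℝ)) = d →
          Pr {ω | ¬ R.regret ω ≤ c * secondOrderBound H 1 (R.sumVar ω) ((max 1 d : ℕ) : ℝ)
              (threshold F K δ) (1 + Real.log K)} ≤ ENNReal.ofReal δ) ∧
        -- with uniform action exploration
        (∀ (R : ODiscoRun Pr M am F (threshold F K δ) K true)
          (d : ℕ), dimV M am Pol F (1 / (K : ℝ)) = d →
          Pr {ω | ¬ (
              R.regret ω ≤ c * secondOrderBound H (Fintype.card A) (R.sumVar ω)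
                ((max 1 d : ℕ) : ℝ) (threshold F K δ) (1 + Real.log K) ∧
              ∀ x : X, (∀ k < K, R.x₁ k ω = x) →
                (K : ℝ) * (M.mixtureValue H K (fun k => R.pol k ω) x - M.optValue H x) ≤
                  c * secondOrderBound H (Fintype.card A) (R.sumVar ω)
                    ((max 1 d : ℕ) : ℝ) (threshold F K δ) (1 + Real.log K))}
            ≤ ENNReal.ofReal δ) := by
  refine ⟨180, by norm_num, fun X A Ω _ _ _ _ _ _ Pr _ lam _ hlam H K hH hK M _ am F hF Pol hPol
    hcomplete δ hδ hδ1 => ?_⟩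
  have hsharp {a V : ℝ} (ha : 0 ≤ a) (d : ℕ) :
      180 * sharpBound H a V ((max 1 d : ℕ) : ℝ) (threshold F K δ) (1 + Real.log K) ≤
        180 * secondOrderBound H a V ((max 1 d : ℕ) : ℝ) (threshold F K δ) (1 + Real.log K) :=
    mul_le_mul_of_nonneg_left (sharpBound_le_secondOrderBound hH ha (Nat.cast_nonneg _)
      (threshold_pos hH hK hF hδ hδ1).le
      (add_nonneg zero_le_one (Real.log_natCast_nonneg K))) (by norm_num)
  obtain ⟨hQ, hV⟩ :=
    mainTheorem1_general (Pr := Pr) hlam hH hK (am := am) hF hPol hcomplete hδ hδ1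
  exact ⟨fun R d hd => le_trans (measure_mono fun ω => mt fun hreg => hreg.trans
      (hsharp zero_le_one d)) (hQ R d hd.le),
    fun R d hd => le_trans (measure_mono fun ω => mt fun hreg =>
      ⟨hreg.1.trans (hsharp (Nat.cast_nonneg _) d),
        fun x hx => (hreg.2 x hx).trans (hsharp (Nat.cast_nonneg _) d)⟩) (hV R d hd.le)⟩
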